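/- Let $m\ge 1$ be an integer. **Fock spaces and the vertex operator.** Let $H$ be the Heisenberg algebra with basis $h_i$ ($i\in\mathbb Z$) and $[h_i,h_j]=i\,\delta_{i+j,0}$. For $s\in\mathbb R$ let $H_s=\mathbb C[h_{-1},h_{-2},\dots]\cdot|s\rangle$ be the Fock module with $h_0|s\rangle=s|s\rangle$ and $h_i|s\rangle=0$ for $i>0$. On $\mathcal F=\bigoplus_{c\in\mathbb Z}H_{c/\sqrt{2m}}$, which is the direct sum of the irreducible modules $L_{(m),i}$, $0\le i<2m$, of the lattice vertex algebra of $\mathbb Z l$, $\langle l,l\rangle=2m$, consider the bosonic vertex operator $$\phi_{\sqrt{2m}}(z)=T\,z^{\sqrt{2m}\,h_0}\exp\Big(\sqrt{2m}\sum_{n>0}\frac{h_{-n}}{n}z^{n}\Big)\exp\Big(-\sqrt{2m}\sum_{n>0}\frac{h_{n}}{n}z^{-n}\Big)=\sum_{n\in\mathbb Z}a_nz^{-n-1},$$ where $T:H_s\to H_{s+\sqrt{2m}}$ sends $|s\rangle$ to $|s+\sqrt{2m}\rangle$ and commutes with all $h_i$, $i\neq0$. For $p\in\mathbb Z$ put $v_p=|{-p}/{\sqrt{2m}}\rangle$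 (so that $a_iv_p=0$ for $i\ge p$). For $p>0$ let $$V_{(m)}(p)=\mathbb C[a_{p-1},a_{p-2},\dots,a_0]\cdot v_p,$$ and, for $k\ge 0$, let $V_{(m)}^{-p/\sqrt{2m}+k\sqrt{2m}}(p)$ be the subspace of $V_{(m)}(p)$ on which $h_0$ acts as $-\frac{p}{\sqrt{2m}}+k\sqrt{2m}$. **Jack polynomials.** Let $\Lambda=\mathbb C[p_1,p_2,\dots]$ be the algebra of symmetric functions in infinitely many variables $\mathbf x$, where $p_k$ is the $k$-th power sum, with the bilinear form for which the monomials in the $p_s$ are orthogonal and $$\Big\langle \prod_s p_s^{i_s},\prod_s p_s^{i_s}\Big\rangle_m=m^{-\sum_s i_s}\prod_s s^{i_s}\,i_s!.$$ Let $m_\lambda$ be the monomial symmetric functions and $\le$ the dominance order on partitions of the same size. The Jack polynomials $J_\lambda(m;\mathbf x)\in\Lambda$ ($\lambda$ any partition) with coupling $m$ are characterized by $$J_\lambda=m_\lambda+\sum_{\mu<\lambda}v_{\lambda\mu}m_\mu\ \ (v_{\lambda\mu}\in\mathbb C),\qquad \langle J_\lambda,J_\mu\rangle_m=0\ \text{ for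 }\lambda\ne\mu .$$ For $s\in\mathbb R$ let $I:H_s\to\Lambda$ be the linear isomorphism $h_{-i_1}\cdots h_{-i_r}|s\rangle\mapsto\big(\sqrt{m/2}\big)^{r}p_{i_1}\cdots p_{i_r}$, and put $\widehat J_\lambda(m;\mathbf x)=I^{-1}(J_\lambda(m;\mathbf x))\in H_s$. **Theorem.** There is exactly one family $(J_\lambda(m;\mathbf x))_\lambda$ with the two properties above. For all integers $p>0$ and $k\ge 0$, the space $V_{(m)}^{-p/\sqrt{2m}+k\sqrt{2m}}(p)$ has as a basis the vectors $$\widehat J_\mu(m;\mathbf x)\in H_{-p/\sqrt{2m}+k\sqrt{2m}},\qquad \mu\subset\big((p-(k-1)m-1)^k\big),$$ where $\mu$ runs over all partitions with at most $k$ parts, all of them at most $p-(k-1)m-1$. (If $k\ge1$ and $p-(k-1)m-1<0$, the rectangle does not exist, there is no such $\mu$, and the space is zero.) -/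

import Mathlib

open scoped Nat

noncomputable section

namespace BosonicVertex

/-! ### Symmetric functions and Jack polynomials -/

/-- The algebra `Λ = ℂ[p₁, p₂, …]` of symmetric functions over `ℂ` in infinitely many variables;
the variable `X k` is the power sum `p_k`. -/
abbrev SymFun : Type := MvPolynomial ℕ+ ℂ

/-- The power sum `x₀ ^ k + x₁ ^ k + …` as a formal power series in infinitely many variables. -/
def powerSum (k : ℕ+) : MvPowerSeries ℕ ℂ :=
  open Classical in fun e => if ∃ i : ℕ, e = Finsupp.single i (k : ℕ) then 1 else 0

/-- The expansion of a symmetric function as a formal power series in `x₀, x₁, …`. -/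
def expand : SymFun →ₐ[ℂ] MvPowerSeries ℕ ℂ :=
  MvPolynomial.aeval powerSum

/-- The monomial symmetric function `m_μ`: the sum of all distinct monomials in `x₀, x₁, …` whose
nonzero exponents are, in some order, the parts of `μ`. -/
def monomialSym (μ : YoungDiagram) : MvPowerSeries ℕ ℂ :=
  open Classical in
  fun e => if e.support.val.map (fun i => e i) = (μ.rowLens : Multiset ℕ) then 1 else 0

/-- The dominance order on partitions of the same size: `μ ≤ lam`. -/
def DominatedBy (μ lam : YoungDiagram) : Prop :=
  μ.card = lam.card ∧
    ∀ i : ℕ, ∑ j ∈ Finset.range i, μ.rowLen j ≤ ∑ j ∈ Finset.range i, lam.rowLen j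

/-- The bilinear form on `Λ` with coupling constant `α` for which the products of power sums are
orthogonal and `⟨∏ p_s ^ e_s, ∏ p_s ^ e_s⟩ = α ^ (-∑ e_s) * ∏ s ^ e_s * e_s !`. -/
def jackForm (α : ℂ) (f g : SymFun) : ℂ :=
  ∑ e ∈ f.support, f.coeff e * g.coeff e *
    e.prod fun s t => α⁻¹ ^ t * ((s : ℕ) : ℂ) ^ t * (t ! : ℂ)

/-- The two properties characterizing the family of Jack polynomials `J_lam(α; x)`:
`J_lam = m_lam + (combination of the m_μ with μ < lam in the dominance order)`,
and `J_lam`, `J_μ` are orthogonal for `lam ≠ μ`. -/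
structure IsJackFamily (α : ℂ) (J : YoungDiagram → SymFun) : Prop where
  triangular : ∀ lam : YoungDiagram, ∃ v : YoungDiagram →₀ ℂ,
    (∀ μ, v μ ≠ 0 → DominatedBy μ lam ∧ μ ≠ lam) ∧
      expand (J lam) = monomialSym lam + v.sum fun μ c => c • monomialSym μ
  orthogonal : ∀ lam μ : YoungDiagram, lam ≠ μ → jackForm α (J lam) (J μ) = 0

/-! ### Fock spaces -/

/-- The underlying space `ℂ[h₋₁, h₋₂, …]` of each of the Fock modules `H_s`; the variable `X n` is
`h₋ₙ`, and `1` is the highest weight vector `|s⟩`. -/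
abbrev Fock : Type := MvPolynomial ℕ+ ℂ

/-- `h₋ₙ` for `n > 0`: multiplication by the variable. -/
def create (n : ℕ+) : Module.End ℂ Fock :=
  LinearMap.mulLeft ℂ (MvPolynomial.X n)

/-- `hₙ` for `n > 0`: it acts as `n ∂/∂h₋ₙ`, so that `[hₙ, h₋ₙ] = n` and `hₙ |s⟩ = 0`. -/
def annihilate (n : ℕ+) : Module.End ℂ Fock :=
  ((n : ℕ) : ℂ) • (MvPolynomial.pderiv n : Derivation ℂ Fock Fock).toLinearMap

/-- `⨁ H_{c / √(2m)}`, the sum over all `c : ℤ`, which is the direct sum of the irreducible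
modules `L_{(m),i}`, `0 ≤ i < 2m`, of the lattice vertex algebra. The component at `c` is
`H_{c / √(2m)}`. -/
abbrev FockSum : Type := ℤ →₀ Fock

/-- The operator `h₀`, acting on `H_{c / √(2m)}` as the scalar `c / √(2m)`. -/
def h0 (m : ℕ) : Module.End ℂ FockSum :=
  Finsupp.lsum ℂ fun c : ℤ =>
    (((c : ℝ) / √(2 * (m : ℝ)) : ℝ) : ℂ) • (Finsupp.lsingle c : Fock →ₗ[ℂ] FockSum)

/-- The extremal vector `v_p = |-p / √(2m)⟩`. -/
def extremal (p : ℤ) : FockSum := Finsupp.single (-p) 1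

/-! ### The bosonic vertex operator -/

/-- The coefficient of `z ^ j` in the formal exponential
`exp (∑_{n > 0} b n z ^ n) = ∑_r (∑_{n > 0} b n z ^ n) ^ r / r !`
(the terms with `r > j` do not contribute). -/
def expCoeff {R : Type*} [Ring R] [Algebra ℂ R] (b : ℕ+ → R) (j : ℕ) : R :=
  ∑ r ∈ Finset.range (j + 1), ((r ! : ℂ)⁻¹) •
    PowerSeries.coeff j
      ((PowerSeries.mk fun n : ℕ => if hn : 0 < n then b ⟨n, hn⟩ else 0) ^ r)

/-- The coefficient of `z ^ i` in `exp (√(2m) ∑_{n > 0} h₋ₙ z ^ n / n)`, for `i : ℤ`. -/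
def creationCoeff (m : ℕ) (i : ℤ) : Module.End ℂ Fock :=
  if 0 ≤ i then
    expCoeff (fun n => ((√(2 * (m : ℝ)) / (n : ℕ) : ℝ) : ℂ) • create n) i.toNat
  else 0

/-- The coefficient of `z ^ (-j)` in `exp (-√(2m) ∑_{n > 0} hₙ z ^ (-n) / n)`. -/
def annihilationCoeff (m : ℕ) (j : ℕ) : Module.End ℂ Fock :=
  expCoeff (fun n => ((-√(2 * (m : ℝ)) / (n : ℕ) : ℝ) : ℂ) • annihilate n) j

/-- The weight `∑ n * e_n` of the monomial `∏ h₋ₙ ^ e_n`. -/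
def weight (e : ℕ+ →₀ ℕ) : ℤ := e.sum fun n t => ((n : ℕ) : ℤ) * (t : ℤ)

/-- The operator `T` lowers weights by at least `n`. -/
def Lowers (T : Module.End ℂ Fock) (n : ℤ) : Prop :=
  ∀ (d : ℤ) (f : Fock), (∀ e, f.coeff e ≠ 0 → weight e ≤ d) →
    ∀ e, (T f).coeff e ≠ 0 → weight e ≤ d - n

theorem weight_nonneg (e : ℕ+ →₀ ℕ) : 0 ≤ weight e :=
  Finset.sum_nonneg fun _ _ => by positivity

theorem Lowers.smul {T : Module.End ℂ Fock} {n : ℤ} (hT : Lowers T n) (c : ℂ) :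
    Lowers (c • T) n := by
  intro d f hf e he
  refine hT d f hf e fun h => he ?_
  simp [h]

theorem Lowers.sum {ι : Type*} {s : Finset ι} {T : ι → Module.End ℂ Fock} {n : ℤ}
    (hT : ∀ i ∈ s, Lowers (T i) n) : Lowers (∑ i ∈ s, T i) n := by
  intro d f hf e he
  rw [LinearMap.sum_apply, MvPolynomial.coeff_sum] at he
  obtain ⟨i, hi, h⟩ := Finset.exists_ne_zero_of_sum_ne_zero he
  exact hT i hi d f hf e h

theorem Lowers.mul {S T : Module.End ℂ Fock} {k n : ℤ} (hS : Lowers S k) (hT : Lowers T n) :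
    Lowers (S * T) (k + n) := by
  intro d f hf e he
  have := hS (d - n) (T f) (hT d f hf) e he
  linarith

theorem lowers_zero (n : ℤ) : Lowers 0 n := fun d f _ e he => absurd (by simp) he

theorem lowers_one : Lowers 1 0 := fun d f hf e he => by simpa using hf e he

theorem lowers_annihilate (n : ℕ+) : Lowers (annihilate n) (n : ℕ) := by
  intro d f hf e he
  have h : f.coeff (e + Finsupp.single n 1) ≠ 0 := by
    intro h
    apply he
    simp [annihilate, MvPolynomial.coeff_pderiv, h]
  have h1 := hf _ h
  have h2 : weight (e + Finsupp.single n 1) = weight e + (n : ℕ) := by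
    unfold weight
    rw [Finsupp.sum_add_index' (by simp) (by intros; push_cast; ring)]
    simp
  linarith

theorem lowers_annihilationCoeff (m j : ℕ) : Lowers (annihilationCoeff m j) j := by
  unfold annihilationCoeff expCoeff
  refine Lowers.sum fun r hr => Lowers.smul ?_ _
  clear hr
  induction r generalizing j with
  | zero =>
    rw [pow_zero, PowerSeries.coeff_one]
    split_ifs with h
    · subst h; exact lowers_one
    · exact lowers_zero _
  | succ r ih =>
    rw [pow_succ, PowerSeries.coeff_mul]
    refine Lowers.sum fun x hx => ?_
    have hx' : (j : ℤ) = x.1 + x.2 := by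
      have := Finset.HasAntidiagonal.mem_antidiagonal.mp hx
      omega
    rw [hx']
    refine Lowers.mul (ih x.1) ?_
    rw [PowerSeries.coeff_mk]
    split_ifs with h
    · exact (lowers_annihilate ⟨x.2, h⟩).smul _
    · exact lowers_zero _

/-- On each vector only finitely many coefficients of the annihilation exponential are nonzero. -/
theorem annihilationCoeff_finite (m : ℕ) (f : Fock) :
    {j : ℕ | annihilationCoeff m j f ≠ 0}.Finite := by
  obtain ⟨d, hd⟩ : ∃ d : ℤ, ∀ e, f.coeff e ≠ 0 → weight e ≤ d := by
    obtain ⟨d, hd⟩ := (f.support.image weight).bddAbove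
    exact ⟨d, fun e he => hd (by
      simpa using ⟨e, he, rfl⟩)⟩
  refine (Set.finite_Iic d.toNat).subset fun j hj => ?_
  obtain ⟨e, he⟩ := MvPolynomial.exists_coeff_ne_zero hj
  have h1 := lowers_annihilationCoeff m j d f hd e he
  have h2 := weight_nonneg e
  simp only [Set.mem_Iic]
  omega

theorem mode_support_finite (m : ℕ) (r : ℤ) (f : Fock) :
    (Function.support fun j : ℕ =>
      creationCoeff m (r + j) (annihilationCoeff m j f)).Finite := by
  refine (annihilationCoeff_finite m f).subset fun j hj h => hj ?_
  simp [h]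

/-- The coefficient of `z ^ r` in the product
`exp (√(2m) ∑_{n > 0} h₋ₙ z ^ n / n) exp (-√(2m) ∑_{n > 0} hₙ z ^ (-n) / n)`.
The sum is finite on each vector. -/
def modeFock (m : ℕ) (r : ℤ) : Module.End ℂ Fock where
  toFun f := ∑ᶠ j : ℕ, creationCoeff m (r + j) (annihilationCoeff m j f)
  map_add' f g := by
    rw [← finsum_add_distrib (mode_support_finite m r f) (mode_support_finite m r g)]
    simp
  map_smul' c f := by
    rw [RingHom.id_apply, smul_finsum' c (mode_support_finite m r f)]
    simp

/-- The Fourier component `a_n` of the bosonic vertex operator `φ(z) = ∑ a_n z ^ (-n - 1)`,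
`φ(z) = T z ^ (√(2m) h₀) exp (√(2m) ∑_{n > 0} h₋ₙ z ^ n / n) exp (-√(2m) ∑_{n > 0} hₙ z ^ (-n) / n)`,
where `T` sends `H_s` to `H_{s + √(2m)}`, fixing polynomials. On `H_{c / √(2m)}` the factor
`z ^ (√(2m) h₀)` is `z ^ c`. -/
def a (m : ℕ) (n : ℤ) : Module.End ℂ FockSum :=
  Finsupp.lsum ℂ fun c : ℤ =>
    (Finsupp.lsingle (c + 2 * m) : Fock →ₗ[ℂ] FockSum) ∘ₗ modeFock m (-n - 1 - c)

/-! ### The finitized principal subspace -/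

/-- `V_{(m)}(p) = ℂ[a_{p-1}, …, a_0] · v_p`: the image of `v_p` under the algebra of operators
generated by `a_0, …, a_{p-1}`. -/
def finitization (m : ℕ) (p : ℤ) : Submodule ℂ FockSum :=
  (Subalgebra.toSubmodule (Algebra.adjoin ℂ (a m '' Set.Ico 0 p))).map
    (LinearMap.applyₗ (extremal p))

/-- The homogeneous component of `V_{(m)}(p)` on which `h₀` acts as `s`. -/
def component (m : ℕ) (p : ℤ) (s : ℝ) : Submodule ℂ FockSum :=
  finitization m p ⊓ Module.End.eigenspace (h0 m) (s : ℂ)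

/-- The identification `I : H_s → Λ`, `h₋ᵢ₁ ⋯ h₋ᵢₖ |s⟩ ↦ √(m/2) ^ k p_i₁ ⋯ p_iₖ`. -/
def toSymFun (m : ℕ) : Fock →ₐ[ℂ] SymFun :=
  MvPolynomial.aeval fun i => ((√((m : ℝ) / 2) : ℝ) : ℂ) • (MvPolynomial.X i : SymFun)

/-- The inverse of `I`. -/
def ofSymFun (m : ℕ) : SymFun →ₐ[ℂ] Fock :=
  MvPolynomial.aeval fun i => ((√((m : ℝ) / 2) : ℝ) : ℂ)⁻¹ • (MvPolynomial.X i : Fock)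

theorem toSymFun_ofSymFun (m : ℕ) (hm : 0 < m) (f : SymFun) : toSymFun m (ofSymFun m f) = f := by
  have h : ((√((m : ℝ) / 2) : ℝ) : ℂ) ≠ 0 := by
    have : 0 < √((m : ℝ) / 2) := Real.sqrt_pos.mpr (by positivity)
    exact_mod_cast this.ne'
  have : (toSymFun m).comp (ofSymFun m) = AlgHom.id ℂ SymFun := by
    apply MvPolynomial.algHom_ext
    intro i
    simp only [AlgHom.comp_apply, AlgHom.id_apply, ofSymFun, toSymFun, MvPolynomial.aeval_X,
      map_smul, smul_smul, inv_mul_cancel₀ h, one_smul]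
  exact DFunLike.congr_fun this f

theorem ofSymFun_toSymFun (m : ℕ) (hm : 0 < m) (f : Fock) : ofSymFun m (toSymFun m f) = f := by
  have h : ((√((m : ℝ) / 2) : ℝ) : ℂ) ≠ 0 := by
    have : 0 < √((m : ℝ) / 2) := Real.sqrt_pos.mpr (by positivity)
    exact_mod_cast this.ne'
  have : (ofSymFun m).comp (toSymFun m) = AlgHom.id ℂ Fock := by
    apply MvPolynomial.algHom_ext
    intro i
    simp only [AlgHom.comp_apply, AlgHom.id_apply, ofSymFun, toSymFun, MvPolynomial.aeval_X,
      map_smul, smul_smul, mul_inv_cancel₀ h, one_smul]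
  exact DFunLike.congr_fun this f

/-- `μ ⊂ (s ^ k)`: the partition `μ = (μ₀ ≥ μ₁ ≥ …)` is contained in the rectangle with `k` rows of
length `s`, that is, `μ_i ≤ s` for `i < k` and `μ_i = 0` for `i ≥ k`. If `k > 0` and `s < 0`, there
is no such partition. -/
def InRectangle (s : ℤ) (k : ℕ) (μ : YoungDiagram) : Prop :=
  ∀ i : ℕ, (μ.rowLen i : ℤ) ≤ if i < k then s else 0

end BosonicVertex

end

open scoped Nat

noncomputable section

/-! The proof pairs both sides with symmetric functions. Identify the Fock space with Λ and pair a
word `a_{n_0} ⋯ a_{n_{k-1}} v_p` with g under the Jack form. The adjoint of the creation exponential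
is p_r ↦ p_r + z ^ r, that is, it adjoins a variable z. The adjoint of the annihilation exponential
is multiplication by ∏ (1 - x_i / z) ^ (2m). Inductively (`form_wordFock`) the pairing is the
constant term of g(x) x ^ (n + 1 - p) ∏_{i<j} (x_i - x_j) ^ (2m) in k variables. Up to a sign the
last product is (x_0 ⋯ x_{k-1}) ^ ((k-1)m) times the torus weight ∏_{i≠j} (1 - x_i / x_j) ^ m
(`vand_pow_eq`). So the pairing is, up to that sign, the coefficient of x ^ (p - 1 - n) in (x_0 ⋯
x_{k-1}) ^ ((k-1)m) · g · weight, where the exponents p - 1 - n_i run over 0, …, p - 1.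

Jack polynomials are orthogonal for the form on Λ and also, in k variables, for the torus scalar
product. Moreover (x_0 ⋯ x_{k-1}) ^ c J_lam behaves there like the Jack polynomial of lam + (c ^ k).
If lam has at most k rows but does not fit in the rectangle, then lam_0 + (k-1)m > p - 1, so all the
coefficients above vanish for g = J_lam (`form_wordFock_jack`). If lam has more than k rows, J_lam
vanishes in k variables. Hence the words lie in the span of the J_μ with μ in the rectangle.
Conversely, a functional on that span killing all words is the pairing with some y in it. The
coefficients of y · weight then vanish on the support of y in k variables, positivity of the torus
product forces y = 0 in k variables, and Jack polynomials with at most k rows stay independent there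
(`map_span_wordFock`). No dimension count is needed.

Existence and both orthogonalities come from Macdonald's operator at q = 1 + 1/(n+1), t = q ^ m, s =
1/t. In vertex operator form it acts on Λ and is visibly self-adjoint for the Macdonald form
(`form_macdonald`). In k variables it becomes the usual difference operator, self-adjoint for the
q-torus product (`torusForm_macdonald`). It is triangular for dominance with generically distinct
eigenvalues, so it has eigenvectors m_lam + lower terms orthogonal in both senses. Their
coefficients solve a linear system whose Gram matrix tends to an invertible one, so they converge as
q → 1 and the limit inherits everything (`exists_jack`). Uniqueness follows from positivity of the
Jack form. -/

namespace BosonicVertex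

/-! ### Formal exponentials of power series. -/

section Exponential

open PowerSeries

variable {R : Type*} [CommRing R] [Algebra ℂ R]

/-- The formal exponential `exp (∑ b n z ^ n)`. -/
def expSeries (b : ℕ+ → R) : PowerSeries R := PowerSeries.mk (expCoeff b)

/-- The logarithmic derivative `∑ n * b n * z ^ (n - 1)` of `expSeries b`. -/
def logDeriv (b : ℕ+ → R) : PowerSeries R :=
  PowerSeries.mk fun i => ((i + 1 : ℕ) : R) * b i.succPNat

/-- The exponent has no constant term, so its r-th power starts in degree r and a longer truncation
changes nothing. A truncation common to several coefficients permits termwise differentiation. -/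
theorem expCoeff_eq_of_lt (b : ℕ+ → R) {j M : ℕ} (hM : j < M) :
    expCoeff b j = ∑ r ∈ Finset.range M, ((r ! : ℂ)⁻¹) •
      PowerSeries.coeff j
        ((PowerSeries.mk fun n : ℕ => if hn : 0 < n then b ⟨n, hn⟩ else 0) ^ r) := by
  unfold expCoeff
  refine Finset.sum_subset (by simpa using hM) fun r _ hr => ?_
  rw [PowerSeries.coeff_of_lt_order, smul_zero]
  refine lt_of_lt_of_le ?_ (PowerSeries.le_order_pow_of_constantCoeff_eq_zero r (by simp))
  simp at hr
  exact_mod_cast hr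

theorem expCoeff_zero (b : ℕ+ → R) : expCoeff b 0 = 1 := by
  simp [expCoeff]

theorem derivative_expSeries (b : ℕ+ → R) :
    PowerSeries.derivative R (expSeries b) = logDeriv b * expSeries b := by
  set B : PowerSeries R := PowerSeries.mk fun n : ℕ => if hn : 0 < n then b ⟨n, hn⟩ else 0 with hB
  have hB' : PowerSeries.derivative R B = logDeriv b := by
    ext i
    simp [PowerSeries.coeff_derivative, hB, logDeriv, mul_comm, Nat.succPNat]
  ext j
  have h1 : PowerSeries.coeff j (PowerSeries.derivative R (expSeries b)) =
      PowerSeries.coeff j (PowerSeries.derivative R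
        (∑ r ∈ Finset.range (j + 2), ((r ! : ℂ)⁻¹) • B ^ r)) := by
    rw [PowerSeries.coeff_derivative, PowerSeries.coeff_derivative, expSeries, PowerSeries.coeff_mk,
      expCoeff_eq_of_lt b (show j + 1 < j + 2 by omega), map_sum]
    simp [hB]
  have h2 : PowerSeries.derivative R (∑ r ∈ Finset.range (j + 2), ((r ! : ℂ)⁻¹) • B ^ r) =
      logDeriv b * ∑ r ∈ Finset.range (j + 1), ((r ! : ℂ)⁻¹) • B ^ r := by
    rw [Finset.sum_range_succ', map_add, map_sum, Finset.mul_sum]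
    have : PowerSeries.derivative R (((0 ! : ℂ)⁻¹) • B ^ 0) = 0 := by
      simp
    rw [this, add_zero]
    refine Finset.sum_congr rfl fun r _ => ?_
    have hs : PowerSeries.derivative R ((((r + 1)! : ℂ)⁻¹) • B ^ (r + 1)) =
        (((r + 1)! : ℂ)⁻¹) • PowerSeries.derivative R (B ^ (r + 1)) := by
      ext; simp
    rw [hs, Derivation.leibniz_pow, hB', Nat.add_sub_cancel, smul_eq_mul, ← Nat.cast_smul_eq_nsmul ℂ,
      smul_smul, mul_smul_comm, mul_comm (B ^ r)]
    congr 1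
    rw [Nat.factorial_succ]
    have : (r ! : ℂ) ≠ 0 := by exact_mod_cast r.factorial_ne_zero
    have : ((r : ℂ) + 1) ≠ 0 := by exact_mod_cast r.succ_ne_zero
    push_cast
    field_simp
  rw [h1, h2, PowerSeries.coeff_mul, PowerSeries.coeff_mul]
  refine Finset.sum_congr rfl fun x hx => ?_
  have hx' := Finset.HasAntidiagonal.mem_antidiagonal.mp hx
  rw [expSeries, PowerSeries.coeff_mk, expCoeff_eq_of_lt b (show x.2 < j + 1 by omega), map_sum]
  simp [hB]

theorem expCoeff_succ (b : ℕ+ → R) (j : ℕ) :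
    ((j + 1 : ℕ) : R) * expCoeff b (j + 1) =
      ∑ i ∈ Finset.range (j + 1), ((i + 1 : ℕ) : R) * b i.succPNat * expCoeff b (j - i) := by
  have h := congrArg (PowerSeries.coeff j) (derivative_expSeries b)
  rw [PowerSeries.coeff_derivative, PowerSeries.coeff_mul,
    Finset.Nat.sum_antidiagonal_eq_sum_range_succ_mk] at h
  simp only [expSeries, logDeriv, PowerSeries.coeff_mk] at h
  rw [← h]; push_cast; ring

theorem natCast_succ_mul_cancel {x y : R} (j : ℕ)
    (h : ((j + 1 : ℕ) : R) * x = ((j + 1 : ℕ) : R) * y) : x = y := by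
  have hj : ((j + 1 : ℕ) : ℂ) ≠ 0 := by exact_mod_cast j.succ_ne_zero
  have h' : ((j + 1 : ℕ) : ℂ) • x = ((j + 1 : ℕ) : ℂ) • y := by
    simpa [Algebra.smul_def] using h
  exact smul_right_injective_of_ne hj h'
where
  smul_right_injective_of_ne {c : ℂ} (hc : c ≠ 0) {x y : R} (h : c • x = c • y) : x = y := by
    have := congrArg (c⁻¹ • ·) h
    simpa [smul_smul, hc] using this

/-- The equation F' = uF determines each coefficient from the earlier ones, since positive integers
are invertible. The addition formula and the logarithm identity below are checked this way. -/
theorem eq_of_derivative_eq {u F G : PowerSeries R}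
    (hF : PowerSeries.derivative R F = u * F) (hG : PowerSeries.derivative R G = u * G)
    (h0 : PowerSeries.constantCoeff F = PowerSeries.constantCoeff G) : F = G := by
  ext j
  induction j using Nat.strong_induction_on with
  | _ j ih =>
    cases j with
    | zero => simpa using h0
    | succ j =>
      have h1 := congrArg (PowerSeries.coeff j) hF
      have h2 := congrArg (PowerSeries.coeff j) hG
      rw [PowerSeries.coeff_derivative, PowerSeries.coeff_mul] at h1 h2
      refine natCast_succ_mul_cancel j ?_
      push_cast
      rw [mul_comm, h1, mul_comm, h2]
      refine Finset.sum_congr rfl fun x hx => ?_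
      have hx' := Finset.HasAntidiagonal.mem_antidiagonal.mp hx
      rw [ih x.2 (by omega)]

theorem constantCoeff_expSeries (b : ℕ+ → R) :
    PowerSeries.constantCoeff (expSeries b) = 1 := by
  rw [← PowerSeries.coeff_zero_eq_constantCoeff_apply, expSeries, PowerSeries.coeff_mk,
    expCoeff_zero]

theorem expSeries_add (b c : ℕ+ → R) : expSeries (b + c) = expSeries b * expSeries c := by
  refine eq_of_derivative_eq (derivative_expSeries _) (u := logDeriv (b + c)) ?_ ?_
  · rw [Derivation.leibniz, derivative_expSeries, derivative_expSeries]
    have : logDeriv (b + c) = logDeriv b + logDeriv c := by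
      ext; simp [logDeriv, mul_add]
    rw [this]; simp only [smul_eq_mul]; ring
  · simp [constantCoeff_expSeries]

theorem expSeries_zero : expSeries (0 : ℕ+ → R) = 1 := by
  refine eq_of_derivative_eq (derivative_expSeries _) (u := logDeriv 0) ?_ ?_
  · have : logDeriv (0 : ℕ+ → R) = 0 := by ext; simp [logDeriv]
    rw [this]; simp
  · simp [constantCoeff_expSeries]

theorem expSeries_sum {ι : Type*} (s : Finset ι) (b : ι → ℕ+ → R) :
    expSeries (∑ i ∈ s, b i) = ∏ i ∈ s, expSeries (b i) := by
  classical
  induction s using Finset.induction_on with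
  | empty => simp [expSeries_zero]
  | insert i s hi ih => rw [Finset.sum_insert hi, Finset.prod_insert hi, expSeries_add, ih]

theorem expSeries_nsmul (r : ℕ) (b : ℕ+ → R) : expSeries (r • b) = expSeries b ^ r := by
  induction r with
  | zero => simp [expSeries_zero]
  | succ r ih => rw [succ_nsmul, expSeries_add, ih, pow_succ]

/-- `exp (-∑ (x z) ^ n / n) = 1 - x z`. -/
theorem expSeries_neg_log (x : R) :
    expSeries (fun n : ℕ+ => -((((n : ℕ) : ℂ)⁻¹) • x ^ (n : ℕ))) =
      1 - PowerSeries.C x * PowerSeries.X := by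
  refine eq_of_derivative_eq (derivative_expSeries _) ?_ ?_
  · have hu : logDeriv (fun n : ℕ+ => -((((n : ℕ) : ℂ)⁻¹) • x ^ (n : ℕ))) =
        PowerSeries.mk fun i => -x ^ (i + 1) := by
      ext i
      have hi : ((i : ℂ) + 1) ≠ 0 := by exact_mod_cast i.succ_ne_zero
      have : ((i : R) + 1) = algebraMap ℂ R ((i : ℂ) + 1) := by simp
      simp only [logDeriv, PowerSeries.coeff_mk, Nat.succPNat_coe, Nat.succ_eq_add_one]
      push_cast
      rw [this, mul_neg, ← Algebra.smul_def, smul_smul, mul_inv_cancel₀ hi, one_smul]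
    rw [hu, mul_sub, mul_one]
    ext i
    rw [map_sub, ← mul_assoc, mul_comm _ (PowerSeries.C x), mul_assoc]
    cases i with
    | zero => simp
    | succ i =>
      rw [map_sub, map_sub, PowerSeries.coeff_derivative, PowerSeries.coeff_derivative,
        PowerSeries.coeff_C_mul, PowerSeries.coeff_C_mul, PowerSeries.coeff_succ_mul_X]
      simp [PowerSeries.coeff_one, PowerSeries.coeff_X]
      ring
  · simp [constantCoeff_expSeries]

theorem map_expCoeff {S : Type*} [CommRing S] [Algebra ℂ S] (F : R →ₐ[ℂ] S) (b : ℕ+ → R) (j : ℕ) :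
    F (expCoeff b j) = expCoeff (fun n => F (b n)) j := by
  unfold expCoeff
  rw [map_sum]
  refine Finset.sum_congr rfl fun r _ => ?_
  rw [map_smul]
  congr 1
  have : PowerSeries.map (F : R →+* S)
      (PowerSeries.mk fun n : ℕ => if hn : 0 < n then b ⟨n, hn⟩ else 0) =
      PowerSeries.mk fun n : ℕ => if hn : 0 < n then F (b ⟨n, hn⟩) else 0 := by
    ext n
    simp only [PowerSeries.coeff_map, PowerSeries.coeff_mk]
    split_ifs <;> simp
  rw [← this, ← map_pow, PowerSeries.coeff_map]
  rfl

end Exponential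

/-! ### The bilinear forms making products of power sums orthogonal. -/

section Form

open MvPolynomial

/-- The squared norm of the monomial with exponents `e` under the form with weights `w`. -/
def formWeight (w : ℕ+ → ℂ) (e : ℕ+ →₀ ℕ) : ℂ := e.prod fun s t => w s ^ t * (t ! : ℂ)

theorem formWeight_add_single (w : ℕ+ → ℂ) (e : ℕ+ →₀ ℕ) (n : ℕ+) :
    formWeight w (e + Finsupp.single n 1) = w n * (e n + 1) * formWeight w e := by
  classical
  have h1 : (e + Finsupp.single n 1).support ⊆ insert n e.support := by
    intro x hx
    by_cases hxn : x = n
    · simp [hxn]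
    · simp [Ne.symm hxn] at hx
      simp [hx]
  have h2 : e.support ⊆ insert n e.support := Finset.subset_insert _ _
  unfold formWeight
  rw [Finsupp.prod_of_support_subset _ h1 _ (by simp), Finsupp.prod_of_support_subset _ h2 _ (by simp),
    ← Finset.mul_prod_erase _ _ (Finset.mem_insert_self n e.support),
    ← Finset.mul_prod_erase _ (fun s => w s ^ e s * ((e s)! : ℂ)) (Finset.mem_insert_self n e.support)]
  have h3 : ∏ s ∈ (insert n e.support).erase n, (w s ^ (e + Finsupp.single n 1 : ℕ+ →₀ ℕ) s *
      (((e + Finsupp.single n 1 : ℕ+ →₀ ℕ) s)! : ℂ)) =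
      ∏ s ∈ (insert n e.support).erase n, (w s ^ e s * ((e s)! : ℂ)) := by
    refine Finset.prod_congr rfl fun s hs => ?_
    have : n ≠ s := fun h => by simp [h] at hs
    simp [this]
  rw [h3]
  simp [Nat.factorial_succ, pow_succ]
  ring

theorem sum_form_eq (w : ℕ+ → ℂ) (f g : SymFun) {S : Finset (ℕ+ →₀ ℕ)} (hS : f.support ⊆ S) :
    ∑ e ∈ f.support, f.coeff e * g.coeff e * formWeight w e =
      ∑ e ∈ S, f.coeff e * g.coeff e * formWeight w e := by
  refine Finset.sum_subset hS fun e _ he => ?_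
  rw [MvPolynomial.notMem_support_iff.mp he]; simp

/-- The bilinear form on symmetric functions for which the products of power sums are orthogonal,
with weights `w`. -/
def form (w : ℕ+ → ℂ) : SymFun →ₗ[ℂ] SymFun →ₗ[ℂ] ℂ :=
  LinearMap.mk₂ ℂ (fun f g => ∑ e ∈ f.support, f.coeff e * g.coeff e * formWeight w e)
    (by
      classical
      intro f f' g
      rw [sum_form_eq w (f + f') g (S := f.support ∪ f'.support) MvPolynomial.support_add,
        sum_form_eq w f g (S := f.support ∪ f'.support) Finset.subset_union_left,
        sum_form_eq w f' g (S := f.support ∪ f'.support) Finset.subset_union_right,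
        ← Finset.sum_add_distrib]
      refine Finset.sum_congr rfl fun e _ => ?_
      rw [coeff_add]; ring)
    (by
      intro c f g
      rw [sum_form_eq w (c • f) g (S := f.support) MvPolynomial.support_smul, smul_eq_mul,
        Finset.mul_sum]
      refine Finset.sum_congr rfl fun e _ => ?_
      rw [coeff_smul, smul_eq_mul]; ring)
    (by
      intro f g g'
      rw [← Finset.sum_add_distrib]
      refine Finset.sum_congr rfl fun e _ => ?_
      rw [coeff_add]; ring)
    (by
      intro c f g
      rw [smul_eq_mul, Finset.mul_sum]
      refine Finset.sum_congr rfl fun e _ => ?_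
      rw [coeff_smul, smul_eq_mul]; ring)

theorem form_apply (w : ℕ+ → ℂ) (f g : SymFun) :
    form w f g = ∑ e ∈ f.support, f.coeff e * g.coeff e * formWeight w e := rfl

theorem form_monomial (w : ℕ+ → ℂ) (e : ℕ+ →₀ ℕ) (c : ℂ) (g : SymFun) :
    form w (monomial e c) g = c * g.coeff e * formWeight w e := by
  classical
  rw [form_apply, sum_form_eq w _ g (S := {e}) MvPolynomial.support_monomial_subset]
  simp

theorem form_symm (w : ℕ+ → ℂ) (f g : SymFun) : form w f g = form w g f := by
  classical
  rw [form_apply, form_apply,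
    sum_form_eq w f g (S := f.support ∪ g.support) Finset.subset_union_left,
    sum_form_eq w g f (S := f.support ∪ g.support) Finset.subset_union_right]
  refine Finset.sum_congr rfl fun e _ => ?_
  ring

theorem jackForm_eq_form (α : ℂ) (f g : SymFun) :
    jackForm α f g = form (fun s => α⁻¹ * ((s : ℕ) : ℂ)) f g := by
  simp only [jackForm, form_apply, formWeight, mul_pow]

/-- Raising the exponent of p_n from t to t + 1 multiplies the squared norm by w_n (t + 1), and t +
1 is the factor produced by ∂/∂p_n. -/
theorem form_X_mul (w : ℕ+ → ℂ) (n : ℕ+) (f g : SymFun) :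
    form w (X n * f) g = w n * form w f (pderiv n g) := by
  induction f using MvPolynomial.induction_on' with
  | monomial e c =>
    rw [X, monomial_mul, form_monomial, form_monomial, coeff_pderiv, one_mul, add_comm,
      formWeight_add_single]
    ring
  | add f f' h h' => rw [mul_add, map_add, map_add, LinearMap.add_apply, LinearMap.add_apply, h, h', mul_add]

theorem form_one (w : ℕ+ → ℂ) (g : SymFun) : form w 1 g = g.coeff 0 := by
  rw [show (1 : SymFun) = monomial 0 1 from rfl, form_monomial]
  simp [formWeight]

end Form

/-! ### Adjoints of multiplication by a formal exponential. -/

section Shift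

open MvPolynomial

/-- The substitution `p_n ↦ p_n + c n * z ^ n`. -/
def shift (c : ℕ+ → ℂ) : SymFun →ₐ[ℂ] Polynomial SymFun :=
  MvPolynomial.aeval fun n => Polynomial.C (X n) + c n • Polynomial.X ^ (n : ℕ)

/-- Differentiating exp (∑ b_i p_i z ^ i) with respect to p_n multiplies it by b_n z ^ n. The
coefficientwise version follows by strong induction from the recursion `expCoeff_succ`. -/
theorem pderiv_expCoeff (b : ℕ+ → ℂ) (n : ℕ+) (j : ℕ) :
    pderiv n (expCoeff (fun i => b i • (X i : SymFun)) j) =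
      if (n : ℕ) ≤ j then b n • expCoeff (fun i => b i • (X i : SymFun)) (j - n) else 0 := by
  classical
  induction j using Nat.strong_induction_on with
  | _ j ih =>
  cases j with
  | zero =>
    have : ¬ ((n : ℕ) ≤ 0) := by have := n.pos; omega
    rw [expCoeff_zero, if_neg this]; simp
  | succ j =>
  refine natCast_succ_mul_cancel j ?_
  set E := expCoeff (fun i => b i • (X i : SymFun)) with hE
  have hd : ((j + 1 : ℕ) : SymFun) * pderiv n (E (j + 1)) =
      pderiv n (((j + 1 : ℕ) : SymFun) * E (j + 1)) := by
    rw [Derivation.leibniz]; simp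
  rw [hd, hE, expCoeff_succ, ← hE, map_sum]
  -- A summand contributes through the derivative of p_{i+1} itself, only when i + 1 = n, and
  -- through the derivative of the lower coefficient, known by induction.
  have hterm : ∀ i ∈ Finset.range (j + 1),
      pderiv n (((i + 1 : ℕ) : SymFun) * (b i.succPNat • X i.succPNat) * E (j - i)) =
      (if i + 1 = n then ((n : ℕ) : SymFun) * b n • E (j + 1 - n) else 0) +
      (if i + n ≤ j then ((i + 1 : ℕ) : SymFun) * (b i.succPNat • X i.succPNat) *
        b n • E (j - i - n) else 0) := by
    intro i hi
    have hi' : i ≤ j := by simpa [Nat.lt_succ_iff] using hi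
    rw [Derivation.leibniz, Derivation.leibniz, ih (j - i) (by omega)]
    simp only [smul_eq_mul, Derivation.map_natCast, mul_zero, add_zero, Derivation.map_smul, pderiv_X]
    have h1 : (n : ℕ) ≤ j - i ↔ i + n ≤ j := by omega
    have h2 : (Pi.single n 1 : ℕ+ → SymFun) i.succPNat = if i + 1 = (n : ℕ) then 1 else 0 := by
      rw [Pi.single_apply]
      refine if_congr ?_ rfl rfl
      rw [← PNat.coe_inj]; rfl
    rw [h2, if_congr h1 rfl rfl, add_comm]
    congr 1
    · split_ifs with hin
      · rw [show j + 1 - (n : ℕ) = j - i by omega, ← hin]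
        have : i.succPNat = n := by rw [← PNat.coe_inj]; exact hin
        rw [this]
        simp only [Algebra.smul_def]
        ring
      · simp
    · simp only [mul_ite, mul_zero]
  rw [Finset.sum_congr rfl hterm, Finset.sum_add_distrib]
  by_cases hn : (n : ℕ) ≤ j + 1
  · rw [if_pos hn]
    have hs1 : ∑ i ∈ Finset.range (j + 1),
        (if i + 1 = (n : ℕ) then ((n : ℕ) : SymFun) * b n • E (j + 1 - n) else 0) =
        ((n : ℕ) : SymFun) * b n • E (j + 1 - n) := by
      have hn0 := n.pos
      rw [Finset.sum_eq_single ((n : ℕ) - 1)]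
      · rw [if_pos (by omega)]
      · intro i _ hi; rw [if_neg (by omega)]
      · intro h; exact absurd (Finset.mem_range.mpr (by omega)) h
    rw [hs1]
    have hs2 : ∑ i ∈ Finset.range (j + 1), (if i + (n : ℕ) ≤ j then
        ((i + 1 : ℕ) : SymFun) * (b i.succPNat • X i.succPNat) * b n • E (j - i - n) else 0) =
        b n • (((j + 1 - n : ℕ) : SymFun) * E (j + 1 - n)) := by
      obtain ⟨l, hl⟩ := Nat.exists_eq_add_of_le hn
      rw [show j + 1 - (n : ℕ) = l by omega]
      cases l with
      | zero =>
        rw [Finset.sum_eq_zero]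
        · simp
        · intro i _; rw [if_neg (by omega)]
      | succ l =>
        rw [hE, expCoeff_succ, ← hE, Finset.smul_sum]
        symm
        refine Finset.sum_subset_zero_on_sdiff (Finset.range_subset_range.mpr (by omega)) ?_ ?_
        · intro i hi
          simp at hi
          rw [if_neg (by omega)]
        · intro i hi
          simp at hi
          rw [if_pos (by omega), show j - i - (n : ℕ) = l - i by omega]
          rw [mul_smul_comm (b n)]
    rw [hs2]
    obtain ⟨l, hl⟩ := Nat.exists_eq_add_of_le hn
    rw [show j + 1 - (n : ℕ) = l by omega, hl]
    simp only [Algebra.smul_def]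
    push_cast
    ring
  · have hs1 : ∀ i ∈ Finset.range (j + 1), i + 1 ≠ (n : ℕ) := by
      intro i hi; simp at hi; omega
    have hs2 : ∀ i ∈ Finset.range (j + 1), ¬ (i + (n : ℕ) ≤ j) := by
      intro i hi; simp at hi; omega
    rw [if_neg hn, Finset.sum_eq_zero fun i hi => if_neg (hs1 i hi),
      Finset.sum_eq_zero fun i hi => if_neg (hs2 i hi)]
    simp

theorem coeff_shift_mul_X (c : ℕ+ → ℂ) (g : SymFun) (n : ℕ+) (j : ℕ) :
    (shift c (g * X n)).coeff j = X n * (shift c g).coeff j +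
      if (n : ℕ) ≤ j then c n • (shift c g).coeff (j - n) else 0 := by
  rw [map_mul, shift, aeval_X, mul_add, Polynomial.coeff_add, Polynomial.coeff_mul_C, mul_smul_comm,
    Polynomial.coeff_smul, Polynomial.coeff_mul_X_pow', mul_comm (X n)]
  split_ifs <;> simp

theorem shift_C (c : ℕ+ → ℂ) (a : ℂ) : shift c (C a) = Polynomial.C (C a) := by
  rw [shift, aeval_C]; rfl

/-- Multiplication by the coefficients of `exp (∑ b n p_n z ^ n)` is adjoint to taking the
coefficients of the shift `p_n ↦ p_n + w n * b n * z ^ n`. -/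
theorem form_expCoeff_mul (w b : ℕ+ → ℂ) (f g : SymFun) (j : ℕ) :
    form w (expCoeff (fun i => b i • (X i : SymFun)) j * f) g =
      form w f ((shift (fun n => w n * b n) g).coeff j) := by
  induction g using MvPolynomial.induction_on generalizing f j with
  | C a =>
    rw [shift_C, Polynomial.coeff_C]
    split_ifs with hj
    · rw [hj, expCoeff_zero, one_mul]
    · rw [map_zero, form_symm, show (C a : SymFun) = monomial 0 a from rfl, form_monomial]
      have : (expCoeff (fun i => b i • (X i : SymFun)) j).coeff 0 = 0 := by
        rw [← constantCoeff_eq]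
        have h := map_expCoeff (MvPolynomial.aeval (fun _ => (0 : ℂ)) : SymFun →ₐ[ℂ] ℂ)
          (fun i => b i • (X i : SymFun)) j
        have h0 := congrArg (PowerSeries.coeff j) (expSeries_zero (R := ℂ))
        rw [expSeries, PowerSeries.coeff_mk, PowerSeries.coeff_one, if_neg hj] at h0
        simp only [map_smul, aeval_X, smul_zero] at h
        rw [← h0]
        change _ = expCoeff (fun _ => (0 : ℂ)) j
        rw [← h, aeval_zero']
        rfl
      have h2 : (expCoeff (fun i => b i • (X i : SymFun)) j * f).coeff 0 = 0 := by
        rw [← constantCoeff_eq, map_mul, constantCoeff_eq, this, zero_mul]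
      rw [h2]; ring
  | add g g' h h' => rw [map_add, h, h', map_add, Polynomial.coeff_add, map_add]
  | mul_X g n h =>
    -- Moved across the form, p_n becomes a derivative of E_j f. The Leibniz rule gives E_j ∂_n f
    -- and b_n E_{j-n} f, which match the two terms in the shift of g p_n.
    rw [coeff_shift_mul_X, map_add, form_symm, mul_comm g, form_X_mul, form_symm, Derivation.leibniz,
      map_add, LinearMap.add_apply, smul_eq_mul, smul_eq_mul, h, mul_comm f, pderiv_expCoeff,
      form_symm w f (X n * _), form_X_mul, form_symm w _ (pderiv n f), mul_add]
    congr 1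
    split_ifs with hn
    · rw [smul_mul_assoc, map_smul, LinearMap.smul_apply, h, map_smul, smul_eq_mul, smul_eq_mul,
        mul_assoc]
    · simp

/-- The factors r ^ n amount to replacing z by r z. -/
theorem coeff_shift_scale (c : ℕ+ → ℂ) (r : ℂ) (g : SymFun) (j : ℕ) :
    (shift (fun n => c n * r ^ (n : ℕ)) g).coeff j = r ^ j • (shift c g).coeff j := by
  induction g using MvPolynomial.induction_on generalizing j with
  | C a =>
    rw [shift_C, shift_C, Polynomial.coeff_C]
    split_ifs with hj <;> simp [hj]
  | add g g' h h' => simp only [map_add, Polynomial.coeff_add, h, h', smul_add]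
  | mul_X g n h =>
    rw [coeff_shift_mul_X, coeff_shift_mul_X, h, h, smul_add, mul_smul_comm]
    congr 1
    split_ifs with hn
    · rw [smul_smul, smul_smul, mul_assoc, ← pow_add, Nat.add_sub_cancel' hn, mul_comm]
    · simp

end Shift

/-! ### Coefficients in infinitely many and in k variables depend only on the shape of the exponent.
-/

section Shape

open MvPolynomial

/-- The multiset of the nonzero values of `a` on `S`. -/
def shapeOn {ι : Type*} (S : Finset ι) (a : ι → ℕ) : Multiset ℕ := (S.val.map a).filter (0 < ·)

/-- Replace the part `v` by `v - n`. -/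
def subPart (n v : ℕ) (s : Multiset ℕ) : Multiset ℕ := s.erase v + Multiset.filter (0 < ·) {v - n}

/-- Stated for an arbitrary index set, so that one rule serves both the formal series and the
Laurent polynomials in `exists_shapeCoeff`. -/
theorem shapeOn_update {ι : Type*} [DecidableEq ι] (S : Finset ι) (a b : ι → ℕ) (n : ℕ) {i : ι}
    (hi : i ∈ S) (h0 : 0 < a i) (hb : b i = a i - n) (hb' : ∀ l, l ≠ i → b l = a l) :
    shapeOn S b = subPart n (a i) (shapeOn S a) := by
  have hS : S.val = i ::ₘ (S.erase i).val := by
    rw [Finset.erase_val, Multiset.cons_erase hi]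
  have hbS : (S.erase i).val.map b = (S.erase i).val.map a :=
    Multiset.map_congr rfl fun l hl => hb' l (Finset.ne_of_mem_erase hl)
  unfold shapeOn subPart
  rw [hS, Multiset.map_cons, Multiset.map_cons, hbS, hb, Multiset.filter_cons_of_pos _ h0,
    Multiset.erase_cons_head, ← Multiset.singleton_add, Multiset.filter_add, add_comm]

theorem mem_shapeOn {ι : Type*} {S : Finset ι} {a : ι → ℕ} {v : ℕ} :
    v ∈ shapeOn S a ↔ 0 < v ∧ ∃ i ∈ S, a i = v := by
  simp [shapeOn, and_comm]

theorem sum_shapeOn {ι : Type*} (S : Finset ι) (a : ι → ℕ) (n : ℕ) (hn : 0 < n) (c : ℕ → ℂ) :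
    (((shapeOn S a).filter (n ≤ ·)).map c).sum = ∑ i ∈ S with n ≤ a i, c (a i) := by
  unfold shapeOn
  rw [Multiset.filter_filter]
  have : ∀ v, (n ≤ v ∧ 0 < v) ↔ n ≤ v := fun v => ⟨fun h => h.1, fun h => ⟨h, by omega⟩⟩
  simp only [this]
  rw [Multiset.filter_map, Multiset.map_map]
  rfl

/-- The multiset of the nonzero exponents of a monomial. -/
def shape (e : ℕ →₀ ℕ) : Multiset ℕ := e.support.val.map e

theorem shape_eq_shapeOn {e : ℕ →₀ ℕ} {S : Finset ℕ} (hS : e.support ⊆ S) :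
    shape e = shapeOn S e := by
  have h : S.filter (fun i => 0 < e i) = e.support := by
    ext i
    simp only [Finset.mem_filter, Finsupp.mem_support_iff, Nat.pos_iff_ne_zero]
    exact ⟨fun h => h.2, fun h => ⟨hS (Finsupp.mem_support_iff.mpr h), h⟩⟩
  unfold shape shapeOn
  rw [Multiset.filter_map, ← h]
  rfl

theorem shape_sub_single {e : ℕ →₀ ℕ} {n i : ℕ} (hn : 0 < n) (hi : n ≤ e i) :
    shape (e - Finsupp.single i n) = subPart n (e i) (shape e) := by
  rw [shape_eq_shapeOn (e := e) (S := e.support) subset_rfl,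
    shape_eq_shapeOn (e := e - Finsupp.single i n) (S := e.support) Finsupp.support_tsub]
  refine shapeOn_update _ _ _ _ ?_ (by omega) (by simp) fun l hl => ?_
  · rw [Finsupp.mem_support_iff]; omega
  · simp [Finsupp.single_eq_of_ne hl]

theorem expand_X (n : ℕ+) : expand (X n) = powerSum n := by simp [expand]

theorem coeff_expand_mul_X (f : SymFun) (n : ℕ+) (e : ℕ →₀ ℕ) :
    MvPowerSeries.coeff e (expand (f * X n)) =
      ∑ i ∈ e.support with (n : ℕ) ≤ e i,
        MvPowerSeries.coeff (e - Finsupp.single i (n : ℕ)) (expand f) := by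
  classical
  rw [map_mul, expand_X, MvPowerSeries.coeff_mul]
  have hc : ∀ d, MvPowerSeries.coeff d (powerSum n) =
      if ∃ i : ℕ, d = Finsupp.single i (n : ℕ) then 1 else 0 := by
    intro d
    change powerSum n d = _
    unfold powerSum
    congr
  simp only [hc, mul_ite, mul_one, mul_zero]
  rw [← Finset.sum_filter]
  symm
  have hn := n.pos
  refine Finset.sum_bij (fun i _ => (e - Finsupp.single i (n : ℕ), Finsupp.single i (n : ℕ)))
    ?_ ?_ ?_ ?_
  · intro i hi
    simp only [Finset.mem_filter] at hi
    simp only [Finset.mem_filter, Finset.HasAntidiagonal.mem_antidiagonal]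
    refine ⟨tsub_add_cancel_of_le ?_, i, rfl⟩
    rw [Finsupp.single_le_iff]; exact hi.2
  · intro i _ j _ hij
    have h := (Prod.mk.inj hij).2
    exact Finsupp.single_left_injective hn.ne' h
  · rintro ⟨d, d'⟩ hd
    simp only [Finset.mem_filter, Finset.HasAntidiagonal.mem_antidiagonal] at hd
    obtain ⟨hd, i, rfl⟩ := hd
    have h2 : e i = d i + n := by rw [← hd]; simp
    refine ⟨i, ?_, ?_⟩
    · simp only [Finset.mem_filter, Finsupp.mem_support_iff]
      omega
    · rw [← hd]; simp
  · intro i _; rfl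

/-- Laurent polynomials in `k` variables. -/
abbrev Laurent (k : ℕ) : Type := AddMonoidAlgebra ℂ (Fin k → ℤ)

/-- The variable `x i`, to the power `n`. -/
def xpow {k : ℕ} (i : Fin k) (n : ℤ) : Laurent k := AddMonoidAlgebra.single (Pi.single i n) 1

/-- The value of a symmetric function in `k` variables. -/
def restrict (k : ℕ) : SymFun →ₐ[ℂ] Laurent k :=
  MvPolynomial.aeval fun n => ∑ i : Fin k, xpow i (n : ℕ)

theorem restrict_X (k : ℕ) (n : ℕ+) : restrict k (X n) = ∑ i : Fin k, xpow i (n : ℕ) := by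
  simp [restrict]

theorem coeff_restrict_mul_X (k : ℕ) (f : SymFun) (n : ℕ+) (e : Fin k → ℤ) :
    (restrict k (f * X n)).coeff e = ∑ i, (restrict k f).coeff (e - Pi.single i ((n : ℕ) : ℤ)) := by
  rw [map_mul, restrict_X, Finset.mul_sum, AddMonoidAlgebra.coeff_sum, Finset.sum_apply']
  refine Finset.sum_congr rfl fun i _ => ?_
  rw [xpow, AddMonoidAlgebra.coeff_mul_single_apply, mul_one, sub_eq_add_neg]

/-- The multiset of the positive exponents of a Laurent monomial. -/
def shapeZ {k : ℕ} (e : Fin k → ℤ) : Multiset ℕ := shapeOn Finset.univ fun i => (e i).toNat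

/-- The coefficients of a symmetric function depend only on the shape of the exponents. -/
theorem exists_shapeCoeff (f : SymFun) : ∃ c : Multiset ℕ → ℂ,
    (∀ e : ℕ →₀ ℕ, MvPowerSeries.coeff e (expand f) = c (shape e)) ∧
    ∀ (k : ℕ) (e : Fin k → ℤ), (restrict k f).coeff e = if ∀ i, 0 ≤ e i then c (shapeZ e) else 0 := by
  classical
  induction f using MvPolynomial.induction_on with
  | C a =>
    refine ⟨fun s => if s = 0 then a else 0, fun e => ?_, fun k e => ?_⟩
    · rw [expand, aeval_C]
      change MvPowerSeries.coeff e (MvPowerSeries.C a) = _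
      rw [MvPowerSeries.coeff_C]
      refine if_congr ?_ rfl rfl
      simp [shape]
    · rw [restrict, aeval_C, AddMonoidAlgebra.coe_algebraMap]
      simp only [Function.comp, Algebra.algebraMap_self, RingHom.id_apply,
        AddMonoidAlgebra.coeff_single, Finsupp.single_apply]
      have : (0 = e) ↔ ((∀ i, 0 ≤ e i) ∧ shapeZ e = 0) := by
        constructor
        · rintro rfl
          refine ⟨fun i => le_rfl, ?_⟩
          rw [Multiset.eq_zero_iff_forall_notMem]
          intro v hv
          obtain ⟨hv0, i, _, hi⟩ := mem_shapeOn.mp hv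
          simp at hi; omega
        · rintro ⟨h1, h2⟩
          funext i
          by_contra hne
          have h3 : 0 ≤ e i := h1 i
          have h4 : (e i).toNat ∈ shapeZ e := mem_shapeOn.mpr ⟨by
            have : e i ≠ 0 := fun h => hne h.symm
            omega, i, by simp, rfl⟩
          rw [h2] at h4; simp at h4
      by_cases h : ∀ i, 0 ≤ e i
      · simp [this, h]
      · simp [this, h]
  | add f g hf hg =>
    obtain ⟨c, hc, hc'⟩ := hf
    obtain ⟨d, hd, hd'⟩ := hg
    refine ⟨c + d, fun e => ?_, fun k e => ?_⟩
    · rw [map_add, map_add, hc, hd]; rfl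
    · rw [map_add, AddMonoidAlgebra.coeff_add, Finsupp.add_apply, hc', hd']
      split_ifs <;> simp
  | mul_X f n hf =>
    obtain ⟨c, hc, hc'⟩ := hf
    have hn := n.pos
    -- Multiplication by p_n collects the coefficients at all exponents obtained by lowering one
    -- entry v ≥ n by n. With multiplicities this is a sum over the shape alone.
    refine ⟨fun s => ((s.filter ((n : ℕ) ≤ ·)).map fun v => c (subPart n v s)).sum,
      fun e => ?_, fun k e => ?_⟩
    · dsimp only
      rw [coeff_expand_mul_X, shape_eq_shapeOn (e := e) (S := e.support) subset_rfl,
        sum_shapeOn _ _ _ hn fun v => c (subPart n v _), ← shape_eq_shapeOn (e := e) (S := e.support) subset_rfl]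
      refine Finset.sum_congr rfl fun i hi => ?_
      rw [hc, shape_sub_single hn (Finset.mem_filter.mp hi).2]
    · dsimp only
      rw [coeff_restrict_mul_X]
      split_ifs with h
      · rw [shapeZ, sum_shapeOn _ _ _ hn fun v => c (subPart n v _), Finset.sum_filter]
        refine Finset.sum_congr rfl fun i _ => ?_
        rw [hc']
        have hi : 0 ≤ e i := h i
        have hiff : (∀ l, 0 ≤ (e - Pi.single i ((n : ℕ) : ℤ) : Fin k → ℤ) l) ↔ (n : ℕ) ≤ (e i).toNat := by
          constructor
          · intro h'
            have := h' i
            simp at this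
            omega
          · intro h' l
            by_cases hl : l = i
            · subst hl; simp; omega
            · simpa [hl] using h l
        rw [if_congr hiff rfl rfl]
        split_ifs with h'
        · congr 1
          refine shapeOn_update _ _ _ _ (Finset.mem_univ i) (by omega) ?_ ?_
          · simp
          · intro l hl; simp [hl]
        · rfl
      · refine Finset.sum_eq_zero fun i _ => ?_
        rw [hc', if_neg]
        intro h'
        apply h
        intro l
        have := h' l
        by_cases hl : l = i
        · subst hl; simp at this ⊢; omega
        · simpa [hl] using this

end Shape

/-! ### Young diagrams as multisets of parts. -/

section Diagram

/-- The exponent vector of the dominant monomial of a partition. -/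
def expo (μ : YoungDiagram) : ℕ →₀ ℕ :=
  Finsupp.onFinset (Finset.range (μ.colLen 0)) μ.rowLen fun i hi => by
    rw [Finset.mem_range, ← YoungDiagram.mem_iff_lt_colLen, YoungDiagram.mem_iff_lt_rowLen]
    omega

theorem rowLen_pos_iff (μ : YoungDiagram) (i : ℕ) : 0 < μ.rowLen i ↔ i < μ.colLen 0 := by
  rw [← YoungDiagram.mem_iff_lt_colLen, YoungDiagram.mem_iff_lt_rowLen]

theorem shape_expo (μ : YoungDiagram) : shape (expo μ) = (μ.rowLens : Multiset ℕ) := by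
  have h : (expo μ).support = Finset.range (μ.colLen 0) := by
    ext i
    simp only [expo, Finsupp.mem_support_iff, Finsupp.onFinset_apply, Finset.mem_range]
    rw [← rowLen_pos_iff]; omega
  unfold shape
  rw [h]
  rfl

theorem rowLens_coe_injective {μ ν : YoungDiagram}
    (h : (μ.rowLens : Multiset ℕ) = (ν.rowLens : Multiset ℕ)) : μ = ν := by
  have h1 : μ.rowLens = ν.rowLens :=
    (Multiset.coe_eq_coe.mp h).eq_of_pairwise' μ.rowLens_sorted.pairwise ν.rowLens_sorted.pairwise
  exact YoungDiagram.equivListRowLens.injective (Subtype.ext h1)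

theorem exists_rowLens_eq {s : Multiset ℕ} (hs : ∀ x ∈ s, 0 < x) :
    ∃ μ : YoungDiagram, (μ.rowLens : Multiset ℕ) = s := by
  have hsort : (s.sort (· ≥ ·)).SortedGE := (Multiset.pairwise_sort s _).sortedGE
  refine ⟨YoungDiagram.ofRowLens (s.sort (· ≥ ·)) hsort, ?_⟩
  rw [YoungDiagram.rowLens_ofRowLens_eq_self, Multiset.sort_eq]
  intro x hx
  exact hs x (by simpa using hx)

theorem shape_pos (e : ℕ →₀ ℕ) : ∀ x ∈ shape e, 0 < x := by
  rw [shape_eq_shapeOn (e := e) subset_rfl]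
  intro x hx
  exact (mem_shapeOn.mp hx).1

theorem coeff_monomialSym (μ : YoungDiagram) (e : ℕ →₀ ℕ) [Decidable (shape e = μ.rowLens)] :
    MvPowerSeries.coeff e (monomialSym μ) = if shape e = (μ.rowLens : Multiset ℕ) then 1 else 0 := by
  change monomialSym μ e = _
  unfold monomialSym shape
  congr

theorem card_eq_sum_rowLen (μ : YoungDiagram) {n : ℕ} (hn : μ.colLen 0 ≤ n) :
    μ.card = ∑ i ∈ Finset.range n, μ.rowLen i := by
  have h : ∀ c ∈ μ.cells, c.1 ∈ Finset.range n := by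
    rintro ⟨i, j⟩ hc
    have h1 : (i, j) ∈ μ := hc
    have h2 : (i, 0) ∈ μ := μ.up_left_mem le_rfl (Nat.zero_le j) h1
    rw [YoungDiagram.mem_iff_lt_colLen] at h2
    exact Finset.mem_range.mpr (lt_of_lt_of_le h2 hn)
  rw [YoungDiagram.card, Finset.card_eq_sum_card_fiberwise h]
  refine Finset.sum_congr rfl fun i _ => ?_
  rw [YoungDiagram.rowLen_eq_card]
  rfl

theorem card_eq_sum_rowLens (μ : YoungDiagram) : μ.card = μ.rowLens.sum := by
  rw [card_eq_sum_rowLen μ le_rfl]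
  rfl

/-- A cell (i, j) forces i + 1 cells in its column and j + 1 in its row, so a diagram with at most N
cells lies in a fixed square. -/
theorem finite_card_le (N : ℕ) : {μ : YoungDiagram | μ.card ≤ N}.Finite := by
  have hinj : Set.InjOn YoungDiagram.cells {μ : YoungDiagram | μ.card ≤ N} :=
    fun μ _ ν _ h => YoungDiagram.ext h
  refine Set.Finite.of_finite_image ?_ hinj
  refine Set.Finite.subset ((Finset.range (N + 1) ×ˢ Finset.range (N + 1)).powerset.finite_toSet) ?_
  rintro _ ⟨μ, hμ, rfl⟩
  simp only [Finset.coe_powerset, Set.mem_preimage, Set.mem_powerset_iff]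
  rintro ⟨i, j⟩ hc
  have hμ' : μ.card ≤ N := hμ
  have h1 : (i, j) ∈ μ := hc
  have hi : ((Finset.range (i + 1)).image fun i' => (i', j)) ⊆ μ.cells := by
    intro c hc
    simp only [Finset.mem_image, Finset.mem_range] at hc
    obtain ⟨i', hi', rfl⟩ := hc
    exact μ.up_left_mem (by omega) le_rfl h1
  have hj : ((Finset.range (j + 1)).image fun j' => (i, j')) ⊆ μ.cells := by
    intro c hc
    simp only [Finset.mem_image, Finset.mem_range] at hc
    obtain ⟨j', hj', rfl⟩ := hc
    exact μ.up_left_mem le_rfl (by omega) h1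
  have hi' := Finset.card_le_card hi
  have hj' := Finset.card_le_card hj
  rw [Finset.card_image_of_injective _ (fun a b h => (Prod.mk.inj h).1), Finset.card_range] at hi'
  rw [Finset.card_image_of_injective _ (fun a b h => (Prod.mk.inj h).2), Finset.card_range] at hj'
  change _ ≤ μ.card at hi'
  change _ ≤ μ.card at hj'
  simp only [Finset.coe_product, Finset.coe_range, Set.mem_prod, Set.mem_Iio]
  omega

end Diagram

/-! ### The monomial symmetric functions form a basis of Λ. -/

section MonomialBasis

open MvPolynomial

theorem card_subPart {n v : ℕ} {s : Multiset ℕ} (hv : v ∈ s) :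
    (subPart n v s).card + 1 = s.card + if n < v then 1 else 0 := by
  have h := Multiset.card_erase_add_one hv
  unfold subPart
  rw [Multiset.card_add, Multiset.filter_singleton]
  split_ifs with h1 h2 h2 <;> simp <;> omega

theorem apply_mem_shape {e : ℕ →₀ ℕ} {i : ℕ} (hi : i ∈ e.support) : e i ∈ shape e :=
  Multiset.mem_map_of_mem _ hi

theorem mem_support_filter {e : ℕ →₀ ℕ} {n i : ℕ} :
    i ∈ e.support.filter (fun i => n ≤ e i) ↔ i ∈ e.support ∧ n ≤ e i := Finset.mem_filter

/-- A product of power sums is triangular in the number of parts: expanding it merges factors, and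
no merging happens only for the shape t itself. Integrality is carried along because sums of natural
numbers cannot cancel, which keeps the diagonal coefficient nonzero. -/
theorem powerSum_prod_coeff (t : Multiset ℕ+) (e : ℕ →₀ ℕ) :
    (∃ N : ℕ, MvPowerSeries.coeff e (expand (t.map X).prod) = N) ∧
    (MvPowerSeries.coeff e (expand (t.map X).prod) ≠ 0 → (shape e).card ≤ t.card ∧
      ((shape e).card = t.card → shape e = t.map (fun n : ℕ+ => (n : ℕ)))) ∧
    (shape e = t.map (fun n : ℕ+ => (n : ℕ)) →
      MvPowerSeries.coeff e (expand (t.map X).prod) ≠ 0) := by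
  classical
  induction t using Multiset.induction_on generalizing e with
  | empty =>
    have h : MvPowerSeries.coeff e (expand ((0 : Multiset ℕ+).map X).prod) =
        if e = 0 then 1 else 0 := by
      simp [MvPowerSeries.coeff_one]
    rw [h]
    have h0 : shape e = 0 ↔ e = 0 := by simp [shape]
    refine ⟨⟨if e = 0 then 1 else 0, by split_ifs <;> simp⟩, fun he => ?_, fun he => ?_⟩
    · have : e = 0 := by by_contra h'; simp [h'] at he
      subst this
      simp [shape]
    · have : e = 0 := h0.mp (by simpa using he)
      simp [this]
  | cons n t ih =>
    rw [Multiset.map_cons, Multiset.prod_cons, mul_comm, coeff_expand_mul_X]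
    have hn := n.pos
    refine ⟨?_, fun he => ?_, fun he => ?_⟩
    · choose N hN using fun e => (ih e).1
      refine ⟨∑ i ∈ e.support with (n : ℕ) ≤ e i, N (e - Finsupp.single i (n : ℕ)), ?_⟩
      push_cast
      exact Finset.sum_congr rfl fun i _ => hN _
    · obtain ⟨i, hi, hne⟩ := Finset.exists_ne_zero_of_sum_ne_zero he
      rw [mem_support_filter] at hi
      have hm := apply_mem_shape hi.1
      obtain ⟨h1, h2⟩ := (ih _).2.1 hne
      rw [shape_sub_single hn hi.2] at h1 h2
      have h3 := card_subPart (n := n) hm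
      rw [Multiset.card_cons]
      refine ⟨?_, fun hcard => ?_⟩
      · split_ifs at h3 <;> omega
      · have h4 : e i = n := by
          by_contra h5
          rw [if_pos (by omega)] at h3
          omega
        rw [h4, if_neg (lt_irrefl _)] at h3
        have h5 := h2 (by rw [h4]; omega)
        rw [Multiset.map_cons, ← h5, h4]
        unfold subPart
        rw [Nat.sub_self, Multiset.filter_singleton, if_neg (lt_irrefl _)]
        simp only [Multiset.empty_eq_zero, add_zero]
        rw [Multiset.cons_erase (h4 ▸ hm)]
    · choose N hN using fun e => (ih e).1
      have hs : ∑ i ∈ e.support with (n : ℕ) ≤ e i, MvPowerSeries.coeff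
          (e - Finsupp.single i (n : ℕ)) (expand (t.map X).prod) =
          ((∑ i ∈ e.support with (n : ℕ) ≤ e i, N (e - Finsupp.single i (n : ℕ)) : ℕ) : ℂ) := by
        push_cast
        exact Finset.sum_congr rfl fun i _ => hN _
      rw [hs, Nat.cast_ne_zero]
      have hm : (n : ℕ) ∈ shape e := by rw [he]; simp
      obtain ⟨i, hi, hin⟩ := Multiset.mem_map.mp hm
      have hmem : i ∈ e.support.filter (fun i => (n : ℕ) ≤ e i) := mem_support_filter.mpr ⟨hi, hin.ge⟩
      intro h0
      rw [Finset.sum_eq_zero_iff] at h0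
      refine (ih (e - Finsupp.single i (n : ℕ))).2.2 ?_ ?_
      · rw [shape_sub_single hn hin.ge, he, subPart, hin, Multiset.map_cons,
          Multiset.erase_cons_head, Nat.sub_self, Multiset.filter_singleton, if_neg (lt_irrefl _)]
        simp
      · rw [hN, h0 i hmem, Nat.cast_zero]

theorem coeff_expand_eq {f : SymFun} {e e' : ℕ →₀ ℕ} (h : shape e = shape e') :
    MvPowerSeries.coeff e (expand f) = MvPowerSeries.coeff e' (expand f) := by
  obtain ⟨c, hc, _⟩ := exists_shapeCoeff f
  rw [hc, hc, h]

/-- The coefficient of `f` along the monomial symmetric function of `μ`. -/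
def symCoeff (μ : YoungDiagram) : SymFun →ₗ[ℂ] ℂ :=
  MvPowerSeries.coeff (expo μ) ∘ₗ expand.toLinearMap

theorem symCoeff_apply (μ : YoungDiagram) (f : SymFun) :
    symCoeff μ f = MvPowerSeries.coeff (expo μ) (expand f) := rfl

theorem coeff_expand_of_shape {f : SymFun} {e : ℕ →₀ ℕ} {μ : YoungDiagram}
    (h : shape e = (μ.rowLens : Multiset ℕ)) :
    MvPowerSeries.coeff e (expand f) = symCoeff μ f :=
  coeff_expand_eq (by rw [h, shape_expo])

theorem coeff_restrict {k : ℕ} {f : SymFun} {e : Fin k → ℤ} {μ : YoungDiagram} (he : ∀ i, 0 ≤ e i)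
    (h : shapeZ e = (μ.rowLens : Multiset ℕ)) : (restrict k f).coeff e = symCoeff μ f := by
  obtain ⟨c, hc, hc'⟩ := exists_shapeCoeff f
  rw [hc', if_pos he, symCoeff_apply, hc, shape_expo, h]

theorem coeff_restrict_of_neg {k : ℕ} {f : SymFun} {e : Fin k → ℤ} (he : ¬ ∀ i, 0 ≤ e i) :
    (restrict k f).coeff e = 0 := by
  obtain ⟨c, hc, hc'⟩ := exists_shapeCoeff f
  rw [hc', if_neg he]

theorem exists_shapeZ_eq {k : ℕ} (e : Fin k → ℤ) :
    ∃ μ : YoungDiagram, shapeZ e = (μ.rowLens : Multiset ℕ) := by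
  obtain ⟨μ, hμ⟩ := exists_rowLens_eq (s := shapeZ e) fun x hx => (mem_shapeOn.mp hx).1
  exact ⟨μ, hμ.symm⟩

theorem exists_shape_eq (e : ℕ →₀ ℕ) :
    ∃ μ : YoungDiagram, shape e = (μ.rowLens : Multiset ℕ) := by
  obtain ⟨μ, hμ⟩ := exists_rowLens_eq (s := shape e) (shape_pos e)
  exact ⟨μ, hμ.symm⟩

theorem sum_subPart {n v : ℕ} {s : Multiset ℕ} (hv : v ∈ s) (hn : n ≤ v) :
    (subPart n v s).sum + n = s.sum := by
  have h := Multiset.sum_erase hv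
  unfold subPart
  rw [Multiset.sum_add, Multiset.filter_singleton]
  split_ifs with h1 <;> simp <;> omega

/-- The expansion has infinitely many monomials but bounded degree, so only finitely many shapes
occur. -/
theorem exists_shape_sum_le (f : SymFun) :
    ∃ N : ℕ, ∀ e, MvPowerSeries.coeff e (expand f) ≠ 0 → (shape e).sum ≤ N := by
  classical
  induction f using MvPolynomial.induction_on with
  | C a =>
    refine ⟨0, fun e he => ?_⟩
    rw [expand, aeval_C] at he
    change MvPowerSeries.coeff e (MvPowerSeries.C a) ≠ 0 at he
    rw [MvPowerSeries.coeff_C] at he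
    have : e = 0 := by by_contra h; simp [h] at he
    simp [this, shape]
  | add f g hf hg =>
    obtain ⟨M, hM⟩ := hf
    obtain ⟨N, hN⟩ := hg
    refine ⟨max M N, fun e he => ?_⟩
    rw [map_add, map_add] at he
    by_cases h : MvPowerSeries.coeff e (expand f) = 0
    · rw [h, zero_add] at he
      exact le_max_of_le_right (hN e he)
    · exact le_max_of_le_left (hM e h)
  | mul_X f n hf =>
    obtain ⟨N, hN⟩ := hf
    refine ⟨N + n, fun e he => ?_⟩
    rw [coeff_expand_mul_X] at he
    obtain ⟨i, hi, hne⟩ := Finset.exists_ne_zero_of_sum_ne_zero he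
    rw [mem_support_filter] at hi
    have h1 := hN _ hne
    rw [shape_sub_single n.pos hi.2] at h1
    have h2 := sum_subPart (apply_mem_shape hi.1) hi.2
    omega

theorem finite_symCoeff (f : SymFun) : {μ : YoungDiagram | symCoeff μ f ≠ 0}.Finite := by
  obtain ⟨N, hN⟩ := exists_shape_sum_le f
  refine (finite_card_le N).subset fun μ hμ => ?_
  have h := hN _ hμ
  rw [shape_expo, Multiset.sum_coe, ← card_eq_sum_rowLens] at h
  exact h

/-- The coefficients of `f` in the basis of monomial symmetric functions. -/
def symCoeffs (f : SymFun) : YoungDiagram →₀ ℂ :=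
  Finsupp.onFinset (finite_symCoeff f).toFinset (fun μ => symCoeff μ f) fun μ hμ => by simpa using hμ

theorem symCoeffs_apply (f : SymFun) (μ : YoungDiagram) : symCoeffs f μ = symCoeff μ f := rfl

theorem coeff_sum_monomialSym (v : YoungDiagram →₀ ℂ) (e : ℕ →₀ ℕ) (μ : YoungDiagram)
    (h : shape e = (μ.rowLens : Multiset ℕ)) :
    MvPowerSeries.coeff e (v.sum fun μ c => c • monomialSym μ) = v μ := by
  classical
  rw [Finsupp.sum, map_sum, Finset.sum_eq_single μ]
  · simp [coeff_monomialSym, h]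
  · intro ν _ hν
    rw [map_smul, coeff_monomialSym, if_neg, smul_zero]
    intro h'
    exact hν (rowLens_coe_injective (h'.symm.trans h))
  · intro hμ
    simp [Finsupp.notMem_support_iff.mp hμ]

theorem expand_eq_sum (f : SymFun) :
    expand f = (symCoeffs f).sum fun μ c => c • monomialSym μ := by
  ext e
  obtain ⟨μ, hμ⟩ := exists_shape_eq e
  rw [coeff_sum_monomialSym _ e μ hμ, coeff_expand_of_shape hμ, symCoeffs_apply]

theorem monomial_eq_prod (e : ℕ+ →₀ ℕ) :
    (monomial e (1 : ℂ) : SymFun) = ((Finsupp.toMultiset e).map X).prod := by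
  rw [monomial_eq, Finsupp.toMultiset_map, Finsupp.prod_toMultiset, C_1, one_mul,
    Finsupp.prod_mapDomain_index (by simp) (by intros; rw [pow_add])]

/-- Among the monomials of f take one with the largest number of power sum factors. By
`powerSum_prod_coeff` no other monomial of f contributes to the coefficient at its shape. -/
theorem expand_injective : Function.Injective expand := by
  classical
  rw [injective_iff_map_eq_zero]
  intro f hf
  by_contra hne
  obtain ⟨e, he, hmax⟩ := Finset.exists_max_image f.support (fun e => (Finsupp.toMultiset e).card)
    (by simpa using hne)
  obtain ⟨μ, hμ⟩ := exists_rowLens_eq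
    (s := (Finsupp.toMultiset e).map (fun n : ℕ+ => (n : ℕ))) (by
      intro x hx
      obtain ⟨n, _, rfl⟩ := Multiset.mem_map.mp hx
      exact n.pos)
  have hE : shape (expo μ) = (Finsupp.toMultiset e).map (fun n : ℕ+ => (n : ℕ)) := by
    rw [shape_expo, hμ]
  have h0 : MvPowerSeries.coeff (expo μ) (expand f) = 0 := by rw [hf]; rfl
  rw [f.as_sum, map_sum, map_sum, Finset.sum_eq_single e] at h0
  · have hm : (monomial e (f.coeff e) : SymFun) = f.coeff e • monomial e (1 : ℂ) := by
      rw [smul_monomial]; simp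
    rw [hm, map_smul, map_smul, smul_eq_zero] at h0
    refine h0.elim (MvPolynomial.mem_support_iff.mp he) ?_
    rw [monomial_eq_prod]
    exact (powerSum_prod_coeff _ _).2.2 hE
  · intro e' he' hee
    have hm : (monomial e' (f.coeff e') : SymFun) = f.coeff e' • monomial e' (1 : ℂ) := by
      rw [smul_monomial]; simp
    rw [hm, map_smul, map_smul]
    by_contra h1
    have h2 : MvPowerSeries.coeff (expo μ) (expand (monomial e' (1 : ℂ))) ≠ 0 := by
      intro h; exact h1 (by rw [h, smul_zero])
    rw [monomial_eq_prod] at h2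
    obtain ⟨h3, h4⟩ := (powerSum_prod_coeff _ _).2.1 h2
    have h5 := hmax e' he'
    have h6 : (shape (expo μ)).card = (Finsupp.toMultiset e).card := by rw [hE]; simp
    have h7 := h4 (by omega)
    rw [hE] at h7
    have h8 := Multiset.map_injective (f := fun n : ℕ+ => (n : ℕ)) PNat.coe_injective h7
    exact hee (by simpa using congrArg Multiset.toFinsupp h8.symm)
  · intro h; exact absurd he h

/-- The product of the power sums of the parts of μ is a nonzero multiple of m_μ plus terms m_ν with
fewer parts, which are available by induction. -/
theorem exists_expand_eq (μ : YoungDiagram) : ∃ f : SymFun, expand f = monomialSym μ := by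
  classical
  induction hr : μ.rowLens.length using Nat.strong_induction_on generalizing μ with
  | _ r ih =>
  obtain ⟨t, ht⟩ : ∃ t : Multiset ℕ+, t.map (fun n : ℕ+ => (n : ℕ)) = (μ.rowLens : Multiset ℕ) := by
    have : CanLift (Multiset ℕ) (Multiset ℕ+) (Multiset.map (fun n : ℕ+ => (n : ℕ)))
        (fun s => ∀ x ∈ s, 0 < x) := Multiset.canLift _ _
    exact CanLift.prf (μ.rowLens : Multiset ℕ) fun x hx => μ.pos_of_mem_rowLens x hx
  set p : SymFun := (t.map X).prod with hp
  have hne : symCoeff μ p ≠ 0 := (powerSum_prod_coeff t _).2.2 (by rw [shape_expo, ht])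
  have hlen : ∀ ν : YoungDiagram, symCoeff ν p ≠ 0 → ν ≠ μ → ν.rowLens.length < r := by
    intro ν hν hνμ
    obtain ⟨h1, h2⟩ := (powerSum_prod_coeff t _).2.1 hν
    have h3 : t.card = r := by rw [← hr, ← Multiset.coe_card, ← ht, Multiset.card_map]
    rw [shape_expo, Multiset.coe_card] at h1 h2
    rcases lt_or_eq_of_le h1 with h | h
    · omega
    · exact absurd (rowLens_coe_injective ((h2 h).trans ht)) hνμ
  choose! g hg using fun (ν : YoungDiagram) (h : ν.rowLens.length < r) => ih _ h ν rfl
  refine ⟨(symCoeff μ p)⁻¹ • (p - ∑ ν ∈ (symCoeffs p).support.erase μ, symCoeff ν p • g ν), ?_⟩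
  rw [map_smul, map_sub, map_sum]
  have hsum : ∑ ν ∈ (symCoeffs p).support.erase μ, expand (symCoeff ν p • g ν) =
      ∑ ν ∈ (symCoeffs p).support.erase μ, symCoeff ν p • monomialSym ν := by
    refine Finset.sum_congr rfl fun ν hν => ?_
    rw [Finset.mem_erase, Finsupp.mem_support_iff] at hν
    rw [map_smul, hg ν (hlen ν hν.2 hν.1)]
  have hmem : μ ∈ (symCoeffs p).support := by rwa [Finsupp.mem_support_iff]
  rw [hsum, expand_eq_sum p, Finsupp.sum, ← Finset.add_sum_erase _ _ hmem]
  simp only [symCoeffs_apply]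
  rw [add_sub_cancel_right, smul_smul, inv_mul_cancel₀ hne, one_smul]

/-- The monomial symmetric function, as an element of `Λ`. -/
def mono (μ : YoungDiagram) : SymFun := (exists_expand_eq μ).choose

theorem expand_mono (μ : YoungDiagram) : expand (mono μ) = monomialSym μ :=
  (exists_expand_eq μ).choose_spec

theorem symCoeff_mono (μ ν : YoungDiagram) [Decidable (ν = μ)] :
    symCoeff ν (mono μ) = if ν = μ then 1 else 0 := by
  classical
  rw [symCoeff_apply, expand_mono, coeff_monomialSym, shape_expo]
  exact if_congr ⟨fun h => rowLens_coe_injective h, fun h => by rw [h]⟩ rfl rfl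

theorem eq_sum_mono (f : SymFun) : f = (symCoeffs f).sum fun μ c => c • mono μ := by
  apply expand_injective
  rw [Finsupp.sum, map_sum, expand_eq_sum f]
  refine Finset.sum_congr rfl fun μ _ => ?_
  rw [map_smul, expand_mono]

theorem ext_symCoeff {f g : SymFun} (h : ∀ μ, symCoeff μ f = symCoeff μ g) : f = g := by
  rw [eq_sum_mono f, eq_sum_mono g]
  congr 1
  ext μ
  exact h μ

theorem mem_span_mono {f : SymFun} {S : Set YoungDiagram} (h : ∀ μ, symCoeff μ f ≠ 0 → μ ∈ S) :
    f ∈ Submodule.span ℂ (mono '' S) := by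
  rw [eq_sum_mono f]
  refine Submodule.sum_mem _ fun μ hμ => Submodule.smul_mem _ _ (Submodule.subset_span ?_)
  exact ⟨μ, h μ (by simpa [symCoeffs_apply] using hμ), rfl⟩

theorem symCoeff_eq_zero_of_mem_span {f : SymFun} {S : Set YoungDiagram}
    (h : f ∈ Submodule.span ℂ (mono '' S)) {μ : YoungDiagram} (hμ : μ ∉ S) : symCoeff μ f = 0 := by
  classical
  induction h using Submodule.span_induction with
  | mem x hx =>
    obtain ⟨ν, hν, rfl⟩ := hx
    rw [symCoeff_mono, if_neg]
    rintro rfl; exact hμ hν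
  | zero => simp
  | add x y _ _ hx hy => rw [map_add, hx, hy, add_zero]
  | smul c x _ hx => rw [map_smul, hx, smul_zero]

end MonomialBasis

/-! ### Rescaling one variable, and its effect on the Vandermonde product. -/

section LaurentTwist

variable {k : ℕ}

/-- The rescaling `x i ↦ u * x i`. -/
def twist (i : Fin k) (u : ℂˣ) : Laurent k →ₐ[ℂ] Laurent k :=
  AddMonoidAlgebra.lift ℂ (Laurent k) (Fin k → ℤ)
    { toFun := fun e => AddMonoidAlgebra.single e.toAdd ((u ^ (e.toAdd i) : ℂˣ) : ℂ)
      map_one' := by simp [AddMonoidAlgebra.one_def]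
      map_mul' := fun e f => by
        simp [AddMonoidAlgebra.single_mul_single, zpow_add] }

theorem twist_single (i : Fin k) (u : ℂˣ) (e : Fin k → ℤ) (c : ℂ) :
    twist i u (AddMonoidAlgebra.single e c) =
      AddMonoidAlgebra.single e (c * ((u ^ (e i) : ℂˣ) : ℂ)) := by
  rw [twist, AddMonoidAlgebra.lift_single]
  simp

theorem laurent_induction {p : Laurent k → Prop} (f : Laurent k)
    (hs : ∀ e c, p (AddMonoidAlgebra.single e c)) (ha : ∀ f g, p f → p g → p (f + g)) : p f := by
  have : f = f.coeff.sum fun e c => AddMonoidAlgebra.single e c := by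
    ext e
    simp [Finsupp.sum, AddMonoidAlgebra.coeff_sum, Finsupp.single_apply]
  rw [this]
  have h0 : p 0 := by simpa using hs 0 0
  exact Finset.sum_induction _ p ha h0 fun e _ => hs _ _

theorem coeff_twist (i : Fin k) (u : ℂˣ) (f : Laurent k) (e : Fin k → ℤ) :
    (twist i u f).coeff e = f.coeff e * ((u ^ (e i) : ℂˣ) : ℂ) := by
  classical
  induction f using laurent_induction with
  | hs d c =>
    rw [twist_single, AddMonoidAlgebra.coeff_single, AddMonoidAlgebra.coeff_single,
      Finsupp.single_apply, Finsupp.single_apply]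
    split_ifs with h
    · rw [h]
    · simp
  | ha f g hf hg => simp [hf, hg, add_mul]

theorem twist_xpow_self (i : Fin k) (u : ℂˣ) (n : ℤ) :
    twist i u (xpow i n) = ((u ^ n : ℂˣ) : ℂ) • xpow i n := by
  simp [xpow, twist_single]

theorem twist_xpow_of_ne {i j : Fin k} (h : i ≠ j) (u : ℂˣ) (n : ℤ) :
    twist i u (xpow j n) = xpow j n := by
  simp [xpow, twist_single, h]

theorem xpow_mul (i : Fin k) (n n' : ℤ) : xpow i n * xpow i n' = xpow i (n + n') := by
  simp [xpow, AddMonoidAlgebra.single_mul_single, Pi.single_add]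

theorem xpow_zero (i : Fin k) : xpow i 0 = 1 := by
  simp [xpow, AddMonoidAlgebra.one_def]

theorem xpow_pow (i : Fin k) (n : ℤ) (r : ℕ) : xpow i n ^ r = xpow i (r * n) := by
  induction r with
  | zero => simp [xpow_zero]
  | succ r ih => rw [pow_succ, ih, xpow_mul]; push_cast; ring_nf

theorem xpow_injective {n : ℤ} (hn : n ≠ 0) : Function.Injective fun i : Fin k => xpow i n := by
  intro i j h
  by_contra hij
  have h1 : (Pi.single i n : Fin k → ℤ) = Pi.single j n :=
    AddMonoidAlgebra.single_left_injective one_ne_zero h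
  have := congrFun h1 i
  simp [hij, hn] at this

/-- The index set of the Vandermonde product. -/
def pairs (k : ℕ) : Finset (Fin k × Fin k) := Finset.univ.filter fun p => p.1 < p.2

theorem mem_pairs {p : Fin k × Fin k} : p ∈ pairs k ↔ p.1 < p.2 := by simp [pairs]

/-- The Vandermonde product. -/
def vand (k : ℕ) : Laurent k := ∏ p ∈ pairs k, (xpow p.1 1 - xpow p.2 1)

instance : IsDomain (Laurent k) := NoZeroDivisors.to_isDomain _

theorem vand_ne_zero : vand k ≠ 0 := by
  refine Finset.prod_ne_zero_iff.mpr fun p hp h => ?_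
  have := xpow_injective (k := k) one_ne_zero (sub_eq_zero.mp h)
  exact absurd this (mem_pairs.mp hp).ne

/-- Each j ≠ i occurs in exactly one ordered pair together with i. -/
theorem prod_pairs_eq {M : Type*} [CommMonoid M] (i : Fin k) (h : Fin k → M) :
    ∏ p ∈ pairs k, (if p.1 = i then h p.2 else if p.2 = i then h p.1 else 1) =
      ∏ j ∈ Finset.univ.erase i, h j := by
  symm
  rw [← Finset.prod_subset (Finset.filter_subset (fun p => p.1 = i ∨ p.2 = i) (pairs k))]
  · refine Finset.prod_bij (fun j _ => if i < j then (i, j) else (j, i)) ?_ ?_ ?_ ?_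
    · intro j hj
      have hj' := Finset.ne_of_mem_erase hj
      split_ifs with hij
      · simp [mem_pairs, hij]
      · simp [mem_pairs, lt_of_le_of_ne (not_lt.mp hij) hj']
    · intro a ha b hb hab
      have ha' := Finset.ne_of_mem_erase ha
      have hb' := Finset.ne_of_mem_erase hb
      split_ifs at hab <;> simp_all
    · intro p hp
      simp only [Finset.mem_filter, mem_pairs] at hp
      obtain ⟨hlt, h1 | h2⟩ := hp
      · refine ⟨p.2, by simp [← h1, hlt.ne'], ?_⟩
        rw [if_pos (h1 ▸ hlt), ← h1]
      · refine ⟨p.1, by simp [← h2, hlt.ne], ?_⟩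
        rw [if_neg (h2 ▸ not_lt.mpr hlt.le), ← h2]
    · intro j hj
      have hj' := Finset.ne_of_mem_erase hj
      split_ifs <;> simp_all
  · intro p hp hp'
    simp only [Finset.mem_filter, not_and, not_or] at hp'
    obtain ⟨h1, h2⟩ := hp' hp
    rw [if_neg h1, if_neg h2]

/-- Only the factors containing x_i change. Without denominators this expresses ∏_{j≠i} (u x_i -
x_j) / (x_i - x_j), the coefficient in Macdonald's operator, as a ratio of Vandermonde products. -/
theorem twist_vand (i : Fin k) (u : ℂˣ) :
    twist i u (vand k) * ∏ j ∈ Finset.univ.erase i, (xpow i 1 - xpow j 1) =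
      vand k * ∏ j ∈ Finset.univ.erase i, ((u : ℂ) • xpow i 1 - xpow j 1) := by
  rw [← prod_pairs_eq, ← prod_pairs_eq, vand, map_prod, ← Finset.prod_mul_distrib,
    ← Finset.prod_mul_distrib]
  refine Finset.prod_congr rfl fun p hp => ?_
  have hp' := mem_pairs.mp hp
  rw [map_sub]
  split_ifs with h1 h2
  · subst h1
    rw [twist_xpow_self, twist_xpow_of_ne hp'.ne, zpow_one]
    ring
  · subst h2
    rw [twist_xpow_self, twist_xpow_of_ne hp'.ne', zpow_one]
    ring
  · rw [twist_xpow_of_ne (Ne.symm h1), twist_xpow_of_ne (Ne.symm h2)]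

end LaurentTwist

/-! ### The partial fraction identity behind Macdonald's operator. -/

section PartialFractions

open Polynomial

variable {k : ℕ}

theorem coeff_prod_one_sub (S : Finset (Fin k)) (y : Fin k → Laurent k) :
    (∏ i ∈ S, (1 - C (y i) * X)).coeff S.card = ∏ i ∈ S, -y i := by
  have h := Polynomial.coeff_prod_of_natDegree_le (s := S) (fun i => 1 - C (y i) * X) 1
    (fun i _ => by compute_degree)
  rw [mul_one] at h
  rw [h]
  refine Finset.prod_congr rfl fun i _ => ?_
  simp [coeff_one]

theorem natDegree_prod_one_sub (S : Finset (Fin k)) (y : Fin k → Laurent k) :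
    (∏ i ∈ S, (1 - C (y i) * X)).natDegree ≤ S.card := by
  refine (natDegree_prod_le _ _).trans ?_
  rw [Finset.card_eq_sum_ones]
  exact Finset.sum_le_sum fun i _ => by compute_degree

/-- After division by ∏ (1 - x_i z) this is the decomposition of vand · ∏ (1 - s x_i z) / (1 - x_i
z) into a constant and simple poles. Both sides have degree at most k in z and the same coefficient
of z ^ k, so agreement at the k points z = 1 / x_l suffices. -/
theorem partial_fractions (s : ℂˣ) :
    C (vand k) * ∏ i, (1 - C ((s : ℂ) • xpow i 1) * X) =
      C ((s : ℂ) ^ k • vand k) * ∏ i, (1 - C (xpow i 1) * X) +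
      ∑ i, C (((1 - (s : ℂ)) * (s : ℂ) ^ (k - 1)) • twist i s⁻¹ (vand k)) *
        ∏ j ∈ Finset.univ.erase i, (1 - C (xpow j 1) * X) := by
  rw [← sub_eq_zero]
  set P : (Laurent k)[X] := C (vand k) * ∏ i, (1 - C ((s : ℂ) • xpow i 1) * X) -
      (C ((s : ℂ) ^ k • vand k) * ∏ i, (1 - C (xpow i 1) * X) +
      ∑ i, C (((1 - (s : ℂ)) * (s : ℂ) ^ (k - 1)) • twist i s⁻¹ (vand k)) *
        ∏ j ∈ Finset.univ.erase i, (1 - C (xpow j 1) * X)) with hP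
  have hcard : (Finset.univ : Finset (Fin k)).card = k := by simp
  have hdeg2 : ∀ i : Fin k, (∏ j ∈ Finset.univ.erase i, (1 - C (xpow j 1 : Laurent k) * X)).natDegree
      < k := by
    intro i
    have h1 := natDegree_prod_one_sub (Finset.univ.erase i) (fun j => (xpow j 1 : Laurent k))
    rw [Finset.card_erase_of_mem (Finset.mem_univ i), hcard] at h1
    have := i.pos
    omega
  have hnat : P.natDegree ≤ k := by
    refine (natDegree_sub_le _ _).trans (max_le ?_ ((natDegree_add_le _ _).trans (max_le ?_ ?_)))
    · exact (natDegree_C_mul_le _ _).trans ((natDegree_prod_one_sub _ _).trans hcard.le)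
    · exact (natDegree_C_mul_le _ _).trans ((natDegree_prod_one_sub _ _).trans hcard.le)
    · refine natDegree_sum_le_of_forall_le _ _ fun i _ => ?_
      exact (natDegree_C_mul_le _ _).trans (hdeg2 i).le
  have hcoef : P.coeff k = 0 := by
    have h1 := coeff_prod_one_sub (Finset.univ) fun i : Fin k => (s : ℂ) • (xpow i 1 : Laurent k)
    have h2 := coeff_prod_one_sub (Finset.univ) fun i : Fin k => (xpow i 1 : Laurent k)
    rw [hcard] at h1 h2
    rw [hP, coeff_sub, coeff_add, coeff_C_mul, coeff_C_mul, h1, h2, finsetSum_coeff,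
      Finset.sum_eq_zero fun i _ => by
        rw [coeff_C_mul, coeff_eq_zero_of_natDegree_lt (hdeg2 i), mul_zero]]
    have h3 : ∏ i : Fin k, -((s : ℂ) • (xpow i 1 : Laurent k)) =
        (s : ℂ) ^ k • ∏ i : Fin k, -(xpow i 1 : Laurent k) := by
      simp only [← smul_neg]
      rw [Finset.prod_smul, Finset.prod_const, hcard]
    rw [h3]
    simp
  have hdeg : P.degree < (Finset.univ : Finset (Fin k)).card := by
    rw [hcard, degree_lt_iff_coeff_zero]
    intro n hn
    rcases eq_or_lt_of_le hn with rfl | h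
    · exact hcoef
    · exact coeff_eq_zero_of_natDegree_lt (by omega)
  refine Polynomial.eq_zero_of_degree_lt_of_eval_index_eq_zero Finset.univ
    (v := fun i : Fin k => xpow i (-1)) (xpow_injective (by norm_num)).injOn hdeg fun l _ => ?_
  have hx : (xpow l 1 * xpow l (-1) : Laurent k) = 1 := by
    rw [xpow_mul]; simp [xpow_zero]
  rw [hP, eval_sub, eval_add, eval_finsetSum]
  simp only [eval_mul, eval_prod, eval_sub, eval_one, eval_C, eval_X]
  rw [← Finset.mul_prod_erase Finset.univ (fun i => 1 - xpow i 1 * xpow l (-1)) (Finset.mem_univ l),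
    Finset.sum_eq_single l, hx, sub_self, zero_mul, mul_zero, zero_add, sub_eq_zero,
    ← Finset.mul_prod_erase Finset.univ (fun i => 1 - (s : ℂ) • xpow i 1 * xpow l (-1))
      (Finset.mem_univ l)]
  -- At z = 1 / x_l only the l-th simple pole survives, and its residue is read off from
  -- `twist_vand` divided by x_l ^ (k - 1).
  · have h1 := congrArg (· * ∏ _j ∈ Finset.univ.erase l, xpow l (-1)) (twist_vand l s⁻¹)
    simp only [mul_assoc, ← Finset.prod_mul_distrib, sub_mul, hx, smul_mul_assoc] at h1
    have h2 : ∏ j ∈ Finset.univ.erase l, (1 - (s : ℂ) • (xpow j 1 * xpow l (-1)) : Laurent k) =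
        (s : ℂ) ^ (k - 1) • ∏ j ∈ Finset.univ.erase l,
          (((s⁻¹ : ℂˣ) : ℂ) • 1 - xpow j 1 * xpow l (-1)) := by
      have h3 : (Finset.univ.erase l).card = k - 1 := by
        rw [Finset.card_erase_of_mem (Finset.mem_univ l), hcard]
      rw [← h3, ← Finset.prod_const, ← Finset.prod_smul]
      refine Finset.prod_congr rfl fun j _ => ?_
      rw [smul_sub, smul_smul]
      simp
    rw [smul_mul_assoc, hx, smul_mul_assoc, h1]
    simp only [smul_mul_assoc]
    rw [h2]
    simp only [Algebra.smul_def, map_sub, map_mul, map_one, mul_one]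
    ring
  · intro i _ hi
    rw [Finset.prod_eq_zero (Finset.mem_erase.mpr ⟨hi.symm, Finset.mem_univ l⟩), mul_zero]
    rw [hx, sub_self]
  · intro h; exact absurd (Finset.mem_univ l) h

end PartialFractions

/-! ### Macdonald's operator on Λ, its self-adjointness, and its form in k variables. -/

section MacdonaldOperator

variable {k : ℕ}

/-- The coefficient of `z ^ j` in `exp (∑ (1 - s ^ n) p_n z ^ n / n) = ∏ (1 - s x z) / (1 - x z)`. -/
def kernelCoeff (s : ℂ) (j : ℕ) : SymFun :=
  expCoeff (fun n : ℕ+ => ((1 - s ^ (n : ℕ)) / ((n : ℕ) : ℂ)) • (MvPolynomial.X n : SymFun)) j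

theorem mk_pow_mul_one_sub {R : Type*} [CommRing R] (x : R) :
    (PowerSeries.mk fun j => x ^ j) * (1 - PowerSeries.C x * PowerSeries.X) = 1 := by
  ext j
  rw [mul_sub, mul_one, ← mul_assoc, mul_comm _ (PowerSeries.C x), mul_assoc]
  cases j with
  | zero => simp
  | succ j =>
    rw [map_sub, PowerSeries.coeff_C_mul, PowerSeries.coeff_succ_mul_X]
    simp [pow_succ', PowerSeries.coeff_one]

theorem restrict_kernelCoeff_mul (s : ℂ) :
    (PowerSeries.mk fun j => restrict k (kernelCoeff s j)) *
      ∏ i : Fin k, (1 - PowerSeries.C (xpow i 1) * PowerSeries.X) =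
      ∏ i : Fin k, (1 - PowerSeries.C (s • xpow i 1) * PowerSeries.X) := by
  have h1 : (PowerSeries.mk fun j => restrict k (kernelCoeff s j)) =
      expSeries fun n : ℕ+ => ∑ i : Fin k,
        ((1 - s ^ (n : ℕ)) / ((n : ℕ) : ℂ)) • xpow i ((n : ℕ) : ℤ) := by
    ext1 j
    rw [PowerSeries.coeff_mk, expSeries, PowerSeries.coeff_mk, kernelCoeff, map_expCoeff]
    congr 1
    funext n
    rw [map_smul, restrict_X, Finset.smul_sum]
  have h2 : ∀ (y : Fin k → Laurent k), ∏ i : Fin k, (1 - PowerSeries.C (y i) * PowerSeries.X) =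
      expSeries fun n : ℕ+ => ∑ i : Fin k, -((((n : ℕ) : ℂ)⁻¹) • y i ^ (n : ℕ)) := by
    intro y
    have := expSeries_sum Finset.univ fun (i : Fin k) (n : ℕ+) => -((((n : ℕ) : ℂ)⁻¹) • y i ^ (n : ℕ))
    simp only [expSeries_neg_log] at this
    rw [← this]
    congr 1
    funext n
    rw [Finset.sum_apply]
  rw [h1, h2, h2, ← expSeries_add]
  congr 1
  funext n
  rw [Pi.add_apply, ← Finset.sum_add_distrib]
  refine Finset.sum_congr rfl fun i _ => ?_
  rw [smul_pow, xpow_pow, mul_one, smul_smul, ← neg_smul, ← neg_smul, ← add_smul]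
  congr 1
  ring

/-- Comparison of the coefficients of z ^ j in the partial fraction decomposition, with 1 / (1 - x_i
z) expanded as a geometric series. -/
theorem vand_mul_restrict_kernelCoeff (s : ℂˣ) (j : ℕ) :
    vand k * restrict k (kernelCoeff s j) =
      (if j = 0 then (s : ℂ) ^ k • vand k else 0) +
      ∑ i, (((1 - (s : ℂ)) * (s : ℂ) ^ (k - 1)) • twist i s⁻¹ (vand k)) * xpow i (j : ℤ) := by
  have hpf := congrArg (Polynomial.coeToPowerSeries.ringHom) (partial_fractions (k := k) s)
  simp only [map_mul, map_add, map_sum, map_prod, map_sub, map_one,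
    Polynomial.coeToPowerSeries.ringHom_apply, Polynomial.coe_C, Polynomial.coe_X] at hpf
  have hG := restrict_kernelCoeff_mul (k := k) s
  rw [← hG] at hpf
  have hD0 : (∏ i : Fin k, (1 - PowerSeries.C (xpow i 1 : Laurent k) * PowerSeries.X)) ≠ 0 := by
    intro h
    have := congrArg PowerSeries.constantCoeff h
    simp at this
  have hDi : ∀ i : Fin k, (PowerSeries.mk fun j => (xpow i 1 : Laurent k) ^ j) *
      ∏ i : Fin k, (1 - PowerSeries.C (xpow i 1) * PowerSeries.X) =
      ∏ j ∈ Finset.univ.erase i, (1 - PowerSeries.C (xpow j 1) * PowerSeries.X) := by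
    intro i
    rw [← Finset.mul_prod_erase _ _ (Finset.mem_univ i), ← mul_assoc, mk_pow_mul_one_sub, one_mul]
  simp only [← hDi] at hpf
  generalize (∏ i : Fin k, (1 - PowerSeries.C (xpow i 1 : Laurent k) * PowerSeries.X)) = D
    at hpf hD0
  have key : PowerSeries.C (vand k) * (PowerSeries.mk fun j => restrict k (kernelCoeff s j)) =
      PowerSeries.C ((s : ℂ) ^ k • vand k) +
      ∑ i, PowerSeries.C (((1 - (s : ℂ)) * (s : ℂ) ^ (k - 1)) • twist i s⁻¹ (vand k)) *
        PowerSeries.mk fun j => (xpow i 1) ^ j := by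
    refine mul_right_cancel₀ hD0 ?_
    rw [add_mul, Finset.sum_mul]
    simp only [← mul_assoc] at hpf
    exact hpf
  have := congrArg (PowerSeries.coeff j) key
  simp only [PowerSeries.coeff_C_mul, map_add, map_sum, PowerSeries.coeff_mk, PowerSeries.coeff_C,
    xpow_pow, mul_one] at this
  exact this

/-- The shift `p_n ↦ p_n + (q ^ n - 1) z ^ n`. -/
def qShift (q : ℂ) : SymFun →ₐ[ℂ] Polynomial SymFun := shift fun n => q ^ (n : ℕ) - 1

/-- The Macdonald operator on symmetric functions, in its vertex operator form. -/
def macdonald (q s : ℂ) : SymFun →ₗ[ℂ] SymFun :=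
  Polynomial.lsum (fun j : ℕ => LinearMap.mulLeft ℂ (kernelCoeff s j)) ∘ₗ (qShift q).toLinearMap

theorem macdonald_apply (q s : ℂ) (f : SymFun) {N : ℕ} (hN : (qShift q f).natDegree < N) :
    macdonald q s f = ∑ j ∈ Finset.range N, kernelCoeff s j * (qShift q f).coeff j := by
  rw [macdonald, LinearMap.comp_apply]
  change (qShift q f).sum (fun j x => kernelCoeff s j * x) = _
  exact Polynomial.sum_over_range' _ (by simp) N hN

/-- The weights of the Macdonald form, `n (1 - q ^ n) / (1 - q ^ (m n))`. -/
def macdonaldWeight (m : ℕ) (q : ℂ) (n : ℕ+) : ℂ :=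
  (n : ℕ) / ∑ j ∈ Finset.range m, q ^ ((n : ℕ) * j)

/-- The Macdonald operator is self-adjoint. -/
theorem form_macdonald (m : ℕ) (q : ℂˣ)
    (hq : ∀ n : ℕ+, ∑ j ∈ Finset.range m, (q : ℂ) ^ ((n : ℕ) * j) ≠ 0) (f h : SymFun) :
    form (macdonaldWeight m q) (macdonald q ((q⁻¹ ^ m : ℂˣ) : ℂ) f) h =
      form (macdonaldWeight m q) f (macdonald q ((q⁻¹ ^ m : ℂˣ) : ℂ) h) := by
  set s : ℂ := ((q⁻¹ ^ m : ℂˣ) : ℂ) with hs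
  have hsq : s * (q : ℂ) ^ m = 1 := by rw [hs]; simp
  -- Because s = q ^ (-m), the geometric sum in the weight turns 1 - s ^ n into s ^ n (q ^ n - 1).
  -- Thus multiplication by the kernel is adjoint to the very shift used in the operator, with z
  -- replaced by s z.
  have hw : (fun n : ℕ+ => macdonaldWeight m q n * ((1 - s ^ (n : ℕ)) / ((n : ℕ) : ℂ))) =
      fun n : ℕ+ => ((q : ℂ) ^ (n : ℕ) - 1) * s ^ (n : ℕ) := by
    funext n
    have hn : ((n : ℕ) : ℂ) ≠ 0 := by exact_mod_cast n.ne_zero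
    have hgeom := geom_sum_mul ((q : ℂ) ^ (n : ℕ)) m
    simp only [← pow_mul] at hgeom
    have h1 : 1 - s ^ (n : ℕ) = s ^ (n : ℕ) * ((q : ℂ) ^ ((n : ℕ) * m) - 1) := by
      rw [mul_sub, mul_one, mul_comm (n : ℕ) m, pow_mul, ← mul_pow, hsq, one_pow]
    rw [h1, ← hgeom, macdonaldWeight]
    have h2 := hq n
    field_simp
  have key : ∀ (f h : SymFun) (j : ℕ), form (macdonaldWeight m q) (kernelCoeff s j * f) h =
      s ^ j * form (macdonaldWeight m q) f ((qShift q h).coeff j) := by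
    intro f h j
    rw [kernelCoeff, form_expCoeff_mul, hw, coeff_shift_scale, map_smul, smul_eq_mul]
    rfl
  -- Writing A_j for the coefficients of the shift, both sides become ∑ s ^ j ⟨A_j f, A_j h⟩, which
  -- is symmetric in f and h.
  set N := max (qShift (q : ℂ) f).natDegree (qShift (q : ℂ) h).natDegree + 1 with hN
  rw [macdonald_apply (N := N) q s f (by omega), macdonald_apply (N := N) q s h (by omega), map_sum,
    map_sum, LinearMap.sum_apply]
  refine Finset.sum_congr rfl fun j _ => ?_
  rw [key, form_symm _ f, key, form_symm]

/-- The restriction of the Macdonald operator to `k` variables. -/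
theorem vand_mul_restrict_macdonald (q s : ℂˣ) (f : SymFun) :
    vand k * restrict k (macdonald q s f) = (s : ℂ) ^ k • (vand k * restrict k f) +
      ((1 - (s : ℂ)) * (s : ℂ) ^ (k - 1)) •
        ∑ i, twist i s⁻¹ (vand k) * twist i q (restrict k f) := by
  have h0 : (qShift (q : ℂ) f).coeff 0 = f := by
    induction f using MvPolynomial.induction_on with
    | C a => rw [qShift, shift_C]; simp
    | add f g hf hg => rw [map_add, Polynomial.coeff_add, hf, hg]
    | mul_X f n hf =>
      rw [qShift, coeff_shift_mul_X, if_neg (by have := n.pos; omega), add_zero]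
      rw [qShift] at hf
      rw [hf, mul_comm]
  -- At z = x_i the shift p_n + (q ^ n - 1) z ^ n is the power sum in which x_i has been replaced by
  -- q x_i.
  have hi : ∀ i : Fin k, Polynomial.eval₂ (restrict k).toRingHom (xpow i 1) (qShift (q : ℂ) f) =
      twist i q (restrict k f) := by
    intro i
    clear h0
    induction f using MvPolynomial.induction_on with
    | C a =>
      rw [qShift, shift_C, Polynomial.eval₂_C]
      change restrict k (algebraMap ℂ SymFun a) = twist i q (restrict k (algebraMap ℂ SymFun a))
      rw [AlgHom.commutes, AlgHom.commutes]
    | add f g hf hg => rw [map_add, Polynomial.eval₂_add, hf, hg, map_add, map_add]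
    | mul_X f n hf =>
      rw [map_mul, Polynomial.eval₂_mul, hf, map_mul, map_mul]
      congr 1
      have h1 : qShift (q : ℂ) (MvPolynomial.X n) = Polynomial.C (MvPolynomial.X n) +
          Polynomial.C (MvPolynomial.C ((q : ℂ) ^ (n : ℕ) - 1)) * Polynomial.X ^ (n : ℕ) := by
        rw [qShift, shift, MvPolynomial.aeval_X, Algebra.smul_def]
        rfl
      have h2 : (restrict k) (MvPolynomial.C ((q : ℂ) ^ (n : ℕ) - 1)) =
          algebraMap ℂ (Laurent k) ((q : ℂ) ^ (n : ℕ) - 1) := (restrict k).commutes _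
      rw [h1, Polynomial.eval₂_add, Polynomial.eval₂_mul, Polynomial.eval₂_C, Polynomial.eval₂_C,
        Polynomial.eval₂_X_pow]
      simp only [AlgHom.toRingHom_eq_coe, RingHom.coe_coe]
      rw [h2, ← Algebra.smul_def, xpow_pow, mul_one, restrict_X, map_sum,
        ← Finset.add_sum_erase _ _ (Finset.mem_univ i),
        ← Finset.add_sum_erase _ (fun l => twist i q (xpow l ((n : ℕ) : ℤ))) (Finset.mem_univ i),
        twist_xpow_self, sub_smul, one_smul,
        Finset.sum_congr rfl fun l hl => twist_xpow_of_ne (Finset.ne_of_mem_erase hl).symm q _]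
      rw [zpow_natCast, Units.val_pow_eq_pow_val]
      ring
  set N := (qShift (q : ℂ) f).natDegree + 1 with hN
  rw [macdonald_apply (N := N) q s f (by omega), map_sum, Finset.mul_sum]
  simp only [map_mul, ← mul_assoc, vand_mul_restrict_kernelCoeff, add_mul, Finset.sum_add_distrib]
  congr 1
  · rw [Finset.sum_eq_single 0]
    · rw [if_pos rfl, h0, smul_mul_assoc]
    · intro j _ hj; rw [if_neg hj, zero_mul]
    · intro h; simp [hN] at h
  · simp only [Finset.sum_mul]
    rw [Finset.sum_comm, Finset.smul_sum]
    refine Finset.sum_congr rfl fun i _ => ?_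
    rw [← hi, Polynomial.eval₂_eq_sum_range, ← hN, Finset.mul_sum, Finset.smul_sum]
    refine Finset.sum_congr rfl fun j _ => ?_
    rw [smul_mul_assoc, smul_mul_assoc, xpow_pow, mul_one, mul_assoc, mul_comm (xpow i _)]
    rfl

end MacdonaldOperator

/-! ### Leading monomials of Laurent polynomials, to divide estimates by the Vandermonde product. -/

section LeadingTerms

variable {k : ℕ}

/-- The linear functional with coefficients `c` on exponents. -/
def dot (c : Fin k → ℤ) : (Fin k → ℤ) →+ ℤ where
  toFun e := ∑ i, c i * e i
  map_zero' := by simp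
  map_add' e f := by simp [mul_add, Finset.sum_add_distrib]

theorem dot_apply (c e : Fin k → ℤ) : dot c e = ∑ i, c i * e i := rfl

theorem dot_single (c : Fin k → ℤ) (i : Fin k) (n : ℤ) : dot c (Pi.single i n) = c i * n := by
  rw [dot_apply, Finset.sum_eq_single i]
  · simp
  · intro j _ hj; simp [hj]
  · intro h; exact absurd (Finset.mem_univ i) h

/-- Compare exponents by `dot c` first, then lexicographically. -/
def orderKey (c : Fin k → ℤ) (e : Fin k → ℤ) : ℤ ×ₗ Lex (Fin k → ℤ) := toLex (dot c e, toLex e)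

theorem orderKey_add (c e f : Fin k → ℤ) : orderKey c (e + f) = orderKey c e + orderKey c f := by
  unfold orderKey
  rw [map_add]; rfl

theorem orderKey_injective (c : Fin k → ℤ) : Function.Injective (orderKey c) := by
  intro e f h
  have h1 := congrArg Prod.snd (toLex.injective h)
  exact toLex.injective h1

theorem dot_le_of_orderKey_le {c e f : Fin k → ℤ} (h : orderKey c e ≤ orderKey c f) :
    dot c e ≤ dot c f := by
  rcases Prod.Lex.toLex_le_toLex.mp h with h | h
  · exact h.le
  · exact h.1.le

/-- The leading term of `f` is `u x ^ δ`. -/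
def IsTop (c : Fin k → ℤ) (f : Laurent k) (δ : Fin k → ℤ) (u : ℂ) : Prop :=
  f.coeff δ = u ∧ ∀ e, f.coeff e ≠ 0 → orderKey c e ≤ orderKey c δ

theorem exists_of_coeff_mul_ne_zero {f g : Laurent k} {e : Fin k → ℤ} (h : (f * g).coeff e ≠ 0) :
    ∃ a b, a + b = e ∧ f.coeff a ≠ 0 ∧ g.coeff b ≠ 0 := by
  classical
  rw [AddMonoidAlgebra.coeff_mul] at h
  obtain ⟨a, ha, h⟩ := Finset.exists_ne_zero_of_sum_ne_zero h
  obtain ⟨b, hb, h⟩ := Finset.exists_ne_zero_of_sum_ne_zero h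
  refine ⟨a, b, ?_, Finsupp.mem_support_iff.mp ha, Finsupp.mem_support_iff.mp hb⟩
  by_contra hne
  simp [hne] at h

/-- The order on exponents is total and compatible with addition, so nothing cancels the product of
the leading terms. -/
theorem IsTop.mul {c : Fin k → ℤ} {f g : Laurent k} {δ ε : Fin k → ℤ} {u v : ℂ}
    (hf : IsTop c f δ u) (hg : IsTop c g ε v) : IsTop c (f * g) (δ + ε) (u * v) := by
  classical
  constructor
  · rw [AddMonoidAlgebra.coeff_mul, Finsupp.sum, Finset.sum_eq_single δ]
    · rw [Finsupp.sum, Finset.sum_eq_single ε]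
      · rw [if_pos rfl, hf.1, hg.1]
      · intro b _ hb
        rw [if_neg]
        intro h; exact hb (add_left_cancel h)
      · intro h
        rw [Finsupp.notMem_support_iff.mp h]; simp
    · intro a ha haδ
      refine Finset.sum_eq_zero fun b hb => ?_
      dsimp only
      rw [if_neg]
      intro h
      have h1 := hf.2 a (Finsupp.mem_support_iff.mp ha)
      have h2 := hg.2 b (Finsupp.mem_support_iff.mp hb)
      have h3 : orderKey c a < orderKey c δ :=
        lt_of_le_of_ne h1 fun h => haδ (orderKey_injective c h)
      have h4 := add_lt_add_of_lt_of_le h3 h2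
      rw [← orderKey_add, ← orderKey_add, h] at h4
      exact lt_irrefl _ h4
    · intro h
      rw [Finsupp.notMem_support_iff.mp h]; simp [Finsupp.sum]
  · intro e he
    obtain ⟨a, b, rfl, ha, hb⟩ := exists_of_coeff_mul_ne_zero he
    rw [orderKey_add, orderKey_add]
    exact add_le_add (hf.2 a ha) (hg.2 b hb)

theorem isTop_one (c : Fin k → ℤ) : IsTop c 1 0 1 := by
  classical
  rw [AddMonoidAlgebra.one_def]
  refine ⟨by simp, fun e he => ?_⟩
  rw [AddMonoidAlgebra.coeff_single, Finsupp.single_apply] at he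
  have : 0 = e := by by_contra h; simp [h] at he
  rw [this]

theorem IsTop.prod {c : Fin k → ℤ} {ι : Type*} (S : Finset ι) (f : ι → Laurent k)
    (δ : ι → Fin k → ℤ) (hf : ∀ i ∈ S, IsTop c (f i) (δ i) 1) :
    IsTop c (∏ i ∈ S, f i) (∑ i ∈ S, δ i) 1 := by
  classical
  induction S using Finset.induction_on with
  | empty => simpa using isTop_one c
  | insert i S hi ih =>
    rw [Finset.prod_insert hi, Finset.sum_insert hi]
    have := (hf i (Finset.mem_insert_self i S)).mul
      (ih fun j hj => hf j (Finset.mem_insert_of_mem hj))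
    rwa [one_mul] at this

theorem IsTop.add {c : Fin k → ℤ} {f g : Laurent k} {δ : Fin k → ℤ} {u v : ℂ}
    (hf : IsTop c f δ u) (hg : IsTop c g δ v) : IsTop c (f + g) δ (u + v) := by
  refine ⟨by simp [hf.1, hg.1], fun e he => ?_⟩
  by_cases h : f.coeff e = 0
  · exact hg.2 e fun h' => he (by simp [h, h'])
  · exact hf.2 e h

theorem IsTop.smul {c : Fin k → ℤ} {f : Laurent k} {δ : Fin k → ℤ} {u : ℂ}
    (hf : IsTop c f δ u) (a : ℂ) : IsTop c (a • f) δ (a * u) := by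
  refine ⟨by simp [hf.1], fun e he => hf.2 e fun h => he (by simp [h])⟩

theorem IsTop.sum {c : Fin k → ℤ} {ι : Type*} (S : Finset ι) (f : ι → Laurent k)
    {δ : Fin k → ℤ} (u : ι → ℂ) (hf : ∀ i ∈ S, IsTop c (f i) δ (u i)) :
    IsTop c (∑ i ∈ S, f i) δ (∑ i ∈ S, u i) := by
  classical
  induction S using Finset.induction_on with
  | empty => exact ⟨by simp, fun e he => absurd (by simp) he⟩
  | insert i S hi ih =>
    rw [Finset.sum_insert hi, Finset.sum_insert hi]
    exact (hf i (Finset.mem_insert_self i S)).add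
      (ih fun j hj => hf j (Finset.mem_insert_of_mem hj))

theorem IsTop.twist {c : Fin k → ℤ} {f : Laurent k} {δ : Fin k → ℤ} {u : ℂ}
    (hf : IsTop c f δ u) (i : Fin k) (v : ℂˣ) :
    IsTop c (twist i v f) δ (u * ((v ^ (δ i) : ℂˣ) : ℂ)) := by
  refine ⟨by rw [coeff_twist, hf.1], fun e he => hf.2 e fun h => he (by rw [coeff_twist, h, zero_mul])⟩

/-- The exponents of the leading monomial of the Vandermonde product. -/
def stair (k : ℕ) : Fin k → ℤ := fun i => (k : ℤ) - 1 - i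

theorem sum_pairs_single : ∑ p ∈ pairs k, (Pi.single p.1 1 : Fin k → ℤ) = stair k := by
  funext i
  rw [Finset.sum_apply]
  have h1 : ∀ p ∈ pairs k, (Pi.single p.1 1 : Fin k → ℤ) i = if p.1 = i then 1 else 0 := by
    intro p _
    rw [Pi.single_apply]
    exact if_congr eq_comm rfl rfl
  rw [Finset.sum_congr rfl h1, Finset.sum_boole]
  have h2 : (pairs k).filter (fun p => p.1 = i) = (Finset.Ioi i).image fun j => (i, j) := by
    ext ⟨a, b⟩
    simp only [Finset.mem_filter, mem_pairs, Finset.mem_image, Finset.mem_Ioi, Prod.mk.injEq]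
    constructor
    · rintro ⟨h, rfl⟩; exact ⟨b, h, rfl, rfl⟩
    · rintro ⟨j, h, rfl, rfl⟩; exact ⟨h, rfl⟩
  rw [h2, Finset.card_image_of_injective _ fun a b h => (Prod.mk.inj h).2, Fin.card_Ioi, stair]
  have := i.isLt
  omega

/-- In a factor x_a - x_b with a < b the weight of x_a is at least that of x_b, and the
lexicographic tie-break favours x_a. So the same monomial leads for every antitone c. -/
theorem isTop_vand {c : Fin k → ℤ} (hc : Antitone c) : IsTop c (vand k) (stair k) 1 := by
  classical
  rw [← sum_pairs_single]
  refine IsTop.prod _ _ _ fun p hp => ?_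
  have hp' := mem_pairs.mp hp
  have hne : (Pi.single p.2 1 : Fin k → ℤ) ≠ Pi.single p.1 1 := by
    intro h
    have := congrFun h p.1
    simp [hp'.ne] at this
  constructor
  · simp [xpow, hne]
  · intro e he
    simp only [xpow, AddMonoidAlgebra.coeff_sub, AddMonoidAlgebra.coeff_single, Finsupp.sub_apply,
      Finsupp.single_apply] at he
    by_cases h1 : Pi.single p.1 1 = e
    · rw [h1]
    · by_cases h2 : Pi.single p.2 1 = e
      · rw [← h2]
        refine Prod.Lex.toLex_le_toLex.mpr ?_
        have h3 := hc hp'.le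
        simp only [dot_single, mul_one]
        rcases lt_or_eq_of_le h3 with h | h
        · exact Or.inl h
        · refine Or.inr ⟨h, le_of_lt ?_⟩
          refine ⟨p.1, fun j hj => ?_, ?_⟩
          · change (Pi.single p.2 1 : Fin k → ℤ) j = (Pi.single p.1 1 : Fin k → ℤ) j
            rw [Pi.single_eq_of_ne hj.ne, Pi.single_eq_of_ne (hj.trans hp').ne]
          · change (Pi.single p.2 1 : Fin k → ℤ) p.1 < (Pi.single p.1 1 : Fin k → ℤ) p.1
            rw [Pi.single_eq_of_ne hp'.ne]; simp
      · simp [h1, h2] at he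

/-- If `vand k * g` is bounded in the direction `c`, then so is `g`. -/
theorem dot_le_of_vand_mul {c : Fin k → ℤ} (hc : Antitone c) {g : Laurent k} {M : ℤ}
    (h : ∀ e, (vand k * g).coeff e ≠ 0 → dot c e ≤ dot c (stair k) + M) {e : Fin k → ℤ}
    (he : g.coeff e ≠ 0) : dot c e ≤ M := by
  obtain ⟨e0, he0, hmax⟩ := Finset.exists_max_image g.coeff.support (orderKey c)
    ⟨e, Finsupp.mem_support_iff.mpr he⟩
  have htop : IsTop c g e0 (g.coeff e0) :=
    ⟨rfl, fun e he => hmax e (Finsupp.mem_support_iff.mpr he)⟩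
  -- The leading exponent of g, shifted by the staircase, really occurs in the product and therefore
  -- obeys its bound.
  have h1 := ((isTop_vand hc).mul htop).1
  have h2 := h (stair k + e0) (by rw [h1, one_mul]; exact Finsupp.mem_support_iff.mp he0)
  rw [map_add] at h2
  have h3 := dot_le_of_orderKey_le (hmax e (Finsupp.mem_support_iff.mpr he))
  linarith

end LeadingTerms

/-! ### Partial sums of exponents and dominance. -/

section Dominance

variable {k : ℕ}

/-- At each step one element not exceeding the current maximum of the list is removed from t: that
maximum if t contains it, otherwise any element. -/
theorem sum_le_sum_take {l : List ℕ} (hl : l.SortedGE) {t : Multiset ℕ} (ht : t ≤ (l : Multiset ℕ))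
    {r : ℕ} (hr : t.card ≤ r) : t.sum ≤ (l.take r).sum := by
  induction l generalizing t r with
  | nil => simp at ht; simp [ht]
  | cons a l ih =>
    have hl' := List.pairwise_cons.mp hl.pairwise
    rcases t.empty_or_exists_mem with rfl | ⟨b0, hb0⟩
    · simp
    · obtain ⟨b, hb, hba, hle⟩ : ∃ b ∈ t, b ≤ a ∧ t.erase b ≤ (l : Multiset ℕ) := by
        by_cases ha : a ∈ t
        · refine ⟨a, ha, le_rfl, ?_⟩
          have := Multiset.erase_le_erase a ht
          simpa using this
        · refine ⟨b0, hb0, ?_, (Multiset.erase_le _ _).trans ?_⟩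
          · have : b0 ∈ a :: l := by simpa using Multiset.mem_of_le ht hb0
            rcases List.mem_cons.mp this with h | h
            · exact h.le
            · exact hl'.1 b0 h
          · rw [← Multiset.cons_coe, Multiset.le_cons_of_notMem ha] at ht
            exact ht
      have hcard := Multiset.card_erase_add_one hb
      obtain ⟨r, rfl⟩ : ∃ r', r = r' + 1 := ⟨r - 1, by omega⟩
      have h1 := ih hl'.2.sortedGE hle (r := r) (by omega)
      have h2 := Multiset.sum_erase hb
      rw [List.take_succ_cons, List.sum_cons]
      omega

theorem rowLen_eq_zero {μ : YoungDiagram} {i : ℕ} (h : μ.colLen 0 ≤ i) : μ.rowLen i = 0 := by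
  have := (rowLen_pos_iff μ i).not.mpr (by omega)
  omega

theorem sum_take_rowLens (μ : YoungDiagram) (r : ℕ) :
    (μ.rowLens.take r).sum = ∑ i ∈ Finset.range r, μ.rowLen i := by
  unfold YoungDiagram.rowLens
  rw [← List.map_take, List.take_range]
  have h1 : ((List.range (min r (μ.colLen 0))).map μ.rowLen).sum =
      ∑ i ∈ Finset.range (min r (μ.colLen 0)), μ.rowLen i := rfl
  rw [h1]
  refine Finset.sum_subset (Finset.range_subset_range.mpr (min_le_left _ _)) fun i hi hi' => ?_
  simp at hi hi'
  exact rowLen_eq_zero (hi' hi)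

/-- The exponents of the dominant monomial, in `k` variables. -/
def vec (k : ℕ) (μ : YoungDiagram) : Fin k → ℤ := fun i => μ.rowLen i

theorem shapeZ_vec {μ : YoungDiagram} (h : μ.colLen 0 ≤ k) :
    shapeZ (vec k μ) = (μ.rowLens : Multiset ℕ) := by
  have h1 : (Finset.univ.val.map fun i : Fin k => ((vec k μ) i).toNat) =
      (Finset.range k).val.map μ.rowLen := by
    have : Finset.range k = Finset.univ.map (Fin.valEmbedding (n := k)) := by
      ext i; simp
    rw [this, Finset.map_val, Multiset.map_map]
    rfl
  unfold shapeZ shapeOn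
  rw [h1, ← shape_expo, shape_eq_shapeOn (S := Finset.range k) (e := expo μ)]
  · rfl
  · intro i hi
    have : μ.rowLen i ≠ 0 := Finsupp.mem_support_iff.mp hi
    rw [Finset.mem_range]
    have := (rowLen_pos_iff μ i).mp (by omega)
    omega

theorem coeff_restrict_vec {μ : YoungDiagram} (h : μ.colLen 0 ≤ k) (f : SymFun) :
    (restrict k f).coeff (vec k μ) = symCoeff μ f :=
  coeff_restrict (fun _ => Int.natCast_nonneg _) (shapeZ_vec h)

theorem coeff_restrict_mono {lam : YoungDiagram} {e : Fin k → ℤ}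
    (h : (restrict k (mono lam)).coeff e ≠ 0) :
    (∀ i, 0 ≤ e i) ∧ shapeZ e = (lam.rowLens : Multiset ℕ) := by
  classical
  have h1 : ∀ i, 0 ≤ e i := by
    by_contra h1; exact h (coeff_restrict_of_neg h1)
  obtain ⟨μ, hμ⟩ := exists_shapeZ_eq e
  rw [coeff_restrict h1 hμ, symCoeff_mono] at h
  have : μ = lam := by by_contra h'; simp [h'] at h
  exact ⟨h1, this ▸ hμ⟩

/-- The indicator function of the first `r` variables. -/
def initial (k r : ℕ) : Fin k → ℤ := fun i => if (i : ℕ) < r then 1 else 0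

theorem initial_antitone (r : ℕ) : Antitone (initial k r) := by
  intro i j hij
  have : (i : ℕ) ≤ j := hij
  unfold initial
  split_ifs <;> omega

theorem dot_initial (r : ℕ) (e : Fin k → ℤ) :
    dot (initial k r) e = ∑ i ∈ Finset.univ.filter (fun i : Fin k => (i : ℕ) < r), e i := by
  rw [dot_apply, Finset.sum_filter]
  refine Finset.sum_congr rfl fun i _ => ?_
  unfold initial
  split_ifs <;> simp

theorem dot_initial_vec (μ : YoungDiagram) {r : ℕ} (hr : r ≤ k) :
    dot (initial k r) (vec k μ) = ((∑ i ∈ Finset.range r, μ.rowLen i : ℕ) : ℤ) := by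
  rw [dot_initial]
  push_cast
  refine Finset.sum_bij (fun i _ => (i : ℕ)) ?_ ?_ ?_ ?_
  · intro i hi; simpa using hi
  · intro i _ j _ h; exact Fin.ext h
  · intro i hi
    have hi' : i < r := by simpa using hi
    exact ⟨⟨i, by omega⟩, by simpa using hi', rfl⟩
  · intro i _; rfl

theorem sum_filter_pos (s : Multiset ℕ) : (s.filter (0 < ·)).sum = s.sum := by
  induction s using Multiset.induction_on with
  | empty => simp
  | cons a s ih =>
    by_cases h : 0 < a
    · rw [Multiset.filter_cons_of_pos _ h, Multiset.sum_cons, Multiset.sum_cons, ih]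
    · rw [Multiset.filter_cons_of_neg _ h, Multiset.sum_cons, ih]
      omega

theorem dot_initial_le {lam : YoungDiagram} {e : Fin k → ℤ} (he : ∀ i, 0 ≤ e i)
    (hs : shapeZ e = (lam.rowLens : Multiset ℕ)) {r : ℕ} (hr : r ≤ k) :
    dot (initial k r) e ≤ dot (initial k r) (vec k lam) := by
  rw [dot_initial_vec _ hr, ← sum_take_rowLens, dot_initial]
  have h1 : ((Finset.univ.filter fun i : Fin k => (i : ℕ) < r).val.map fun i => (e i).toNat).filter
      (0 < ·) ≤ (lam.rowLens : Multiset ℕ) := by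
    rw [← hs]
    exact Multiset.filter_le_filter _ (Multiset.map_le_map (Finset.val_le_iff.mpr (Finset.filter_subset _ _)))
  have h2 := sum_le_sum_take lam.rowLens_sorted h1 (r := r) (by
    refine (Multiset.card_le_card (Multiset.filter_le _ _)).trans ?_
    rw [Multiset.card_map, Finset.card_val]
    refine (Finset.card_le_card_of_injOn (t := Finset.range r) (fun i : Fin k => (i : ℕ)) ?_ ?_).trans
      (by simp)
    · intro i hi; simpa using hi
    · intro i _ j _ h; exact Fin.ext h)
  have h3 : (((Finset.univ.filter fun i : Fin k => (i : ℕ) < r).val.map fun i => (e i).toNat).filter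
      (0 < ·)).sum = ∑ i ∈ Finset.univ.filter (fun i : Fin k => (i : ℕ) < r), (e i).toNat := by
    exact sum_filter_pos _
  rw [h3] at h2
  calc ∑ i ∈ Finset.univ.filter (fun i : Fin k => (i : ℕ) < r), e i
      = ((∑ i ∈ Finset.univ.filter (fun i : Fin k => (i : ℕ) < r), (e i).toNat : ℕ) : ℤ) := by
        push_cast
        refine Finset.sum_congr rfl fun i _ => ?_
        have := he i
        omega
    _ ≤ _ := by exact_mod_cast h2

end Dominance

/-! ### Macdonald's operator is triangular on monomial symmetric functions; its eigenvalues. -/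

section Triangularity

variable {k : ℕ}

theorem exists_of_coeff_vand_mul_macdonald {q s : ℂˣ} {f : SymFun} {e : Fin k → ℤ}
    (h : (vand k * restrict k (macdonald q s f)).coeff e ≠ 0) :
    ∃ a b, a + b = e ∧ (vand k).coeff a ≠ 0 ∧ (restrict k f).coeff b ≠ 0 := by
  rw [vand_mul_restrict_macdonald, AddMonoidAlgebra.coeff_add, Finsupp.add_apply] at h
  by_cases h1 : ((s : ℂ) ^ k • (vand k * restrict k f)).coeff e = 0
  · rw [h1, zero_add, AddMonoidAlgebra.coeff_smul, Finsupp.smul_apply, AddMonoidAlgebra.coeff_sum,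
      Finset.sum_apply'] at h
    obtain ⟨i, _, hi⟩ := Finset.exists_ne_zero_of_sum_ne_zero (right_ne_zero_of_smul h)
    obtain ⟨a, b, hab, ha, hb⟩ := exists_of_coeff_mul_ne_zero hi
    rw [coeff_twist] at ha hb
    exact ⟨a, b, hab, left_ne_zero_of_mul ha, left_ne_zero_of_mul hb⟩
  · rw [AddMonoidAlgebra.coeff_smul, Finsupp.smul_apply] at h1
    exact exists_of_coeff_mul_ne_zero (right_ne_zero_of_smul h1)

/-- Twists only rescale coefficients, so after multiplication by the Vandermonde product the support
lies in the sum of the two supports. The bound is then divided by the Vandermonde product again. -/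
theorem dot_le_of_coeff_macdonald {q s : ℂˣ} {f : SymFun} {c : Fin k → ℤ} (hc : Antitone c) {M : ℤ}
    (hf : ∀ e, (restrict k f).coeff e ≠ 0 → dot c e ≤ M) {e : Fin k → ℤ}
    (he : (restrict k (macdonald q s f)).coeff e ≠ 0) : dot c e ≤ M := by
  refine dot_le_of_vand_mul hc (fun e he => ?_) he
  obtain ⟨a, b, rfl, ha, hb⟩ := exists_of_coeff_vand_mul_macdonald he
  rw [map_add]
  exact add_le_add (dot_le_of_orderKey_le ((isTop_vand hc).2 a ha)) (hf b hb)

theorem sum_eq_of_shapeZ {lam : YoungDiagram} {e : Fin k → ℤ} (he : ∀ i, 0 ≤ e i)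
    (hs : shapeZ e = (lam.rowLens : Multiset ℕ)) : ∑ i, e i = lam.card := by
  have h1 : (shapeZ e).sum = ∑ i, (e i).toNat := by
    unfold shapeZ shapeOn; rw [sum_filter_pos]; rfl
  rw [card_eq_sum_rowLens, ← Multiset.sum_coe, ← hs, h1]
  push_cast
  refine Finset.sum_congr rfl fun i _ => ?_
  have := he i
  omega

/-- Every antitone linear functional bounded on m_lam stays bounded by the same constant. The
constants 1 and -1 give equal size, and the indicators of initial segments give the dominance
inequalities. -/
theorem dominatedBy_of_symCoeff_macdonald {q s : ℂˣ} {lam μ : YoungDiagram}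
    (h : symCoeff μ (macdonald q s (mono lam)) ≠ 0) : DominatedBy μ lam := by
  constructor
  · set k := max (μ.colLen 0) (lam.colLen 0) with hk
    rw [← coeff_restrict_vec (k := k) (le_max_left _ _)] at h
    have h2 := dot_le_of_coeff_macdonald (c := fun _ => -1) (M := -lam.card) antitone_const
      (fun e he => by
        obtain ⟨he0, hs⟩ := coeff_restrict_mono he
        simp [dot_apply, sum_eq_of_shapeZ he0 hs]) h
    have h3 := dot_le_of_coeff_macdonald (c := fun _ => 1) (M := lam.card) antitone_const
      (fun e he => by
        obtain ⟨he0, hs⟩ := coeff_restrict_mono he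
        simp [dot_apply, sum_eq_of_shapeZ he0 hs]) h
    have h4 : ∑ i, vec k μ i = μ.card :=
      sum_eq_of_shapeZ (fun _ => Int.natCast_nonneg _) (shapeZ_vec (le_max_left _ _))
    simp [dot_apply, h4] at h2 h3
    omega
  · intro r
    set k := max r (max (μ.colLen 0) (lam.colLen 0)) with hk
    have hμ : μ.colLen 0 ≤ k := by omega
    have hr : r ≤ k := by omega
    rw [← coeff_restrict_vec (k := k) hμ] at h
    have h2 := dot_le_of_coeff_macdonald (initial_antitone r) (M := dot (initial k r) (vec k lam))
      (fun e he => by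
        obtain ⟨he0, hs⟩ := coeff_restrict_mono he
        exact dot_initial_le he0 hs hr) h
    rw [dot_initial_vec _ hr, dot_initial_vec _ hr] at h2
    exact_mod_cast h2

/-- The eigenvalue of the Macdonald operator at a partition. -/
def macdonaldEig (q s : ℂ) (lam : YoungDiagram) : ℂ :=
  1 + (1 - s) * ∑ i ∈ Finset.range (lam.colLen 0), s ^ i * (q ^ lam.rowLen i - 1)

theorem macdonaldEig_eq (q s : ℂ) {lam : YoungDiagram} (h : lam.colLen 0 ≤ k) :
    macdonaldEig q s lam = s ^ k + (1 - s) * ∑ i ∈ Finset.range k, s ^ i * q ^ lam.rowLen i := by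
  have h1 : ∑ i ∈ Finset.range (lam.colLen 0), s ^ i * (q ^ lam.rowLen i - 1) =
      ∑ i ∈ Finset.range k, s ^ i * (q ^ lam.rowLen i - 1) := by
    refine Finset.sum_subset (Finset.range_subset_range.mpr h) fun i _ hi => ?_
    rw [rowLen_eq_zero (by simpa using hi)]; simp
  have h2 := mul_neg_geom_sum s k
  rw [macdonaldEig, h1]
  simp only [mul_sub, mul_one, Finset.sum_sub_distrib]
  rw [h2]
  ring

/-- At the first index where e and f differ, the initial sums up to that index compare the two
entries. -/
theorem toLex_le_of_dot_initial {e f : Fin k → ℤ}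
    (h : ∀ r ≤ k, dot (initial k r) e ≤ dot (initial k r) f) : toLex e ≤ toLex f := by
  by_contra hlt
  obtain ⟨i, hi, hi'⟩ := not_le.mp hlt
  change ∀ j < i, f j = e j at hi
  change f i < e i at hi'
  have h1 := h (i + 1) i.isLt
  rw [dot_initial, dot_initial] at h1
  refine absurd h1 (not_le.mpr ?_)
  refine Finset.sum_lt_sum (fun j hj => ?_) ⟨i, by simp, hi'⟩
  have hj' : (j : ℕ) < i + 1 := by simpa using hj
  rcases lt_or_eq_of_le (Nat.lt_succ_iff.mp hj') with h | h
  · exact (hi j h).le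
  · rw [Fin.ext h]; exact hi'.le

theorem isTop_of_dot_initial_le {f : Laurent k} {v : Fin k → ℤ}
    (h : ∀ r ≤ k, ∀ e, f.coeff e ≠ 0 → dot (initial k r) e ≤ dot (initial k r) v) :
    IsTop 0 f v (f.coeff v) := by
  refine ⟨rfl, fun e he => Prod.Lex.toLex_le_toLex.mpr (Or.inr ⟨?_, ?_⟩)⟩
  · simp [dot_apply]
  · exact toLex_le_of_dot_initial fun r hr => h r hr e he

/-- The coefficient is read off at the leading exponent stair + lam of the identity in k variables.
The i-th twist there contributes s ^ (k-1) s ^ (-(k-1-i)) q ^ lam_i = s ^ i q ^ lam_i. -/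
theorem symCoeff_macdonald_self (q s : ℂˣ) (lam : YoungDiagram) :
    symCoeff lam (macdonald q s (mono lam)) = macdonaldEig q s lam := by
  classical
  set k := lam.colLen 0 with hk
  have hbound : ∀ r ≤ k, ∀ e, (restrict k (mono lam)).coeff e ≠ 0 →
      dot (initial k r) e ≤ dot (initial k r) (vec k lam) := by
    intro r hr e he
    obtain ⟨he0, hs⟩ := coeff_restrict_mono he
    exact dot_initial_le he0 hs hr
  have htop1 := isTop_of_dot_initial_le hbound
  have htop2 : IsTop 0 (restrict k (macdonald q s (mono lam))) (vec k lam) _ :=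
    isTop_of_dot_initial_le fun r hr e he =>
      dot_le_of_coeff_macdonald (initial_antitone r) (hbound r hr) he
  rw [coeff_restrict_vec le_rfl] at htop1 htop2
  rw [symCoeff_mono, if_pos rfl] at htop1
  have hv := isTop_vand (k := k) (c := 0) antitone_const
  have h1 := (hv.mul htop2).1
  rw [vand_mul_restrict_macdonald, one_mul] at h1
  have h2 := ((hv.mul htop1).smul ((s : ℂ) ^ k)).add
    ((IsTop.sum Finset.univ _ _ fun i _ => (hv.twist i s⁻¹).mul (htop1.twist i q)).smul
      ((1 - (s : ℂ)) * (s : ℂ) ^ (k - 1)))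
  rw [← h1, h2.1, macdonaldEig_eq (k := k) _ _ le_rfl]
  simp only [one_mul, mul_one]
  congr 1
  rw [mul_assoc, Finset.mul_sum, Finset.sum_range]
  congr 1
  refine Finset.sum_congr rfl fun i _ => ?_
  have h3 : (q : ℂˣ) ^ (vec k lam i) = q ^ lam.rowLen i := by
    rw [vec, zpow_natCast]
  have h4 : s ^ (k - 1) * s⁻¹ ^ (stair k i) = s ^ (i : ℕ) := by
    have h5 : stair k i = ((k - 1 - i : ℕ) : ℤ) := by
      have := i.isLt
      simp only [stair]; omega
    rw [h5, zpow_natCast, inv_pow, ← div_eq_mul_inv, div_eq_iff_eq_mul, ← pow_add]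
    congr 1
    have := i.isLt
    omega
  rw [← mul_assoc, h3, ← Units.val_pow_eq_pow_val, ← Units.val_pow_eq_pow_val,
    ← Units.val_pow_eq_pow_val, ← Units.val_mul, h4]

end Triangularity

/-! ### The torus scalar product and self-adjointness of Macdonald's operator in k variables. -/

section Torus

variable {k : ℕ}

/-- The inversion `x i ↦ (x i)⁻¹`. -/
def inversion (k : ℕ) : Laurent k →ₐ[ℂ] Laurent k :=
  AddMonoidAlgebra.lift ℂ (Laurent k) (Fin k → ℤ)
    { toFun := fun e => AddMonoidAlgebra.single (-e.toAdd) 1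
      map_one' := by simp [AddMonoidAlgebra.one_def]
      map_mul' := fun e f => by
        simp [AddMonoidAlgebra.single_mul_single, add_comm] }

theorem inversion_single (e : Fin k → ℤ) (c : ℂ) :
    inversion k (AddMonoidAlgebra.single e c) = AddMonoidAlgebra.single (-e) c := by
  rw [inversion, AddMonoidAlgebra.lift_single]
  simp

theorem coeff_inversion (f : Laurent k) (e : Fin k → ℤ) :
    (inversion k f).coeff e = f.coeff (-e) := by
  classical
  induction f using laurent_induction with
  | hs d c =>
    rw [inversion_single, AddMonoidAlgebra.coeff_single, AddMonoidAlgebra.coeff_single,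
      Finsupp.single_apply, Finsupp.single_apply]
    exact if_congr neg_eq_iff_eq_neg rfl rfl
  | ha f g hf hg => simp [hf, hg]

theorem inversion_xpow (i : Fin k) (n : ℤ) : inversion k (xpow i n) = xpow i (-n) := by
  rw [xpow, inversion_single, xpow, Pi.single_neg]

/-- The constant term. -/
def constTerm (k : ℕ) : Laurent k →ₗ[ℂ] ℂ where
  toFun f := f.coeff 0
  map_add' f g := by simp
  map_smul' c f := by simp

theorem constTerm_apply (f : Laurent k) : constTerm k f = f.coeff 0 := rfl

theorem constTerm_inversion (f : Laurent k) : constTerm k (inversion k f) = constTerm k f := by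
  rw [constTerm_apply, constTerm_apply, coeff_inversion, neg_zero]

theorem constTerm_twist (i : Fin k) (u : ℂˣ) (f : Laurent k) :
    constTerm k (twist i u f) = constTerm k f := by
  rw [constTerm_apply, constTerm_apply, coeff_twist]
  simp

theorem twist_inversion_twist (i : Fin k) (u : ℂˣ) (f : Laurent k) :
    twist i u (inversion k (twist i u f)) = inversion k f := by
  ext e
  rw [coeff_twist, coeff_inversion, coeff_inversion, coeff_twist, Pi.neg_apply, mul_assoc, zpow_neg,
    ← Units.val_mul, inv_mul_cancel, Units.val_one, mul_one]

/-- The ratio `x a / x b`. -/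
def ratio (a b : Fin k) : Laurent k := xpow a 1 * xpow b (-1)

theorem inversion_ratio (a b : Fin k) : inversion k (ratio a b) = ratio b a := by
  rw [ratio, map_mul, inversion_xpow, inversion_xpow, ratio, mul_comm, neg_neg]

theorem ratio_mul (a b : Fin k) : ratio a b * xpow b 1 = xpow a 1 := by
  rw [ratio, mul_assoc, xpow_mul]
  simp [xpow_zero]

/-- The finite `q`-shifted factorial `∏_{l < m} (1 - q ^ (l + r) x a / x b)`. -/
def qFactor (m : ℕ) (q : ℂ) (r : ℕ) (a b : Fin k) : Laurent k :=
  ∏ l ∈ Finset.range m, (1 - q ^ (l + r) • ratio a b)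

theorem inversion_qFactor (m : ℕ) (q : ℂ) (r : ℕ) (a b : Fin k) :
    inversion k (qFactor m q r a b) = qFactor m q r b a := by
  simp only [qFactor, map_prod, map_sub, map_one, map_smul, inversion_ratio]

theorem twist_qFactor_left (m : ℕ) (q : ℂˣ) {a b : Fin k} (h : a ≠ b) :
    twist a q (qFactor m q 0 a b) = qFactor m q 1 a b := by
  simp only [qFactor, map_prod, map_sub, map_one, map_smul, ratio, map_mul, twist_xpow_self,
    twist_xpow_of_ne h, zpow_one]
  refine Finset.prod_congr rfl fun l _ => ?_
  rw [smul_mul_assoc, smul_smul, add_zero, pow_succ]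

theorem twist_qFactor_right (m : ℕ) (q : ℂˣ) {a b : Fin k} (h : a ≠ b) :
    twist b q (qFactor m q 1 a b) = qFactor m q 0 a b := by
  simp only [qFactor, map_prod, map_sub, map_one, map_smul, ratio, map_mul, twist_xpow_self,
    twist_xpow_of_ne h.symm]
  refine Finset.prod_congr rfl fun l _ => ?_
  rw [mul_smul_comm, smul_smul, add_zero, pow_succ, mul_assoc]
  simp

theorem twist_qFactor_of_ne (m : ℕ) (q : ℂˣ) (r : ℕ) {i a b : Fin k} (ha : i ≠ a) (hb : i ≠ b) :
    twist i q (qFactor m q r a b) = qFactor m q r a b := by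
  simp only [qFactor, map_prod, map_sub, map_one, map_smul, ratio, map_mul,
    twist_xpow_of_ne ha, twist_xpow_of_ne hb]

/-- Both (1 - x) ∏_{l<m} (1 - q ^ (l+1) x) and (1 - q ^ m x) ∏_{l<m} (1 - q ^ l x) are the product
over l ≤ m, for x = x_a / x_b. -/
theorem sub_mul_qFactor (m : ℕ) (q : ℂ) (a b : Fin k) :
    (xpow a 1 - xpow b 1) * qFactor m q 1 a b = (q ^ m • xpow a 1 - xpow b 1) * qFactor m q 0 a b := by
  have h1 : (1 - ratio a b) * qFactor m q 1 a b = (1 - q ^ m • ratio a b) * qFactor m q 0 a b := by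
    have h2 := Finset.prod_range_succ' (fun l => 1 - q ^ l • (ratio a b : Laurent k)) m
    have h3 := Finset.prod_range_succ (fun l => 1 - q ^ l • (ratio a b : Laurent k)) m
    rw [h2] at h3
    simp only [qFactor, add_zero]
    rw [pow_zero, one_smul] at h3
    rw [mul_comm, h3, mul_comm]
  have h4 := ratio_mul a b
  calc (xpow a 1 - xpow b 1) * qFactor m q 1 a b
      = -xpow b 1 * ((1 - ratio a b) * qFactor m q 1 a b) := by rw [← h4]; ring
    _ = -xpow b 1 * ((1 - q ^ m • ratio a b) * qFactor m q 0 a b) := by rw [h1]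
    _ = _ := by rw [← h4]; simp only [Algebra.smul_def]; ring

/-- The weight function of the torus scalar product. -/
def torusWeight (k m : ℕ) (q : ℂ) : Laurent k :=
  ∏ p ∈ pairs k, qFactor m q 0 p.1 p.2 * qFactor m q 0 p.2 p.1

/-- The weight function multiplied by the `i`-th coefficient of the Macdonald operator. -/
def torusWeightAt (m : ℕ) (q : ℂ) (i : Fin k) : Laurent k :=
  ∏ p ∈ pairs k, (if p.1 = i then qFactor m q 1 p.1 p.2 else qFactor m q 0 p.1 p.2) *
    (if p.2 = i then qFactor m q 1 p.2 p.1 else qFactor m q 0 p.2 p.1)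

theorem inversion_torusWeight (m : ℕ) (q : ℂ) :
    inversion k (torusWeight k m q) = torusWeight k m q := by
  rw [torusWeight, map_prod]
  refine Finset.prod_congr rfl fun p _ => ?_
  rw [map_mul, inversion_qFactor, inversion_qFactor, mul_comm]

theorem vand_mul_torusWeightAt (m : ℕ) (q : ℂˣ) (i : Fin k) :
    vand k * torusWeightAt m q i = twist i (q ^ m) (vand k) * torusWeight k m q := by
  rw [vand, torusWeightAt, torusWeight, map_prod, ← Finset.prod_mul_distrib,
    ← Finset.prod_mul_distrib]
  refine Finset.prod_congr rfl fun p hp => ?_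
  have hp' := (mem_pairs.mp hp).ne
  rw [map_sub]
  by_cases h1 : p.1 = i
  · subst h1
    rw [if_pos rfl, if_neg hp'.symm, twist_xpow_self, twist_xpow_of_ne hp', zpow_one,
      Units.val_pow_eq_pow_val, ← mul_assoc, ← mul_assoc, sub_mul_qFactor]
  · rw [if_neg h1]
    by_cases h2 : p.2 = i
    · subst h2
      have := sub_mul_qFactor m (q : ℂ) p.2 p.1
      rw [if_pos rfl, twist_xpow_self, twist_xpow_of_ne hp'.symm, zpow_one,
        Units.val_pow_eq_pow_val]
      linear_combination (-qFactor m (q : ℂ) 0 p.1 p.2) * this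
    · rw [if_neg h2, twist_xpow_of_ne (Ne.symm h1), twist_xpow_of_ne (Ne.symm h2)]

/-- For each pair containing i, inversion moves the q-shift from the ratio x_i / x_j to the ratio
x_j / x_i, and rescaling x_i by q moves it back. Other pairs are only swapped. -/
theorem twist_inversion_torusWeightAt (m : ℕ) (q : ℂˣ) (i : Fin k) :
    twist i q (inversion k (torusWeightAt m q i)) = torusWeightAt m q i := by
  rw [torusWeightAt, map_prod, map_prod]
  refine Finset.prod_congr rfl fun p hp => ?_
  have hp' := (mem_pairs.mp hp).ne
  by_cases h1 : p.1 = i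
  · subst h1
    rw [if_pos rfl, if_neg hp'.symm, map_mul, map_mul, inversion_qFactor, inversion_qFactor,
      twist_qFactor_right _ _ hp'.symm, twist_qFactor_left _ _ hp', mul_comm]
  · rw [if_neg h1]
    by_cases h2 : p.2 = i
    · subst h2
      rw [if_pos rfl, map_mul, map_mul, inversion_qFactor, inversion_qFactor,
        twist_qFactor_right _ _ hp', twist_qFactor_left _ _ hp'.symm, mul_comm]
    · rw [if_neg h2, map_mul, map_mul, inversion_qFactor, inversion_qFactor,
        twist_qFactor_of_ne _ _ _ (Ne.symm h1) (Ne.symm h2),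
        twist_qFactor_of_ne _ _ _ (Ne.symm h2) (Ne.symm h1), mul_comm]

/-- The torus scalar product. -/
def torusForm (k m : ℕ) (q : ℂ) (f g : Laurent k) : ℂ :=
  constTerm k (f * inversion k g * torusWeight k m q)

theorem inversion_inversion (f : Laurent k) : inversion k (inversion k f) = f := by
  ext e
  rw [coeff_inversion, coeff_inversion, neg_neg]

/-- The constant term is unchanged by inverting all variables and then rescaling x_i. This
substitution fixes the weight and exchanges the roles of f and g. -/
theorem constTerm_torusWeightAt (m : ℕ) (q : ℂˣ) (f g : Laurent k) (i : Fin k) :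
    constTerm k (torusWeightAt m q i * twist i q f * inversion k g) =
      constTerm k (torusWeightAt m q i * twist i q g * inversion k f) := by
  rw [← constTerm_inversion (torusWeightAt m q i * twist i q g * inversion k f),
    ← constTerm_twist i q (inversion k _), map_mul (inversion k), map_mul (inversion k),
    map_mul (twist i q), map_mul (twist i q), inversion_inversion,
    twist_inversion_torusWeightAt, twist_inversion_twist]
  refine congrArg (constTerm k) ?_
  rw [mul_assoc, mul_assoc, mul_comm (twist i q f)]

/-- Multiplication by the torus weight absorbs the denominators of the difference operator, so its
summands become Laurent polynomials separately. -/
theorem mul_torusWeight (m : ℕ) (q : ℂˣ) (a b : ℂ) {f g : Laurent k}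
    (h : vand k * g = a • (vand k * f) + b • ∑ i, twist i (q ^ m) (vand k) * twist i q f) :
    g * torusWeight k m q = a • (f * torusWeight k m q) +
      b • ∑ i, torusWeightAt m q i * twist i q f := by
  refine mul_left_cancel₀ vand_ne_zero ?_
  have h1 : vand k * ∑ i, torusWeightAt m q i * twist i q f =
      (∑ i, twist i (q ^ m) (vand k) * twist i q f) * torusWeight k m q := by
    rw [Finset.mul_sum, Finset.sum_mul]
    refine Finset.sum_congr rfl fun i _ => ?_
    rw [← mul_assoc, vand_mul_torusWeightAt]
    ring
  rw [← mul_assoc, h, mul_add, mul_smul_comm, mul_smul_comm, h1]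
  simp only [Algebra.smul_def]
  ring

theorem constTerm_mul_torusWeight (m : ℕ) (q : ℂˣ) (a b : ℂ) {f g : Laurent k} (x : Laurent k)
    (h : vand k * g = a • (vand k * f) + b • ∑ i, twist i (q ^ m) (vand k) * twist i q f) :
    constTerm k (g * torusWeight k m q * x) = a * constTerm k (f * torusWeight k m q * x) +
      b * ∑ i, constTerm k (torusWeightAt m q i * twist i q f * x) := by
  rw [mul_torusWeight m q a b h, add_mul, smul_mul_assoc, smul_mul_assoc, map_add, map_smul,
    map_smul, Finset.sum_mul, map_sum]
  rfl

theorem torusForm_eq (m : ℕ) (q : ℂ) (f g : Laurent k) :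
    torusForm k m q f g = constTerm k (f * torusWeight k m q * inversion k g) := by
  rw [torusForm, mul_right_comm]

theorem torusForm_symm (m : ℕ) (q : ℂ) (f g : Laurent k) :
    torusForm k m q f g = torusForm k m q g f := by
  rw [torusForm, ← constTerm_inversion, map_mul (inversion k), map_mul (inversion k), inversion_inversion,
    inversion_torusWeight, torusForm, mul_comm g]

/-- The Macdonald operator in `k` variables is self-adjoint for the torus scalar product. -/
theorem torusForm_macdonald (m : ℕ) (q : ℂˣ) (a b : ℂ) {f g f' g' : Laurent k}
    (h : vand k * g = a • (vand k * f) + b • ∑ i, twist i (q ^ m) (vand k) * twist i q f)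
    (h' : vand k * g' = a • (vand k * f') + b • ∑ i, twist i (q ^ m) (vand k) * twist i q f') :
    torusForm k m q g f' = torusForm k m q f g' := by
  rw [torusForm_symm m q f g', torusForm_eq, torusForm_eq, constTerm_mul_torusWeight m q a b _ h,
    constTerm_mul_torusWeight m q a b _ h', ← torusForm_eq, ← torusForm_eq, torusForm_symm,
    Finset.sum_congr rfl fun i _ => constTerm_torusWeightAt m q f f' i]

/-- The monomial `(x 0 * ⋯ * x (k - 1)) ^ c`. -/
def fullPow (k : ℕ) (c : ℤ) : Laurent k := AddMonoidAlgebra.single (fun _ => c) 1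

theorem twist_fullPow (i : Fin k) (u : ℂˣ) (c : ℤ) :
    twist i u (fullPow k c) = ((u ^ c : ℂˣ) : ℂ) • fullPow k c := by
  rw [fullPow, twist_single]
  simp

/-- Eigenvectors of the Macdonald operator, multiplied by a power of `x 0 * ⋯ * x (k - 1)`. -/
theorem vand_mul_fullPow_mul (m : ℕ) (q : ℂˣ) (c : ℕ) {f : SymFun} {lam : YoungDiagram}
    (hlam : lam.colLen 0 ≤ k)
    (hf : macdonald q ((q⁻¹ ^ m : ℂˣ) : ℂ) f = macdonaldEig q ((q⁻¹ ^ m : ℂˣ) : ℂ) lam • f) :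
    vand k * ((((q⁻¹ ^ m : ℂˣ) : ℂ) ^ k + (1 - ((q⁻¹ ^ m : ℂˣ) : ℂ)) * ∑ i ∈ Finset.range k,
        ((q⁻¹ ^ m : ℂˣ) : ℂ) ^ i * (q : ℂ) ^ (lam.rowLen i + c)) •
          (fullPow k c * restrict k f)) =
      ((q⁻¹ ^ m : ℂˣ) : ℂ) ^ k • (vand k * (fullPow k c * restrict k f)) +
        ((1 - ((q⁻¹ ^ m : ℂˣ) : ℂ)) * ((q⁻¹ ^ m : ℂˣ) : ℂ) ^ (k - 1)) •
          ∑ i, twist i (q ^ m) (vand k) * twist i q (fullPow k c * restrict k f) := by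
  have h1 := vand_mul_restrict_macdonald (k := k) q (q⁻¹ ^ m) f
  rw [hf, map_smul, macdonaldEig_eq (k := k) _ _ hlam] at h1
  generalize hs : ((q⁻¹ ^ m : ℂˣ) : ℂ) = s at *
  rw [show (q⁻¹ ^ m)⁻¹ = q ^ m by simp] at h1
  -- Each twist rescales (x_0 ⋯ x_{k-1}) ^ c by q ^ c. The eigenvalue therefore changes as if c were
  -- added to every one of the k rows.
  have h2 : ∑ i, twist i (q ^ m) (vand k) * twist i q (fullPow k c * restrict k f) =
      (q : ℂ) ^ c • (fullPow k c * ∑ i, twist i (q ^ m) (vand k) * twist i q (restrict k f)) := by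
    rw [Finset.mul_sum, Finset.smul_sum]
    refine Finset.sum_congr rfl fun i _ => ?_
    rw [map_mul, twist_fullPow, zpow_natCast, Units.val_pow_eq_pow_val]
    simp only [Algebra.smul_def]
    ring
  have h3 : ∑ i ∈ Finset.range k, s ^ i * (q : ℂ) ^ (lam.rowLen i + c) =
      (q : ℂ) ^ c * ∑ i ∈ Finset.range k, s ^ i * (q : ℂ) ^ lam.rowLen i := by
    rw [Finset.mul_sum]
    refine Finset.sum_congr rfl fun i _ => ?_
    ring
  rw [h2, h3]
  generalize ∑ i, twist i (q ^ m) (vand k) * twist i q (restrict k f) = S at *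
  generalize ∑ i ∈ Finset.range k, s ^ i * (q : ℂ) ^ lam.rowLen i = E at *
  simp only [Algebra.smul_def, map_add, map_mul, map_sub, map_one] at h1 ⊢
  linear_combination (algebraMap ℂ (Laurent k) ((q : ℂ) ^ c) * fullPow k c) * h1

end Torus

/-! ### Linear algebra of operators triangular for dominance. -/

section DominanceOrder

theorem DominatedBy.refl (μ : YoungDiagram) : DominatedBy μ μ := ⟨rfl, fun _ => le_rfl⟩

theorem DominatedBy.trans {μ ν lam : YoungDiagram} (h : DominatedBy μ ν) (h' : DominatedBy ν lam) :
    DominatedBy μ lam := ⟨h.1.trans h'.1, fun i => (h.2 i).trans (h'.2 i)⟩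

theorem DominatedBy.antisymm {μ ν : YoungDiagram} (h : DominatedBy μ ν) (h' : DominatedBy ν μ) :
    μ = ν := by
  have h1 : ∀ i, μ.rowLen i = ν.rowLen i := by
    intro i
    have h2 := le_antisymm (h.2 i) (h'.2 i)
    have h3 := le_antisymm (h.2 (i + 1)) (h'.2 (i + 1))
    rw [Finset.sum_range_succ, Finset.sum_range_succ] at h3
    omega
  ext ⟨i, j⟩
  rw [YoungDiagram.mem_cells, YoungDiagram.mem_cells, YoungDiagram.mem_iff_lt_rowLen,
    YoungDiagram.mem_iff_lt_rowLen, h1]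

theorem finite_below (lam : YoungDiagram) : {μ | DominatedBy μ lam ∧ μ ≠ lam}.Finite :=
  (finite_card_le lam.card).subset fun _ h => h.1.1.le

/-- The partitions strictly dominated by `lam`. -/
def below (lam : YoungDiagram) : Finset YoungDiagram := (finite_below lam).toFinset

theorem mem_below {μ lam : YoungDiagram} : μ ∈ below lam ↔ DominatedBy μ lam ∧ μ ≠ lam := by
  simp [below]

theorem below_trans {μ ν lam : YoungDiagram} (h : μ ∈ below ν) (h' : ν ∈ below lam) :
    μ ∈ below lam := by
  rw [mem_below] at *
  refine ⟨h.1.trans h'.1, ?_⟩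
  rintro rfl
  exact h.2 (h.1.antisymm h'.1)

/-- The finite set of partitions strictly below shrinks strictly along the order, so its cardinality
serves as a rank. -/
theorem dominance_induction {p : YoungDiagram → Prop} (h : ∀ ν, (∀ ρ ∈ below ν, p ρ) → p ν)
    (ν : YoungDiagram) : p ν := by
  induction hn : (below ν).card using Nat.strong_induction_on generalizing ν with
  | _ n ih =>
    refine h ν fun ρ hρ => ih (below ρ).card ?_ ρ rfl
    rw [← hn]
    refine Finset.card_lt_card ⟨fun μ hμ => below_trans hμ hρ, fun hsub => ?_⟩
    exact (mem_below.mp (hsub hρ)).2 rfl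

theorem macdonald_mono (q s : ℂˣ) (ν : YoungDiagram) :
    macdonald q s (mono ν) = macdonaldEig q s ν • mono ν +
      ∑ ρ ∈ below ν, symCoeff ρ (macdonald q s (mono ν)) • mono ρ := by
  classical
  apply ext_symCoeff
  intro μ
  rw [map_add, map_smul, map_sum]
  simp only [map_smul, symCoeff_mono, smul_eq_mul, mul_ite, mul_one, mul_zero]
  rw [Finset.sum_ite_eq]
  by_cases h : μ = ν
  · subst h
    rw [if_pos rfl, if_neg fun h => (mem_below.mp h).2 rfl, symCoeff_macdonald_self, add_zero]
  · rw [if_neg h, zero_add]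
    split_ifs with h'
    · rfl
    · by_contra h0
      exact h' (mem_below.mpr ⟨dominatedBy_of_symCoeff_macdonald h0, h⟩)

/-- A functional which is an eigenvector of the transpose of the Macdonald operator vanishes on
monomial symmetric functions whose lower eigenvalues are different. -/
theorem functional_mono_eq_zero {q s : ℂˣ} {L : SymFun →ₗ[ℂ] ℂ} {e : ℂ}
    (hL : ∀ f, L (macdonald q s f) = e * L f) {κ : YoungDiagram}
    (h : ∀ ν, DominatedBy ν κ → L (mono ν) = 0 ∨ macdonaldEig q s ν ≠ e) : L (mono κ) = 0 := by
  induction κ using dominance_induction with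
  | h κ ih =>
    have h1 : ∑ ρ ∈ below κ, symCoeff ρ (macdonald q s (mono κ)) * L (mono ρ) = 0 :=
      Finset.sum_eq_zero fun ρ hρ => by
        rw [ih ρ hρ fun ν hν => h ν (hν.trans (mem_below.mp hρ).1), mul_zero]
    rcases h κ (DominatedBy.refl κ) with h0 | h0
    · exact h0
    · have h2 := hL (mono κ)
      rw [macdonald_mono, map_add, map_smul, map_sum] at h2
      simp only [map_smul, smul_eq_mul] at h2
      rw [h1, add_zero, ← sub_eq_zero, ← sub_mul] at h2
      exact (mul_eq_zero.mp h2).resolve_left (sub_ne_zero.mpr h0)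

theorem eq_sum_of_mem_span {S : Finset YoungDiagram} {f : SymFun}
    (hf : f ∈ Submodule.span ℂ (mono '' (S : Set YoungDiagram))) :
    f = ∑ μ ∈ S, symCoeff μ f • mono μ := by
  classical
  apply ext_symCoeff
  intro μ
  rw [map_sum]
  simp only [map_smul, symCoeff_mono, smul_eq_mul, mul_ite, mul_one, mul_zero]
  rw [Finset.sum_ite_eq]
  split_ifs with hμ
  · rfl
  · exact symCoeff_eq_zero_of_mem_span hf (by simpa using hμ)

/-- Existence of eigenvectors of the Macdonald operator. -/
theorem exists_macdonald_eigenvector {q s : ℂˣ} {lam : YoungDiagram}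
    (h : ∀ μ ∈ below lam, macdonaldEig q s μ ≠ macdonaldEig q s lam) :
    ∃ x : YoungDiagram → ℂ, macdonald q s (mono lam - ∑ μ ∈ below lam, x μ • mono μ) =
      macdonaldEig q s lam • (mono lam - ∑ μ ∈ below lam, x μ • mono μ) := by
  set e := macdonaldEig q s lam with he
  -- On the span of the m_ν strictly below lam, the operator minus e is triangular with nonzero
  -- diagonal, hence surjective.
  have h1 : ∀ ν, ν ∈ below lam → ∃ u ∈ Submodule.span ℂ (mono '' (below lam : Set YoungDiagram)),
      macdonald q s u - e • u = mono ν := by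
    intro ν
    induction ν using dominance_induction with
    | h ν ih =>
      intro hν
      choose! u hu hu' using fun ρ (hρ : ρ ∈ below ν) => ih ρ hρ (below_trans hρ hν)
      have hne : macdonaldEig q s ν - e ≠ 0 := sub_ne_zero.mpr (h ν hν)
      set v := mono ν - ∑ ρ ∈ below ν, symCoeff ρ (macdonald q s (mono ν)) • u ρ with hv
      have h2 : macdonald q s v - e • v = (macdonaldEig q s ν - e) • mono ν := by
        have h3 : ∀ ρ ∈ below ν, symCoeff ρ (macdonald q s (mono ν)) • macdonald q s (u ρ) =
            symCoeff ρ (macdonald q s (mono ν)) • mono ρ +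
              e • symCoeff ρ (macdonald q s (mono ν)) • u ρ := by
          intro ρ hρ
          rw [smul_comm e, ← smul_add, ← hu' ρ hρ, sub_add_cancel]
        rw [hv, map_sub, map_sum]
        simp only [map_smul]
        rw [Finset.sum_congr rfl h3, Finset.sum_add_distrib, ← Finset.smul_sum, smul_sub, sub_smul,
          ← sub_eq_iff_eq_add.mpr (macdonald_mono q s ν)]
        abel
      refine ⟨(macdonaldEig q s ν - e)⁻¹ • v, Submodule.smul_mem _ _ (Submodule.sub_mem _
        (Submodule.subset_span ⟨ν, hν, rfl⟩) (Submodule.sum_mem _ fun ρ hρ =>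
          Submodule.smul_mem _ _ (hu ρ hρ))), ?_⟩
      rw [map_smul, smul_comm e, ← smul_sub, h2, smul_smul, inv_mul_cancel₀ hne, one_smul]
  choose! u hu hu' using h1
  -- This v is a preimage of the off-diagonal part of the operator applied to m_lam, so m_lam - v is
  -- an eigenvector.
  set v := ∑ ρ ∈ below lam, symCoeff ρ (macdonald q s (mono lam)) • u ρ with hv
  have hvmem : v ∈ Submodule.span ℂ (mono '' (below lam : Set YoungDiagram)) :=
    Submodule.sum_mem _ fun ρ hρ => Submodule.smul_mem _ _ (hu ρ hρ)
  have hvx := eq_sum_of_mem_span hvmem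
  refine ⟨fun μ => symCoeff μ v, ?_⟩
  rw [← hvx]
  have h2 : macdonald q s v = ∑ ρ ∈ below lam, symCoeff ρ (macdonald q s (mono lam)) • mono ρ +
      e • v := by
    rw [hv, map_sum, Finset.smul_sum, ← Finset.sum_add_distrib]
    refine Finset.sum_congr rfl fun ρ hρ => ?_
    rw [map_smul, smul_comm e, ← smul_add, ← hu' ρ hρ, sub_add_cancel]
  rw [map_sub, h2, smul_sub]
  nth_rewrite 1 [macdonald_mono q s lam]
  abel

end DominanceOrder

/-! ### Generic parameters q > 1 tending to 1, and separation of eigenvalues. -/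

section Generic

/-- A sequence of generic parameters converging to `1`. -/
def genericParam (n : ℕ) : ℂˣ :=
  Units.mk0 ((1 + 1 / ((n : ℝ) + 1) : ℝ) : ℂ) (by
    have : (0 : ℝ) < 1 + 1 / ((n : ℝ) + 1) := by positivity
    exact_mod_cast this.ne')

theorem genericParam_coe (n : ℕ) : (genericParam n : ℂ) = ((1 + 1 / ((n : ℝ) + 1) : ℝ) : ℂ) := rfl

theorem genericParam_tendsto :
    Filter.Tendsto (fun n => (genericParam n : ℂ)) Filter.atTop (nhds 1) := by
  have h : Filter.Tendsto (fun n : ℕ => (1 : ℝ) + 1 / ((n : ℝ) + 1)) Filter.atTop (nhds (1 + 0)) :=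
    tendsto_const_nhds.add tendsto_one_div_add_atTop_nhds_zero_nat
  rw [add_zero] at h
  have := (Complex.continuous_ofReal.tendsto 1).comp h
  simpa [Function.comp_def, genericParam_coe] using this

theorem genericParam_injective : Function.Injective fun n => (genericParam n : ℂ) := by
  intro a b h
  simp only [genericParam_coe, Complex.ofReal_inj, add_right_inj, one_div, inv_inj, add_left_inj,
    Nat.cast_inj] at h
  exact h

/-- An injective sequence meets the finite set of roots only finitely often. -/
theorem genericParam_eventually_ne {P : Polynomial ℂ} (hP : P ≠ 0) :
    ∀ᶠ n in Filter.atTop, P.eval (genericParam n : ℂ) ≠ 0 := by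
  have h1 : Filter.Tendsto (fun n => (genericParam n : ℂ)) Filter.atTop Filter.cofinite := by
    rw [← Nat.cofinite_eq_atTop]
    exact genericParam_injective.tendsto_cofinite
  refine h1.eventually (p := fun x => P.eval x ≠ 0) ?_
  rw [Filter.eventually_cofinite]
  simpa using Polynomial.finite_setOfPred_isRoot hP

theorem genericParam_sum_ne_zero (m : ℕ) (hm : 0 < m) (n : ℕ) (r : ℕ+) :
    ∑ j ∈ Finset.range m, (genericParam n : ℂ) ^ ((r : ℕ) * j) ≠ 0 := by
  rw [genericParam_coe]
  have h : (0 : ℝ) < ∑ j ∈ Finset.range m, (1 + 1 / ((n : ℝ) + 1)) ^ ((r : ℕ) * j) :=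
    Finset.sum_pos (fun j _ => by positivity) ⟨0, by simpa using hm⟩
  exact_mod_cast h.ne'

theorem genericParam_pow_ne_one (m : ℕ) (hm : 0 < m) (n : ℕ) : (genericParam n : ℂ) ^ m ≠ 1 := by
  rw [genericParam_coe]
  have h : (1 : ℝ) < (1 + 1 / ((n : ℝ) + 1)) ^ m := by
    refine one_lt_pow₀ ?_ hm.ne'
    have : (0 : ℝ) < 1 / ((n : ℝ) + 1) := by positivity
    linarith
  exact_mod_cast h.ne'

theorem sum_X_pow_injective {k : ℕ} {a b : Fin k → ℕ} (ha : StrictAnti a) (hb : StrictAnti b)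
    (h : ∑ i, (Polynomial.X : Polynomial ℂ) ^ a i = ∑ i, Polynomial.X ^ b i) : a = b := by
  classical
  have hcoef : ∀ {a : Fin k → ℕ}, StrictAnti a → ∀ n,
      (∑ i, (Polynomial.X : Polynomial ℂ) ^ a i).coeff n = if n ∈ Set.range a then 1 else 0 := by
    intro a ha n
    simp only [Polynomial.finsetSum_coeff, Polynomial.coeff_X_pow]
    split_ifs with hn
    · obtain ⟨i, rfl⟩ := hn
      rw [Finset.sum_eq_single i]
      · simp
      · intro j _ hj
        rw [if_neg]
        intro h; exact hj (ha.injective h.symm)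
      · intro h; exact absurd (Finset.mem_univ i) h
    · refine Finset.sum_eq_zero fun i _ => if_neg ?_
      rintro rfl
      exact hn ⟨i, rfl⟩
  have hrange : Set.range a = Set.range b := by
    ext n
    have := congrArg (fun p => Polynomial.coeff p n) h
    simp only [hcoef ha, hcoef hb] at this
    by_cases h1 : n ∈ Set.range a <;> by_cases h2 : n ∈ Set.range b <;> simp_all
  exact (StrictAnti.range_inj ha hb).mp hrange

/-- Clearing denominators by q ^ (mk) turns s ^ i q ^ r into q ^ (r + m (k - i)). Along a partition
these exponents strictly decrease, so the resulting polynomial in q determines the rows, and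
distinct rows give a nonzero difference. The shift c allows for the factor (x_0 ⋯ x_{k-1}) ^ c. -/
theorem eventually_eig_ne (m : ℕ) (hm : 0 < m) {k : ℕ} (c : ℕ) (lam : YoungDiagram)
    {ν : YoungDiagram} (hν : ν.colLen 0 ≤ k) (hne : ∃ i < k, lam.rowLen i + c ≠ ν.rowLen i) :
    ∀ᶠ n in Filter.atTop,
      macdonaldEig (genericParam n) (((genericParam n)⁻¹ ^ m : ℂˣ) : ℂ) ν ≠
      (((genericParam n)⁻¹ ^ m : ℂˣ) : ℂ) ^ k + (1 - (((genericParam n)⁻¹ ^ m : ℂˣ) : ℂ)) *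
        ∑ i ∈ Finset.range k, (((genericParam n)⁻¹ ^ m : ℂˣ) : ℂ) ^ i *
          (genericParam n : ℂ) ^ (lam.rowLen i + c) := by
  set a : Fin k → ℕ := fun i => lam.rowLen i + c + m * (k - i) with ha
  set b : Fin k → ℕ := fun i => ν.rowLen i + m * (k - i) with hb
  have hanti : ∀ μ : YoungDiagram, ∀ d : ℕ,
      StrictAnti fun i : Fin k => μ.rowLen i + d + m * (k - i) := by
    intro μ d i j hij
    have h1 := μ.rowLen_anti i j (le_of_lt hij)
    have h2 : m * (k - j) < m * (k - i) := by
      refine Nat.mul_lt_mul_of_pos_left ?_ hm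
      have : (i : ℕ) < j := hij
      have := j.isLt
      omega
    dsimp only
    omega
  have hab : a ≠ b := by
    obtain ⟨i, hi, h⟩ := hne
    intro h'
    have := congrFun h' ⟨i, hi⟩
    simp only [ha, hb] at this
    omega
  have hP : (∑ i, (Polynomial.X : Polynomial ℂ) ^ b i) - ∑ i, Polynomial.X ^ a i ≠ 0 := by
    intro h
    have hA : StrictAnti a := hanti lam c
    have hB : StrictAnti b := by simpa [hb] using hanti ν 0
    exact hab (sum_X_pow_injective hB hA (sub_eq_zero.mp h)).symm
  filter_upwards [genericParam_eventually_ne hP] with n hn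
  intro heq
  apply hn
  rw [macdonaldEig_eq (k := k) _ _ hν, add_right_inj] at heq
  have hs : (((genericParam n)⁻¹ ^ m : ℂˣ) : ℂ) * (genericParam n : ℂ) ^ m = 1 := by simp
  have hs1 : 1 - (((genericParam n)⁻¹ ^ m : ℂˣ) : ℂ) ≠ 0 := by
    intro h
    rw [← sub_eq_zero.mp h, one_mul] at hs
    exact genericParam_pow_ne_one m hm n hs
  have h1 := mul_left_cancel₀ hs1 heq
  generalize (((genericParam n)⁻¹ ^ m : ℂˣ) : ℂ) = s at *
  generalize (genericParam n : ℂ) = q at *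
  have h2 : ∀ (i : Fin k) (r : ℕ), s ^ (i : ℕ) * q ^ r * q ^ (m * k) = q ^ (r + m * (k - i)) := by
    intro i r
    have h3 : m * k = m * i + m * (k - i) := by
      rw [← mul_add]; congr 1; have := i.isLt; omega
    rw [h3, pow_add q (m * i), pow_mul q m i, pow_add q r]
    calc _ = (s * q ^ m) ^ (i : ℕ) * (q ^ r * q ^ (m * (k - i))) := by rw [mul_pow]; ring
      _ = _ := by rw [hs, one_pow, one_mul]
  have h4 := congrArg (· * q ^ (m * k)) h1
  simp only [Finset.sum_range, Finset.sum_mul, h2] at h4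
  simp only [Polynomial.eval_sub, Polynomial.eval_finsetSum, Polynomial.eval_pow, Polynomial.eval_X]
  rw [sub_eq_zero]
  exact h4

end Generic

/-! ### Positivity of the Jack form on functions with conjugated coefficients. -/

section Positivity

open MvPolynomial

/-- Complex conjugation of the coefficients. -/
def conjSym : SymFun →+* SymFun := MvPolynomial.map (starRingEnd ℂ)

theorem expand_conjSym (f : SymFun) :
    expand (conjSym f) = MvPowerSeries.map (starRingEnd ℂ) (expand f) := by
  induction f using MvPolynomial.induction_on with
  | C a =>
    rw [conjSym, MvPolynomial.map_C, expand, aeval_C, aeval_C]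
    exact (MvPowerSeries.map_C _ _).symm
  | add f g hf hg => rw [map_add, map_add, map_add, map_add, hf, hg]
  | mul_X f n hf =>
    rw [map_mul, map_mul, map_mul, map_mul, hf, conjSym, MvPolynomial.map_X]
    congr 1
    ext e
    rw [expand, aeval_X, MvPowerSeries.coeff_map]
    change powerSum n e = (starRingEnd ℂ) (powerSum n e)
    unfold powerSum
    split_ifs <;> simp

theorem conjSym_mono (μ : YoungDiagram) : conjSym (mono μ) = mono μ := by
  apply expand_injective
  rw [expand_conjSym, expand_mono]
  ext e
  rw [MvPowerSeries.coeff_map]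
  change (starRingEnd ℂ) (monomialSym μ e) = monomialSym μ e
  unfold monomialSym
  split_ifs <;> simp

/-- The pairing of f with its conjugate is a sum of squared absolute values with positive weights.
-/
theorem eq_zero_of_form_conjSym {m : ℕ} (hm : 0 < m) {f : SymFun}
    (h : form (fun s => (m : ℂ)⁻¹ * ((s : ℕ) : ℂ)) f (conjSym f) = 0) : f = 0 := by
  set r : (ℕ+ →₀ ℕ) → ℝ := fun e => e.prod fun s t => ((m : ℝ)⁻¹ * ((s : ℕ) : ℝ)) ^ t * (t ! : ℝ)
    with hr
  have hr' : ∀ e, 0 < r e := fun e => Finset.prod_pos fun s _ => by positivity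
  have h1 : form (fun s => (m : ℂ)⁻¹ * ((s : ℕ) : ℂ)) f (conjSym f) =
      ((∑ e ∈ f.support, Complex.normSq (f.coeff e) * r e : ℝ) : ℂ) := by
    rw [form_apply, Complex.ofReal_sum]
    refine Finset.sum_congr rfl fun e _ => ?_
    rw [conjSym, coeff_map, Complex.mul_conj, formWeight]
    simp only [hr, Finsupp.prod]
    push_cast
    rfl
  rw [h1] at h
  have h2 := (Finset.sum_eq_zero_iff_of_nonneg fun e _ =>
    mul_nonneg (Complex.normSq_nonneg _) (hr' e).le).mp (Complex.ofReal_eq_zero.mp h)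
  ext e
  rw [coeff_zero]
  by_contra he
  have := h2 e (mem_support_iff.mpr he)
  rcases mul_eq_zero.mp this with h3 | h3
  · exact he (Complex.normSq_eq_zero.mp h3)
  · exact (hr' e).ne' h3

/-- Monomial symmetric functions are real, so their span contains the conjugate of f and positivity
applies to the bilinear form. -/
theorem eq_zero_of_form_mono {m : ℕ} (hm : 0 < m) {S : Finset YoungDiagram} {f : SymFun}
    (hf : f ∈ Submodule.span ℂ (mono '' (S : Set YoungDiagram)))
    (h : ∀ μ ∈ S, form (fun s => (m : ℂ)⁻¹ * ((s : ℕ) : ℂ)) f (mono μ) = 0) : f = 0 := by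
  apply eq_zero_of_form_conjSym hm
  have h1 : conjSym f = ∑ μ ∈ S, (starRingEnd ℂ (symCoeff μ f)) • mono μ := by
    conv_lhs => rw [eq_sum_of_mem_span hf]
    rw [map_sum]
    refine Finset.sum_congr rfl fun μ _ => ?_
    rw [smul_eq_C_mul, map_mul, conjSym_mono, conjSym, map_C, smul_eq_C_mul]
  rw [h1, map_sum]
  refine Finset.sum_eq_zero fun μ hμ => ?_
  rw [map_smul, h μ hμ, smul_zero]

end Positivity

/-! ### Continuity of both forms in q. -/

section Limits

open Filter Topology

theorem tendsto_formWeight {w : ℕ → ℕ+ → ℂ} {w' : ℕ+ → ℂ}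
    (h : ∀ s, Tendsto (fun n => w n s) atTop (𝓝 (w' s))) (e : ℕ+ →₀ ℕ) :
    Tendsto (fun n => formWeight (w n) e) atTop (𝓝 (formWeight w' e)) :=
  tendsto_finsetProd _ fun s _ => ((h s).pow _).mul tendsto_const_nhds

theorem tendsto_form {w : ℕ → ℕ+ → ℂ} {w' : ℕ+ → ℂ}
    (h : ∀ s, Tendsto (fun n => w n s) atTop (𝓝 (w' s))) (f g : SymFun) :
    Tendsto (fun n => form (w n) f g) atTop (𝓝 (form w' f g)) := by
  simp only [form_apply]
  exact tendsto_finsetSum _ fun e _ => tendsto_const_nhds.mul (tendsto_formWeight h e)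

theorem tendsto_macdonaldWeight {m : ℕ} (hm : 0 < m) (s : ℕ+) :
    Tendsto (fun n => macdonaldWeight m (genericParam n) s) atTop
      (𝓝 ((m : ℂ)⁻¹ * ((s : ℕ) : ℂ))) := by
  have h : Tendsto (fun n => ∑ j ∈ Finset.range m, (genericParam n : ℂ) ^ ((s : ℕ) * j)) atTop
      (𝓝 (∑ j ∈ Finset.range m, (1 : ℂ) ^ ((s : ℕ) * j))) :=
    tendsto_finsetSum _ fun j _ => genericParam_tendsto.pow _
  simp only [one_pow, Finset.sum_const, Finset.card_range, nsmul_eq_mul, mul_one] at h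
  rw [← div_eq_inv_mul]
  exact tendsto_const_nhds.div h (by exact_mod_cast hm.ne')

variable {k : ℕ}

/-- Continuous dependence of the coefficients of a Laurent polynomial on a parameter. -/
def CoeffContinuous (W : ℂ → Laurent k) : Prop :=
  ∀ h : Laurent k, Continuous fun q => constTerm k (h * W q)

/-- Testing against every h makes the notion stable under products: the factor x is absorbed into h.
-/
theorem CoeffContinuous.one_sub_pow_smul_mul {W : ℂ → Laurent k} (hW : CoeffContinuous W) (r : ℕ)
    (x : Laurent k) : CoeffContinuous fun q => (1 - q ^ r • x) * W q := by
  intro h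
  have h1 : (fun q : ℂ => constTerm k (h * ((1 - q ^ r • x) * W q))) =
      fun q => constTerm k (h * W q) - q ^ r * constTerm k (h * x * W q) := by
    funext q
    rw [sub_mul, one_mul, mul_sub, map_sub, smul_mul_assoc, mul_smul_comm, map_smul, mul_assoc]
    rfl
  rw [h1]
  exact (hW h).sub ((continuous_pow r).mul (hW (h * x)))

theorem CoeffContinuous.prod_mul {ι : Type*} (S : Finset ι) {F : ι → ℂ → Laurent k}
    (hF : ∀ i ∈ S, ∀ W : ℂ → Laurent k, CoeffContinuous W → CoeffContinuous fun q => F i q * W q)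
    {W : ℂ → Laurent k} (hW : CoeffContinuous W) :
    CoeffContinuous fun q => (∏ i ∈ S, F i q) * W q := by
  classical
  induction S using Finset.induction_on with
  | empty => simpa using hW
  | insert i S hi ih =>
    simp only [Finset.prod_insert hi, mul_assoc]
    exact hF i (Finset.mem_insert_self i S) _
      (ih fun j hj => hF j (Finset.mem_insert_of_mem hj))

theorem CoeffContinuous.qFactor_mul {W : ℂ → Laurent k} (hW : CoeffContinuous W) (m r : ℕ)
    (a b : Fin k) : CoeffContinuous fun q => qFactor m q r a b * W q :=
  CoeffContinuous.prod_mul _ (fun _ _ _ hW => hW.one_sub_pow_smul_mul _ _) hW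

/-- The torus scalar product as a bilinear map. -/
def torusBilin (k m : ℕ) (q : ℂ) : Laurent k →ₗ[ℂ] Laurent k →ₗ[ℂ] ℂ :=
  LinearMap.mk₂ ℂ (torusForm k m q) (fun f f' g => by simp only [torusForm, add_mul, map_add])
    (fun c f g => by simp only [torusForm, smul_mul_assoc, map_smul])
    (fun f g g' => by simp only [torusForm, map_add, mul_add, add_mul])
    (fun c f g => by simp only [torusForm, map_smul, mul_smul_comm, smul_mul_assoc])

theorem continuous_torusForm (m : ℕ) (f g : Laurent k) :
    Continuous fun q => torusForm k m q f g := by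
  have h : CoeffContinuous fun q => torusWeight k m q * 1 :=
    CoeffContinuous.prod_mul _ (fun p _ W hW => by
      simp only [mul_assoc]
      exact (hW.qFactor_mul m 0 p.2 p.1).qFactor_mul m 0 p.1 p.2) fun h => by
        simpa using continuous_const
  simpa [torusForm] using h (f * inversion k g)

end Limits

/-! ### Jack polynomials as limits of Macdonald polynomials. -/

section Existence

open Filter Topology

theorem restrict_mono_eq_zero {k : ℕ} {ν : YoungDiagram} (h : k < ν.colLen 0) :
    restrict k (mono ν) = 0 := by
  classical
  ext e
  rw [AddMonoidAlgebra.coeff_zero, Finsupp.zero_apply]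
  by_cases he : ∀ i, 0 ≤ e i
  · obtain ⟨μ, hμ⟩ := exists_shapeZ_eq e
    rw [coeff_restrict he hμ, symCoeff_mono, if_neg]
    rintro rfl
    have h1 := congrArg Multiset.card hμ
    rw [Multiset.coe_card, YoungDiagram.length_rowLens] at h1
    have h2 : (shapeZ e).card ≤ k := by
      unfold shapeZ shapeOn
      exact (Multiset.card_le_card (Multiset.filter_le _ _)).trans (by simp)
    omega
  · exact coeff_restrict_of_neg he

theorem exists_rowLen_ne {k : ℕ} {lam ν : YoungDiagram} (h : lam.colLen 0 ≤ k)
    (h' : ν.colLen 0 ≤ k) (hne : ν ≠ lam) : ∃ i < k, lam.rowLen i + 0 ≠ ν.rowLen i := by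
  by_contra! hall
  apply hne
  have h1 : ∀ i, ν.rowLen i = lam.rowLen i := by
    intro i
    rcases lt_or_ge i k with hi | hi
    · rw [← hall i hi, add_zero]
    · rw [rowLen_eq_zero (h'.trans hi), rowLen_eq_zero (h.trans hi)]
  ext ⟨i, j⟩
  rw [YoungDiagram.mem_cells, YoungDiagram.mem_cells, YoungDiagram.mem_iff_lt_rowLen,
    YoungDiagram.mem_iff_lt_rowLen, h1]

theorem eventually_macdonaldEig_ne {m : ℕ} (hm : 0 < m) {lam ν : YoungDiagram} (hne : ν ≠ lam) :
    ∀ᶠ n in atTop, macdonaldEig (genericParam n) (((genericParam n)⁻¹ ^ m : ℂˣ) : ℂ) ν ≠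
      macdonaldEig (genericParam n) (((genericParam n)⁻¹ ^ m : ℂˣ) : ℂ) lam := by
  set k := max (lam.colLen 0) (ν.colLen 0)
  filter_upwards [eventually_eig_ne m hm (k := k) 0 lam (le_max_right _ _)
    (exists_rowLen_ne (le_max_left _ _) (le_max_right _ _) hne)] with n hn
  rw [macdonaldEig_eq (k := k) _ _ (lam := lam) (le_max_left _ _)]
  exact hn

/-- Data approximating a Jack polynomial by Macdonald polynomials. -/
theorem eventually_macdonald_eigenvector {m : ℕ} (hm : 0 < m) (lam : YoungDiagram) :
    ∃ x : ℕ → YoungDiagram → ℂ, ∀ᶠ n in atTop,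
      macdonald (genericParam n) (((genericParam n)⁻¹ ^ m : ℂˣ) : ℂ)
        (mono lam - ∑ μ ∈ below lam, x n μ • mono μ) =
      macdonaldEig (genericParam n) (((genericParam n)⁻¹ ^ m : ℂˣ) : ℂ) lam •
        (mono lam - ∑ μ ∈ below lam, x n μ • mono μ) := by
  have h : ∀ᶠ n in atTop, ∃ x : YoungDiagram → ℂ,
      macdonald (genericParam n) (((genericParam n)⁻¹ ^ m : ℂˣ) : ℂ)
        (mono lam - ∑ μ ∈ below lam, x μ • mono μ) =
      macdonaldEig (genericParam n) (((genericParam n)⁻¹ ^ m : ℂˣ) : ℂ) lam •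
        (mono lam - ∑ μ ∈ below lam, x μ • mono μ) := by
    filter_upwards [(Filter.eventually_all_finset (below lam)).mpr fun μ hμ =>
      eventually_macdonaldEig_ne hm (mem_below.mp hμ).2] with n hn
    exact exists_macdonald_eigenvector hn
  exact h.choice

/-- By self-adjointness, pairing with P n is an eigenfunctional for the eigenvalue of lam. Only the
finitely many eigenvalues of ν ≤ κ have to be avoided, and lam is not among these ν. -/
theorem form_eigenvector_mono_eq_zero {m : ℕ} (hm : 0 < m) {lam κ : YoungDiagram}
    (hκ : ¬ DominatedBy lam κ) {P : ℕ → SymFun}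
    (hP : ∀ᶠ n in atTop, macdonald (genericParam n) (((genericParam n)⁻¹ ^ m : ℂˣ) : ℂ) (P n) =
      macdonaldEig (genericParam n) (((genericParam n)⁻¹ ^ m : ℂˣ) : ℂ) lam • P n) :
    ∀ᶠ n in atTop, form (macdonaldWeight m (genericParam n)) (P n) (mono κ) = 0 := by
  classical
  filter_upwards [hP, (Filter.eventually_all_finset (insert κ (below κ))).mpr fun ν hν =>
    eventually_macdonaldEig_ne hm (lam := lam) (ν := ν) (by
      rintro rfl
      rcases Finset.mem_insert.mp hν with rfl | h
      · exact hκ (DominatedBy.refl _)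
      · exact hκ (mem_below.mp h).1)] with n hn hν
  refine functional_mono_eq_zero (q := genericParam n) (s := (genericParam n)⁻¹ ^ m) (e := macdonaldEig (genericParam n)
    (((genericParam n)⁻¹ ^ m : ℂˣ) : ℂ) lam) (fun f => ?_) fun ν h => Or.inr (hν ν ?_)
  · rw [← form_macdonald m _ (genericParam_sum_ne_zero m hm n), hn, map_smul]
    rfl
  · rw [Finset.mem_insert, mem_below]
    tauto

/-- The same argument in k variables, with the eigenvalue of lam + (c ^ k). Partitions ν with more
than k rows need no condition, since m_ν restricts to zero. -/
theorem torusForm_eigenvector_mono_eq_zero {m : ℕ} (hm : 0 < m) {k c : ℕ} {lam κ : YoungDiagram}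
    (hlam : lam.colLen 0 ≤ k)
    (hκ : ∀ ν, DominatedBy ν κ → ν.colLen 0 ≤ k → ∃ i < k, lam.rowLen i + c ≠ ν.rowLen i)
    {P : ℕ → SymFun}
    (hP : ∀ᶠ n in atTop, macdonald (genericParam n) (((genericParam n)⁻¹ ^ m : ℂˣ) : ℂ) (P n) =
      macdonaldEig (genericParam n) (((genericParam n)⁻¹ ^ m : ℂˣ) : ℂ) lam • P n) :
    ∀ᶠ n in atTop, torusForm k m (genericParam n) (fullPow k c * restrict k (P n))
      (restrict k (mono κ)) = 0 := by
  classical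
  filter_upwards [hP, (Filter.eventually_all_finset
    ((insert κ (below κ)).filter fun ν => ν.colLen 0 ≤ k)).mpr fun ν hν =>
      eventually_eig_ne m hm c lam (Finset.mem_filter.mp hν).2 (hκ ν (by
        rcases Finset.mem_insert.mp (Finset.mem_filter.mp hν).1 with rfl | h
        · exact DominatedBy.refl _
        · exact (mem_below.mp h).1) (Finset.mem_filter.mp hν).2)] with n hn hν
  set L : SymFun →ₗ[ℂ] ℂ :=
    torusBilin k m (genericParam n) (fullPow k c * restrict k (P n)) ∘ₗ (restrict k).toLinearMap
  have hL' : ∀ f, L f = torusForm k m (genericParam n) (fullPow k c * restrict k (P n))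
      (restrict k f) := fun f => rfl
  rw [← hL']
  refine functional_mono_eq_zero (q := genericParam n) (s := (genericParam n)⁻¹ ^ m)
    (e := (((genericParam n)⁻¹ ^ m : ℂˣ) : ℂ) ^ k + (1 - (((genericParam n)⁻¹ ^ m : ℂˣ) : ℂ)) *
        ∑ i ∈ Finset.range k, (((genericParam n)⁻¹ ^ m : ℂˣ) : ℂ) ^ i *
          (genericParam n : ℂ) ^ (lam.rowLen i + c)) (fun f => ?_) fun ν h => ?_
  · have h1 := vand_mul_restrict_macdonald (k := k) (genericParam n) ((genericParam n)⁻¹ ^ m) f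
    rw [inv_pow, inv_inv, ← inv_pow] at h1
    rw [hL', hL', ← torusForm_macdonald m _ _ _ (vand_mul_fullPow_mul m _ c hlam hn) h1]
    simp only [torusForm, smul_mul_assoc, map_smul, smul_eq_mul]
  · rcases lt_or_ge k (ν.colLen 0) with h1 | h1
    · left
      rw [hL', restrict_mono_eq_zero h1]
      simp [torusForm]
    · right
      refine hν ν (Finset.mem_filter.mpr ⟨?_, h1⟩)
      rw [Finset.mem_insert, mem_below]
      tauto

/-- Cramer's rule: the solution is the adjugate applied to the right-hand side, divided by the
determinant, and these depend continuously on the data. -/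
theorem tendsto_of_mulVec_eventuallyEq {ι : Type*} [Fintype ι] [DecidableEq ι]
    {G : ℕ → Matrix ι ι ℂ} {G' : Matrix ι ι ℂ} {x b : ℕ → ι → ℂ} {b' : ι → ℂ}
    (hG : Tendsto G atTop (𝓝 G')) (hb : Tendsto b atTop (𝓝 b')) (hdet : G'.det ≠ 0)
    (h : ∀ᶠ n in atTop, (G n).mulVec (x n) = b n) : ∃ x', Tendsto x atTop (𝓝 x') := by
  have h1 : Tendsto (fun n => (G n).det) atTop (𝓝 G'.det) := by
    have hc : Continuous fun M : Matrix ι ι ℂ => M.det := continuous_id.matrix_det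
    exact (hc.tendsto G').comp hG
  have h2 : Tendsto (fun n => (G n).adjugate) atTop (𝓝 G'.adjugate) := by
    have hc : Continuous fun M : Matrix ι ι ℂ => M.adjugate := continuous_id.matrix_adjugate
    exact (hc.tendsto G').comp hG
  have h3 : Tendsto (fun n => (G n).adjugate.mulVec (b n)) atTop (𝓝 (G'.adjugate.mulVec b')) := by
    have hc : Continuous fun p : Matrix ι ι ℂ × (ι → ℂ) => p.1.mulVec p.2 :=
      continuous_fst.matrix_mulVec continuous_snd
    have h4 := h2.prodMk_nhds hb
    have h5 := hc.tendsto (G'.adjugate, b')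
    have h6 := h5.comp h4
    simp only [Function.comp_def] at h6
    exact h6
  have h4 := (h1.inv₀ hdet).smul h3
  refine ⟨_, h4.congr' ?_⟩
  filter_upwards [h, h1.eventually_ne hdet] with n hn hn'
  rw [← hn, Matrix.mulVec_mulVec, Matrix.adjugate_mul, Matrix.smul_mulVec, Matrix.one_mulVec,
    smul_smul, inv_mul_cancel₀ hn', one_smul]

/-- The Gram matrix of monomial symmetric functions. -/
def gram (S : Finset YoungDiagram) (w : ℕ+ → ℂ) : Matrix S S ℂ :=
  Matrix.of fun μ ν => form w (mono ν) (mono μ)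

theorem gram_mulVec (S : Finset YoungDiagram) (w : ℕ+ → ℂ) (x : S → ℂ) (μ : S) :
    (gram S w).mulVec x μ = form w (∑ ν, x ν • mono ν) (mono μ) := by
  rw [map_sum, LinearMap.sum_apply]
  refine Finset.sum_congr rfl fun ν _ => ?_
  rw [map_smul, LinearMap.smul_apply, smul_eq_mul, mul_comm]
  rfl

theorem det_gram_ne_zero [DecidableEq YoungDiagram] {m : ℕ} (hm : 0 < m) (S : Finset YoungDiagram) :
    (gram S fun s => (m : ℂ)⁻¹ * ((s : ℕ) : ℂ)).det ≠ 0 := by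
  classical
  intro h
  obtain ⟨x, hx, hx'⟩ := Matrix.exists_mulVec_eq_zero_iff.mpr h
  apply hx
  have h1 : ∑ ν : S, x ν • mono ν = 0 := by
    refine eq_zero_of_form_mono hm (S := S) (Submodule.sum_mem _ fun ν _ =>
      Submodule.smul_mem _ _ (Submodule.subset_span ⟨ν, ν.2, rfl⟩)) fun μ hμ => ?_
    rw [← gram_mulVec S _ x ⟨μ, hμ⟩, hx', Pi.zero_apply]
  funext μ
  have h2 := congrArg (symCoeff μ) h1
  rw [map_sum, map_zero, Finset.sum_eq_single μ] at h2
  · simpa [symCoeff_mono] using h2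
  · intro ν _ hν
    rw [map_smul, symCoeff_mono, if_neg (fun h => hν (Subtype.ext h.symm)), smul_zero]
  · exact fun h => absurd (Finset.mem_univ μ) h

/-- Existence of Jack polynomials, together with their orthogonality for the torus scalar
product. -/
theorem exists_jack {m : ℕ} (hm : 0 < m) (lam : YoungDiagram) :
    ∃ J : SymFun, (mono lam - J) ∈ Submodule.span ℂ (mono '' (below lam : Set YoungDiagram)) ∧
      (∀ μ, ¬ DominatedBy lam μ → form (fun s => (m : ℂ)⁻¹ * ((s : ℕ) : ℂ)) J (mono μ) = 0) ∧
      ∀ (k c : ℕ) (κ : YoungDiagram), lam.colLen 0 ≤ k →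
        (∀ ν, DominatedBy ν κ → ν.colLen 0 ≤ k → ∃ i < k, lam.rowLen i + c ≠ ν.rowLen i) →
        torusForm k m 1 (fullPow k c * restrict k J) (restrict k (mono κ)) = 0 := by
  classical
  obtain ⟨x, hx⟩ := eventually_macdonald_eigenvector hm lam
  set P : ℕ → SymFun := fun n => mono lam - ∑ μ ∈ below lam, x n μ • mono μ with hP
  have hw := tendsto_macdonaldWeight hm
  have hform := fun f g => tendsto_form hw f g
  have hG : Tendsto (fun n => gram (below lam) (macdonaldWeight m (genericParam n))) atTop
      (𝓝 (gram (below lam) fun s => (m : ℂ)⁻¹ * ((s : ℕ) : ℂ))) :=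
    tendsto_pi_nhds.mpr fun μ => tendsto_pi_nhds.mpr fun ν => hform _ _
  have hb : Tendsto (fun n => fun μ : below lam =>
      form (macdonaldWeight m (genericParam n)) (mono lam) (mono μ)) atTop
      (𝓝 fun μ : below lam => form (fun s => (m : ℂ)⁻¹ * ((s : ℕ) : ℂ)) (mono lam) (mono μ)) :=
    tendsto_pi_nhds.mpr fun μ => hform _ _
  -- Orthogonality to all lower m_μ is a linear system for the coefficients x n, whose matrix is the
  -- Gram matrix. This forces the coefficients to converge although the eigenvalue equation
  -- degenerates at q = 1.
  have hbelow : ∀ᶠ n in atTop, ∀ μ ∈ below lam,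
      form (macdonaldWeight m (genericParam n)) (P n) (mono μ) = 0 :=
    (Filter.eventually_all_finset _).mpr fun μ hμ => form_eigenvector_mono_eq_zero hm (fun h =>
      (mem_below.mp hμ).2 ((mem_below.mp hμ).1.antisymm h)) hx
  obtain ⟨x', hx'⟩ := tendsto_of_mulVec_eventuallyEq (x := fun n (μ : below lam) => x n μ) hG hb
    (det_gram_ne_zero hm _) (by
      filter_upwards [hbelow] with n hn
      funext μ
      have h1 := hn μ μ.2
      rw [hP, map_sub, LinearMap.sub_apply, sub_eq_zero, ← Finset.sum_coe_sort] at h1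
      rw [gram_mulVec, h1])
  -- Any linear condition with convergent coefficients passes to the limit. It is used once for the
  -- form on Λ and once for the torus product.
  have hlim : ∀ (ℓ : ℕ → SymFun →ₗ[ℂ] ℂ) (ℓ' : SymFun →ₗ[ℂ] ℂ),
      (∀ f, Tendsto (fun n => ℓ n f) atTop (𝓝 (ℓ' f))) → (∀ᶠ n in atTop, ℓ n (P n) = 0) →
      ℓ' (mono lam - ∑ μ : below lam, x' μ • mono μ) = 0 := by
    intro ℓ ℓ' hℓ h0
    have h1 : Tendsto (fun n => ℓ n (P n)) atTop
        (𝓝 (ℓ' (mono lam - ∑ μ : below lam, x' μ • mono μ))) := by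
      simp only [hP, map_sub, map_sum, map_smul]
      simp only [← Finset.sum_coe_sort (below lam)]
      exact (hℓ _).sub (tendsto_finsetSum _ fun μ _ =>
        (tendsto_pi_nhds.mp hx' μ).smul (hℓ _))
    exact tendsto_nhds_unique (h1.congr' h0) tendsto_const_nhds
  refine ⟨mono lam - ∑ μ : below lam, x' μ • mono μ, ?_, fun μ hμ => ?_, fun k c κ hk hκ => ?_⟩
  · rw [sub_sub_cancel]
    exact Submodule.sum_mem _ fun ν _ =>
      Submodule.smul_mem _ _ (Submodule.subset_span ⟨ν, ν.2, rfl⟩)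
  · let ℓ : (ℕ+ → ℂ) → SymFun →ₗ[ℂ] ℂ := fun w => (form w).flip (mono μ)
    have hℓ : ∀ w f, ℓ w f = form w f (mono μ) := fun _ _ => rfl
    have h0 := form_eigenvector_mono_eq_zero hm hμ hx
    have hcont : ∀ f, Tendsto (fun n => ℓ (macdonaldWeight m (genericParam n)) f) atTop
      (𝓝 (ℓ (fun s => (m : ℂ)⁻¹ * ((s : ℕ) : ℂ)) f)) := fun f => hform f (mono μ)
    rw [← hℓ]
    simp only [← hℓ] at h0
    exact hlim (fun n => ℓ (macdonaldWeight m (genericParam n))) _ hcont h0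
  · have hcont : ∀ f, Tendsto (fun n => torusForm k m (genericParam n) (fullPow k c * restrict k f)
        (restrict k (mono κ))) atTop
          (𝓝 (torusForm k m 1 (fullPow k c * restrict k f) (restrict k (mono κ)))) := fun f => by
      have h := continuous_torusForm m (fullPow k c * restrict k f) (restrict k (mono κ))
      have h1 := (h.tendsto 1).comp genericParam_tendsto
      simp only [Function.comp_def] at h1
      exact h1
    let ℓ : ℂ → SymFun →ₗ[ℂ] ℂ := fun q => (torusBilin k m q).flip (restrict k (mono κ)) ∘ₗ
      LinearMap.mulLeft ℂ (fullPow k c) ∘ₗ (restrict k).toLinearMap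
    have hℓ : ∀ q f, ℓ q f = torusForm k m q (fullPow k c * restrict k f) (restrict k (mono κ)) :=
      fun _ _ => rfl
    have h0 := torusForm_eigenvector_mono_eq_zero hm hk hκ hx
    rw [← hℓ]
    simp only [← hℓ] at hcont h0
    exact hlim (fun n => ℓ (genericParam n)) (ℓ 1) hcont h0

end Existence

/-! ### Uniqueness of the Jack family, and its restriction to k variables. -/

section JackFamily

variable {m : ℕ}

/-- The monic Jack polynomials. -/
def jack (hm : 0 < m) (lam : YoungDiagram) : SymFun := (exists_jack hm lam).choose

theorem mono_sub_jack_mem (hm : 0 < m) (lam : YoungDiagram) :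
    mono lam - jack hm lam ∈ Submodule.span ℂ (mono '' (below lam : Set YoungDiagram)) :=
  (exists_jack hm lam).choose_spec.1

theorem form_jack_mono (hm : 0 < m) {lam μ : YoungDiagram} (h : ¬ DominatedBy lam μ) :
    form (fun s => (m : ℂ)⁻¹ * ((s : ℕ) : ℂ)) (jack hm lam) (mono μ) = 0 :=
  (exists_jack hm lam).choose_spec.2.1 μ h

theorem torusForm_jack_mono (hm : 0 < m) {k c : ℕ} {lam κ : YoungDiagram} (hk : lam.colLen 0 ≤ k)
    (h : ∀ ν, DominatedBy ν κ → ν.colLen 0 ≤ k → ∃ i < k, lam.rowLen i + c ≠ ν.rowLen i) :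
    torusForm k m 1 (fullPow k c * restrict k (jack hm lam)) (restrict k (mono κ)) = 0 :=
  (exists_jack hm lam).choose_spec.2.2 k c κ hk h

theorem expand_eq_add_sum_iff {f : SymFun} {lam : YoungDiagram} {v : YoungDiagram →₀ ℂ} :
    expand f = monomialSym lam + (v.sum fun μ c => c • monomialSym μ) ↔
      f = mono lam + v.sum fun μ c => c • mono μ := by
  rw [← expand_injective.eq_iff, map_add, expand_mono, Finsupp.sum, Finsupp.sum, map_sum]
  simp only [map_smul, expand_mono]

theorem IsJackFamily.mono_sub_mem {α : ℂ} {J : YoungDiagram → SymFun} (hJ : IsJackFamily α J)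
    (lam : YoungDiagram) :
    mono lam - J lam ∈ Submodule.span ℂ (mono '' (below lam : Set YoungDiagram)) := by
  obtain ⟨v, hv, h⟩ := hJ.triangular lam
  rw [expand_eq_add_sum_iff.mp h, sub_add_cancel_left]
  refine Submodule.neg_mem _ (Submodule.sum_mem _ fun μ hμ => Submodule.smul_mem _ _
    (Submodule.subset_span ⟨μ, ?_, rfl⟩))
  exact mem_below.mpr (hv μ (Finsupp.mem_support_iff.mp hμ))

theorem isJackFamily_jack (hm : 0 < m) : IsJackFamily (m : ℂ) (jack hm) where
  triangular lam := by
    refine ⟨symCoeffs (jack hm lam - mono lam), fun μ hμ => ?_, ?_⟩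
    · by_contra h
      refine hμ ?_
      rw [symCoeffs_apply, ← neg_sub, map_neg, symCoeff_eq_zero_of_mem_span
        (mono_sub_jack_mem hm lam) fun h' => h (mem_below.mp h'), neg_zero]
    · rw [expand_eq_add_sum_iff, ← eq_sum_mono, add_sub_cancel]
  orthogonal lam μ hne := by
    have key : ∀ lam μ : YoungDiagram, ¬ DominatedBy lam μ →
        form (fun s => (m : ℂ)⁻¹ * ((s : ℕ) : ℂ)) (jack hm lam) (jack hm μ) = 0 := by
      intro lam μ h
      have h1 : form (fun s => (m : ℂ)⁻¹ * ((s : ℕ) : ℂ)) (jack hm lam) (mono μ - jack hm μ) = 0 := by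
        rw [eq_sum_of_mem_span (mono_sub_jack_mem hm μ), map_sum]
        refine Finset.sum_eq_zero fun ν hν => ?_
        rw [map_smul, form_jack_mono hm fun h' => h (h'.trans (mem_below.mp hν).1), smul_zero]
      rw [map_sub, form_jack_mono hm h, zero_sub, neg_eq_zero] at h1
      exact h1
    rw [jackForm_eq_form]
    by_cases h : DominatedBy lam μ
    · rw [form_symm]
      exact key _ _ fun h' => hne (h.antisymm h')
    · exact key _ _ h

/-- A triangular family spans the same space as the monomial symmetric functions. -/
theorem mono_mem_span_of_triangular {J : YoungDiagram → SymFun}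
    (hJ : ∀ lam, mono lam - J lam ∈ Submodule.span ℂ (mono '' (below lam : Set YoungDiagram)))
    (lam : YoungDiagram) :
    mono lam ∈ Submodule.span ℂ (J '' (insert lam (below lam : Set YoungDiagram))) := by
  induction lam using dominance_induction with
  | h lam ih =>
    rw [← sub_add_cancel (mono lam) (J lam)]
    refine Submodule.add_mem _ ?_ (Submodule.subset_span ⟨lam, Set.mem_insert _ _, rfl⟩)
    refine (Submodule.span_le.mpr ?_) (hJ lam)
    rintro _ ⟨μ, hμ, rfl⟩
    refine Submodule.span_mono (Set.image_mono ?_) (ih μ hμ)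
    rintro ν (rfl | hν)
    · exact Set.mem_insert_of_mem _ hμ
    · exact Set.mem_insert_of_mem _ (below_trans hν hμ)

/-- The difference at lam lies in the span of the m_μ strictly below lam. It is also orthogonal to
each of them, because m_μ is a combination of the J_ν with ν ≤ μ. Positivity gives zero. -/
theorem IsJackFamily.eq_jack (hm : 0 < m) {J : YoungDiagram → SymFun}
    (hJ : IsJackFamily (m : ℂ) J) : J = jack hm := by
  funext lam
  rw [← sub_eq_zero]
  refine eq_zero_of_form_mono hm (S := below lam) ?_ fun μ hμ => ?_
  · rw [← sub_sub_sub_cancel_left _ _ (mono lam)]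
    exact Submodule.sub_mem _ (mono_sub_jack_mem hm lam) (hJ.mono_sub_mem lam)
  · have hne := mem_below.mp hμ
    rw [map_sub, LinearMap.sub_apply, form_jack_mono hm fun h => hne.2 (hne.1.antisymm h), sub_zero]
    have h1 := mono_mem_span_of_triangular hJ.mono_sub_mem μ
    generalize mono μ = f at h1
    induction h1 using Submodule.span_induction with
    | mem x hx =>
      obtain ⟨ν, hν, rfl⟩ := hx
      rw [← jackForm_eq_form]
      refine hJ.orthogonal lam ν ?_
      rintro rfl
      rcases hν with rfl | hν
      · exact hne.2 rfl
      · exact (mem_below.mp hν).2 ((mem_below.mp hν).1.antisymm hne.1)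
    | zero => rw [map_zero]
    | add x y _ _ hx hy => rw [map_add, hx, hy, add_zero]
    | smul c x _ hx => rw [map_smul, hx, smul_zero]

theorem existsUnique_isJackFamily (hm : 0 < m) :
    ∃! J : YoungDiagram → SymFun, IsJackFamily (m : ℂ) J :=
  ⟨jack hm, isJackFamily_jack hm, fun _ h => h.eq_jack hm⟩

/-- If μ had fewer rows, its full size would be reached at a row where lam still has cells left,
against the inequality of partial sums. -/
theorem DominatedBy.colLen_le {μ lam : YoungDiagram} (h : DominatedBy μ lam) :
    lam.colLen 0 ≤ μ.colLen 0 := by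
  by_contra! hlt
  have h1 := h.2 (μ.colLen 0)
  rw [← card_eq_sum_rowLen μ le_rfl, h.1, card_eq_sum_rowLen lam le_rfl] at h1
  have h2 : ∑ i ∈ Finset.range (μ.colLen 0), lam.rowLen i <
      ∑ i ∈ Finset.range (lam.colLen 0), lam.rowLen i :=
    Finset.sum_lt_sum_of_subset (Finset.range_subset_range.mpr hlt.le)
      (Finset.mem_range.mpr hlt) (by simp) ((rowLen_pos_iff lam _).mpr hlt) (by simp)
  omega

theorem restrict_jack_eq_zero (hm : 0 < m) {k : ℕ} {lam : YoungDiagram} (h : k < lam.colLen 0) :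
    restrict k (jack hm lam) = 0 := by
  have h1 : restrict k (mono lam - jack hm lam) = 0 := by
    rw [eq_sum_of_mem_span (mono_sub_jack_mem hm lam), map_sum]
    refine Finset.sum_eq_zero fun μ hμ => ?_
    rw [map_smul, restrict_mono_eq_zero (h.trans_le (mem_below.mp hμ).1.colLen_le), smul_zero]
  rw [map_sub, restrict_mono_eq_zero h, zero_sub, neg_eq_zero] at h1
  exact h1

/-- Linear combinations of Jack polynomials with at most `k` rows are determined by their
restriction to `k` variables. -/
theorem sum_jack_eq_zero (hm : 0 < m) {k : ℕ} {S : Finset YoungDiagram}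
    (hS : ∀ lam ∈ S, lam.colLen 0 ≤ k) {c : YoungDiagram → ℂ}
    (h : restrict k (∑ lam ∈ S, c lam • jack hm lam) = 0) : ∀ lam ∈ S, c lam = 0 := by
  classical
  by_contra! hne
  -- The size of `below` is strictly monotone for dominance, so the chosen lam lies below no other
  -- partition in the sum. The coefficient at x ^ lam therefore sees only J_lam.
  obtain ⟨lam, hlam, hmax⟩ := Finset.exists_max_image (S.filter fun lam => c lam ≠ 0)
    (fun lam => (below lam).card) (by
      obtain ⟨lam, h1, h2⟩ := hne
      exact ⟨lam, Finset.mem_filter.mpr ⟨h1, h2⟩⟩)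
  rw [Finset.mem_filter] at hlam
  apply hlam.2
  have h1 := coeff_restrict_vec (hS lam hlam.1) (∑ lam ∈ S, c lam • jack hm lam)
  rw [h, AddMonoidAlgebra.coeff_zero, Finsupp.zero_apply, map_sum,
    Finset.sum_eq_single_of_mem lam hlam.1] at h1
  · have h2 := symCoeff_eq_zero_of_mem_span (mono_sub_jack_mem hm lam)
      (μ := lam) fun h => (mem_below.mp h).2 rfl
    rw [map_sub, symCoeff_mono, if_pos rfl, sub_eq_zero] at h2
    rw [map_smul, ← h2, smul_eq_mul, mul_one] at h1
    exact h1.symm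
  · intro μ hμ hμl
    rw [map_smul]
    by_cases hc : c μ = 0
    · rw [hc, zero_smul]
    · have h3 : lam ∉ below μ := by
        intro h3
        refine absurd (hmax μ (Finset.mem_filter.mpr ⟨hμ, hc⟩)) (not_le.mpr ?_)
        exact Finset.card_lt_card ⟨fun ν hν => below_trans hν h3, fun hsub =>
          (mem_below.mp (hsub h3)).2 rfl⟩
      have h2 := symCoeff_eq_zero_of_mem_span (mono_sub_jack_mem hm μ) (μ := lam) h3
      rw [map_sub, symCoeff_mono, if_neg hμl.symm, zero_sub, neg_eq_zero] at h2
      rw [h2, smul_zero]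

end JackFamily

/-! ### Creation and annihilation exponentials transported to Λ. -/

section Relations

/-- The exponentials of the vertex operator live in a noncommutative algebra of operators. A
relation respected by the algebra operations carries them to exponentials in Λ. -/
theorem expCoeff_rel {R S : Type*} [Ring R] [Algebra ℂ R] [Ring S] [Algebra ℂ S]
    {P : R → S → Prop} (h0 : P 0 0) (h1 : P 1 1)
    (hadd : ∀ x y x' y', P x y → P x' y' → P (x + x') (y + y'))
    (hmul : ∀ x y x' y', P x y → P x' y' → P (x * x') (y * y'))
    (hsmul : ∀ (c : ℂ) x y, P x y → P (c • x) (c • y))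
    {b : ℕ+ → R} {b' : ℕ+ → S} (hb : ∀ n, P (b n) (b' n)) (j : ℕ) :
    P (expCoeff b j) (expCoeff b' j) := by
  have hsum : ∀ {ι : Type} (s : Finset ι) (F : ι → R) (G : ι → S), (∀ i ∈ s, P (F i) (G i)) →
      P (∑ i ∈ s, F i) (∑ i ∈ s, G i) := by
    classical
    intro ι s F G h
    induction s using Finset.induction_on with
    | empty => simpa using h0
    | insert i s hi ih =>
      rw [Finset.sum_insert hi, Finset.sum_insert hi]
      exact hadd _ _ _ _ (h i (Finset.mem_insert_self i s))
        (ih fun j hj => h j (Finset.mem_insert_of_mem hj))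
  unfold expCoeff
  refine hsum _ _ _ fun r hr => hsmul _ _ _ ?_
  clear hr
  induction r generalizing j with
  | zero =>
    rw [pow_zero, pow_zero, PowerSeries.coeff_one, PowerSeries.coeff_one]
    split_ifs
    · exact h1
    · exact h0
  | succ r ih =>
    rw [pow_succ, pow_succ, PowerSeries.coeff_mul, PowerSeries.coeff_mul]
    refine hsum _ _ _ fun x _ => hmul _ _ _ _ (ih x.1) ?_
    rw [PowerSeries.coeff_mk, PowerSeries.coeff_mk]
    split_ifs
    · exact hb _
    · exact h0

variable (m : ℕ)

theorem sqrt_mul_sqrt : ((√(2 * (m : ℝ)) : ℝ) : ℂ) * ((√((m : ℝ) / 2) : ℝ) : ℂ) = m := by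
  rw [← Complex.ofReal_mul, ← Real.sqrt_mul (by positivity),
    show 2 * (m : ℝ) * ((m : ℝ) / 2) = (m : ℝ) ^ 2 by ring, Real.sqrt_sq (by positivity)]
  simp

theorem toSymFun_creationCoeff (i : ℕ) (f : Fock) :
    toSymFun m (creationCoeff m i f) =
      expCoeff (fun n : ℕ+ => ((m : ℂ) / ((n : ℕ) : ℂ)) • (MvPolynomial.X n : SymFun)) i *
        toSymFun m f := by
  rw [creationCoeff, if_pos (Int.natCast_nonneg i), Int.toNat_natCast]
  revert f
  refine expCoeff_rel (P := fun (T : Module.End ℂ Fock) (x : SymFun) =>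
    ∀ f, toSymFun m (T f) = x * toSymFun m f) ?_ ?_ ?_ ?_ ?_ ?_ i
  · intro f; simp
  · intro f; simp
  · intro x y x' y' h h' f
    rw [LinearMap.add_apply, map_add, h, h', add_mul]
  · intro x y x' y' h h' f
    rw [Module.End.mul_apply, h, h', mul_assoc]
  · intro c x y h f
    rw [LinearMap.smul_apply, map_smul, h, smul_mul_assoc]
  · intro n f
    rw [LinearMap.smul_apply, map_smul, create, LinearMap.mulLeft_apply, map_mul, ← smul_mul_assoc]
    congr 1
    rw [toSymFun, MvPolynomial.aeval_X, smul_smul, Complex.ofReal_div, ← sqrt_mul_sqrt]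
    congr 1
    push_cast
    ring

theorem pderiv_toSymFun (n : ℕ+) (f : Fock) :
    MvPolynomial.pderiv n (toSymFun m f) =
      ((√((m : ℝ) / 2) : ℝ) : ℂ) • toSymFun m (MvPolynomial.pderiv n f) := by
  classical
  induction f using MvPolynomial.induction_on with
  | C a => simp [toSymFun]
  | add f g hf hg => simp only [map_add, hf, hg, smul_add]
  | mul_X f i hf =>
    rw [map_mul, Derivation.leibniz, Derivation.leibniz, hf, map_add]
    simp only [toSymFun, MvPolynomial.aeval_X, MvPolynomial.pderiv_X, smul_eq_mul, map_mul]
    rw [smul_add]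
    congr 1
    · rw [← mul_smul_comm]
      congr 2
      by_cases h : i = n
      · subst h; simp
      · simp [h]
    · rw [mul_smul_comm, smul_mul_assoc]

/-- The adjoint of ∂/∂p_n is multiplication by (m / n) p_n, and √(2m) / √(m/2) = 2, which gives the
factor -2m / n. Taking adjoints reverses products, harmlessly since Λ is commutative. -/
theorem form_annihilationCoeff (hm : 0 < m) (j : ℕ) (f : Fock) (g : SymFun) :
    form (fun s => (m : ℂ)⁻¹ * ((s : ℕ) : ℂ)) (toSymFun m (annihilationCoeff m j f)) g =
      form (fun s => (m : ℂ)⁻¹ * ((s : ℕ) : ℂ)) (toSymFun m f)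
        (expCoeff (fun n : ℕ+ => (-(2 * (m : ℂ)) / ((n : ℕ) : ℂ)) •
          (MvPolynomial.X n : SymFun)) j * g) := by
  rw [annihilationCoeff]
  revert f g
  refine expCoeff_rel (P := fun (T : Module.End ℂ Fock) (x : SymFun) => ∀ f g,
    form (fun s => (m : ℂ)⁻¹ * ((s : ℕ) : ℂ)) (toSymFun m (T f)) g =
      form (fun s => (m : ℂ)⁻¹ * ((s : ℕ) : ℂ)) (toSymFun m f) (x * g)) ?_ ?_ ?_ ?_ ?_ ?_ j
  · intro f g; simp
  · intro f g; simp
  · intro x y x' y' h h' f g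
    rw [LinearMap.add_apply, map_add, map_add, LinearMap.add_apply, h, h', add_mul, map_add]
  · intro x y x' y' h h' f g
    rw [Module.End.mul_apply, h, h', ← mul_assoc, mul_comm y']
  · intro c x y h f g
    rw [LinearMap.smul_apply, map_smul, map_smul, LinearMap.smul_apply, h, smul_mul_assoc, map_smul]
  · intro n f g
    have hm' : (m : ℂ) ≠ 0 := by exact_mod_cast hm.ne'
    have hn : ((n : ℕ) : ℂ) ≠ 0 := by exact_mod_cast n.ne_zero
    have hs := sqrt_mul_sqrt m
    have hsq : ((√((m : ℝ) / 2) : ℝ) : ℂ) * ((√((m : ℝ) / 2) : ℝ) : ℂ) = m / 2 := by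
      rw [← Complex.ofReal_mul, Real.mul_self_sqrt (by positivity)]
      push_cast; rfl
    have hs0 : ((√((m : ℝ) / 2) : ℝ) : ℂ) ≠ 0 := by
      intro h; rw [h, mul_zero] at hs; exact hm' hs.symm
    have h1 : toSymFun m (MvPolynomial.pderiv n f) =
        ((√((m : ℝ) / 2) : ℝ) : ℂ)⁻¹ • MvPolynomial.pderiv n (toSymFun m f) := by
      rw [pderiv_toSymFun, smul_smul, inv_mul_cancel₀ hs0, one_smul]
    have hA : ((√(2 * (m : ℝ)) : ℝ) : ℂ) = 2 * ((√((m : ℝ) / 2) : ℝ) : ℂ) :=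
      mul_right_cancel₀ hs0 (by rw [hs, mul_assoc, hsq]; ring)
    have h2 : (((-√(2 * (m : ℝ)) / (n : ℕ) : ℝ) : ℂ) • annihilate n) f =
        (((-√(2 * (m : ℝ)) / (n : ℕ) : ℝ) : ℂ) * ((n : ℕ) : ℂ)) • MvPolynomial.pderiv n f := by
      rw [mul_smul]; rfl
    rw [h2, map_smul, h1, smul_smul, map_smul, LinearMap.smul_apply, form_symm, smul_mul_assoc,
      map_smul, form_symm _ _ (MvPolynomial.X n * g), form_X_mul, form_symm _ g, smul_eq_mul,
      smul_eq_mul, ← mul_assoc]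
    congr 1
    push_cast
    rw [hA]
    field_simp

end Relations

/-! ### Passing from k to k + 1 variables. -/

section AddVariable

variable {k : ℕ}

/-- The embedding of Laurent polynomials in the variables `x 1, …, x k` into Laurent polynomials in
`x 0, …, x k`. -/
def succVars (k : ℕ) : Laurent k →ₐ[ℂ] Laurent (k + 1) :=
  AddMonoidAlgebra.lift ℂ (Laurent (k + 1)) (Fin k → ℤ)
    { toFun := fun e => AddMonoidAlgebra.single (Fin.cons 0 e.toAdd) 1
      map_one' := by
        rw [AddMonoidAlgebra.one_def]
        congr 1
        funext i
        refine Fin.cases ?_ (fun i => ?_) i <;> simp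
      map_mul' := fun e f => by
        rw [AddMonoidAlgebra.single_mul_single, mul_one]
        congr 1
        funext i
        refine Fin.cases ?_ (fun i => ?_) i <;> simp }

theorem succVars_single (e : Fin k → ℤ) (c : ℂ) :
    succVars k (AddMonoidAlgebra.single e c) = AddMonoidAlgebra.single (Fin.cons 0 e) c := by
  rw [succVars, AddMonoidAlgebra.lift_single]
  simp

theorem succVars_xpow (i : Fin k) (n : ℤ) : succVars k (xpow i n) = xpow i.succ n := by
  rw [xpow, succVars_single, xpow]
  congr 1
  funext j
  refine Fin.cases ?_ (fun j => ?_) j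
  · simp [(Fin.succ_ne_zero i).symm]
  · simp [Pi.single_apply]

theorem constTerm_succVars_mul (f : Laurent k) (n : ℤ) :
    constTerm (k + 1) (succVars k f * xpow 0 n) = if n = 0 then constTerm k f else 0 := by
  classical
  induction f using laurent_induction with
  | hs e c =>
    rw [succVars_single, xpow, AddMonoidAlgebra.single_mul_single, mul_one, constTerm_apply,
      constTerm_apply, AddMonoidAlgebra.coeff_single, AddMonoidAlgebra.coeff_single,
      Finsupp.single_apply, Finsupp.single_apply, ← ite_and]
    refine if_congr ⟨fun h => ⟨?_, ?_⟩, ?_⟩ rfl rfl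
    · simpa using congrFun h 0
    · funext i
      simpa [Pi.single_apply, Fin.succ_ne_zero] using congrFun h i.succ
    · rintro ⟨rfl, rfl⟩
      funext i
      refine Fin.cases ?_ (fun i => ?_) i <;> simp
  | ha f g hf hg =>
    rw [map_add, add_mul, map_add, hf, hg, map_add]
    split_ifs <;> simp

/-- Adjoining x_0 replaces p_n by p_n + x_0 ^ n, which is the shift with all constants 1 evaluated
at z = x_0. -/
theorem restrict_succ (g : SymFun) :
    restrict (k + 1) g = ((shift (fun _ => 1) g).map (restrict k : SymFun →+* Laurent k)).eval₂
      (succVars k : Laurent k →+* Laurent (k + 1)) (xpow 0 1) := by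
  induction g using MvPolynomial.induction_on with
  | C a =>
    rw [shift_C, Polynomial.map_C, Polynomial.eval₂_C]
    rw [MvPolynomial.algHom_C]
    simp only [AlgHom.coe_toRingHom, MvPolynomial.algHom_C]
    exact ((succVars k).commutes a).symm
  | add f g hf hg => rw [map_add, map_add, Polynomial.map_add, Polynomial.eval₂_add, hf, hg]
  | mul_X f n hf =>
    rw [map_mul, map_mul, Polynomial.map_mul, Polynomial.eval₂_mul, ← hf, restrict_X,
      Fin.sum_univ_succ]
    congr 1
    rw [shift, MvPolynomial.aeval_X, one_smul, Polynomial.map_add, Polynomial.map_C,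
      Polynomial.map_pow, Polynomial.map_X, Polynomial.eval₂_add, Polynomial.eval₂_C,
      Polynomial.eval₂_X_pow, xpow_pow, mul_one]
    rw [add_comm (xpow _ _)]
    refine congrArg (· + _) ?_
    simp [restrict_X, succVars_xpow]

theorem vand_succ :
    vand (k + 1) = (∏ i : Fin k, (xpow 0 1 - xpow i.succ 1)) * succVars k (vand k) := by
  have h : ∀ k, vand k = ∏ i : Fin k, ∏ j : Fin k, if i < j then xpow i 1 - xpow j 1 else 1 := by
    intro k
    rw [vand, pairs, Finset.prod_filter, Finset.univ_product_univ.symm, Finset.prod_product]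
  rw [h, h, Fin.prod_univ_succ]
  simp only [Fin.prod_univ_succ, lt_self_iff_false, if_false, Fin.succ_pos, if_true, one_mul,
    Fin.not_lt_zero, Fin.succ_lt_succ_iff, map_prod]
  congr 1
  refine Finset.prod_congr rfl fun i _ => Finset.prod_congr rfl fun j _ => ?_
  split_ifs
  · rw [map_sub, succVars_xpow, succVars_xpow]
  · rw [map_one]

/-- The polynomial `∏ (1 - x i z) ^ r`. -/
def linProd (k r : ℕ) : Polynomial (Laurent k) :=
  ∏ i : Fin k, (1 - Polynomial.C (xpow i 1) * Polynomial.X) ^ r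

/-- The logarithm of ∏ (1 - x_i z) ^ r is -r ∑ p_n z ^ n / n. For r = 2m this is the adjoint of the
annihilation exponential. -/
theorem coeff_linProd (r j : ℕ) :
    (linProd k r).coeff j = restrict k (expCoeff (fun n : ℕ+ => (-(r : ℂ) / ((n : ℕ) : ℂ)) •
      (MvPolynomial.X n : SymFun)) j) := by
  have h1 : (linProd k r : PowerSeries (Laurent k)) =
      expSeries fun n : ℕ+ => restrict k ((-(r : ℂ) / ((n : ℕ) : ℂ)) • (MvPolynomial.X n : SymFun)) := by
    have h2 : (fun n : ℕ+ => restrict k ((-(r : ℂ) / ((n : ℕ) : ℂ)) • (MvPolynomial.X n : SymFun))) =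
        ∑ i : Fin k, r • fun n : ℕ+ => -((((n : ℕ) : ℂ)⁻¹) • (xpow i 1 : Laurent k) ^ (n : ℕ)) := by
      funext n
      rw [map_smul, restrict_X, Finset.sum_apply, Finset.smul_sum]
      refine Finset.sum_congr rfl fun i _ => ?_
      rw [Pi.smul_apply, xpow_pow, mul_one, ← neg_smul, ← Nat.cast_smul_eq_nsmul ℂ, smul_smul]
      congr 1
      ring
    rw [h2, expSeries_sum]
    simp only [expSeries_nsmul, expSeries_neg_log]
    change Polynomial.coeToPowerSeries.ringHom (linProd k r) = _
    simp only [linProd, map_prod, map_pow, map_sub, map_one, map_mul,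
      Polynomial.coeToPowerSeries.ringHom_apply, Polynomial.coe_C, Polynomial.coe_X]
  rw [← Polynomial.coeff_coe, h1, expSeries, PowerSeries.coeff_mk, map_expCoeff]

theorem natDegree_linProd (r : ℕ) : (linProd k r).natDegree ≤ r * k := by
  refine (Polynomial.natDegree_prod_le _ _).trans ?_
  refine (Finset.sum_le_card_nsmul _ _ r fun i _ => ?_).trans (by simp [mul_comm])
  have h : (1 - Polynomial.C (xpow i 1) * Polynomial.X : Polynomial (Laurent k)).natDegree ≤ 1 := by
    refine (Polynomial.natDegree_sub_le _ _).trans ?_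
    simp only [Polynomial.natDegree_one, zero_le, sup_of_le_right]
    exact Polynomial.natDegree_C_mul_le _ _ |>.trans Polynomial.natDegree_X_le
  exact (Polynomial.natDegree_pow_le_of_le r h).trans (by simp)

theorem prod_sub_pow_eq (r : ℕ) :
    (∏ i : Fin k, (xpow 0 1 - xpow i.succ 1 : Laurent (k + 1))) ^ r =
      xpow 0 (r * k) * (linProd k r).eval₂ (succVars k : Laurent k →+* Laurent (k + 1))
        (xpow 0 (-1)) := by
  rw [linProd, Polynomial.eval₂_finsetProd]
  have h : (xpow 0 (r * k) : Laurent (k + 1)) = ∏ i : Fin k, xpow 0 1 ^ r := by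
    rw [Finset.prod_const, xpow_pow, xpow_pow]; simp [mul_comm]
  rw [h, ← Finset.prod_mul_distrib, ← Finset.prod_pow]
  refine Finset.prod_congr rfl fun i _ => ?_
  rw [Polynomial.eval₂_pow, ← mul_pow]
  congr 1
  simp only [Polynomial.eval₂_sub, Polynomial.eval₂_one, Polynomial.eval₂_mul, Polynomial.eval₂_C,
    Polynomial.eval₂_X]
  rw [mul_sub, mul_one, mul_left_comm, xpow_mul]
  simp [succVars_xpow, xpow_zero]

end AddVariable

/-! ### Words in the modes as constant terms, and the homogeneous components. -/

section Words

variable {m : ℕ}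

/-- The creation exponent becomes (m / n) p_n, and the Jack weight n / m cancels this factor, so its
adjoint shifts every p_n by exactly z ^ n. The truncation M is left free so that it can also exceed
the degree of the other polynomial involved. -/
theorem form_modeFock (hm : 0 < m) (r : ℤ) (f : Fock) (g : SymFun) : ∃ M₀ : ℕ, ∀ M ≥ M₀,
    form (fun s => (m : ℂ)⁻¹ * ((s : ℕ) : ℂ)) (toSymFun m (modeFock m r f)) g =
      ∑ j ∈ Finset.range M, if 0 ≤ r + j then
        form (fun s => (m : ℂ)⁻¹ * ((s : ℕ) : ℂ)) (toSymFun m f)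
          (expCoeff (fun n : ℕ+ => (-(2 * (m : ℂ)) / ((n : ℕ) : ℂ)) •
            (MvPolynomial.X n : SymFun)) j * (shift (fun _ => 1) g).coeff (r + j).toNat) else 0 := by
  obtain ⟨M₀, hM₀⟩ := (mode_support_finite m r f).bddAbove
  refine ⟨M₀ + 1, fun M hM => ?_⟩
  have hm' : (m : ℂ) ≠ 0 := by exact_mod_cast hm.ne'
  have h1 : modeFock m r f =
      ∑ j ∈ Finset.range M, creationCoeff m (r + j) (annihilationCoeff m j f) := by
    refine finsum_eq_sum_of_support_subset _ fun j hj => ?_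
    have := hM₀ hj
    simp only [Finset.coe_range, Set.mem_Iio]
    omega
  rw [h1, map_sum, map_sum, LinearMap.sum_apply]
  refine Finset.sum_congr rfl fun j _ => ?_
  split_ifs with h
  · obtain ⟨i, hi⟩ := Int.eq_ofNat_of_zero_le h
    have h2 : (fun n : ℕ+ => (m : ℂ)⁻¹ * ((n : ℕ) : ℂ) * ((m : ℂ) / ((n : ℕ) : ℂ))) =
        fun _ => 1 := by
      funext n
      have hn : ((n : ℕ) : ℂ) ≠ 0 := by exact_mod_cast n.ne_zero
      field_simp
    rw [hi, Int.toNat_natCast, toSymFun_creationCoeff, form_expCoeff_mul, h2,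
      form_annihilationCoeff m hm]
  · rw [creationCoeff, if_neg h]
    simp

/-- The polynomial part of `a_{n 0} ⋯ a_{n (k - 1)} v_p`. -/
def wordFock (m : ℕ) (p : ℤ) : (k : ℕ) → (Fin k → ℤ) → Fock
  | 0, _ => 1
  | k + 1, n => modeFock m (-(n 0) - 1 - (-p + 2 * m * k)) (wordFock m p k (Fin.tail n))

theorem single_cons_eq {k : ℕ} (e : Fin (k + 1) → ℤ) :
    (AddMonoidAlgebra.single e 1 : Laurent (k + 1)) =
      xpow 0 (e 0) * succVars k (AddMonoidAlgebra.single (Fin.tail e) 1) := by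
  rw [succVars_single, xpow, AddMonoidAlgebra.single_mul_single, mul_one]
  congr 1
  funext i
  refine Fin.cases ?_ (fun i => ?_) i
  · simp
  · simp [Fin.tail]

theorem sum_ite_toNat {D : ℕ} (r : ℤ) (F : ℕ → ℂ) (hF : ∀ i, D ≤ i → F i = 0) :
    ∑ i ∈ Finset.range D, (if (i : ℤ) = r then F i else 0) = if 0 ≤ r then F r.toNat else 0 := by
  split_ifs with h
  · obtain ⟨i, rfl⟩ := Int.eq_ofNat_of_zero_le h
    simp only [Nat.cast_inj, Int.toNat_natCast]
    rw [Finset.sum_ite_eq']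
    split_ifs with h'
    · rfl
    · exact (hF i (by simpa using h')).symm
  · exact Finset.sum_eq_zero fun i _ => if_neg (by omega)

/-- Taking the constant term in x_0 first matches the power i from G with the power -j from Q when i
= -a - b + j. -/
theorem constTerm_succ {k : ℕ} (G Q : Polynomial (Laurent k)) (Z : Laurent k) (a b : ℤ) {M : ℕ}
    (hM : Q.natDegree < M) :
    constTerm (k + 1) (G.eval₂ (succVars k : Laurent k →+* Laurent (k + 1)) (xpow 0 1) *
      (xpow 0 a * (xpow 0 b * Q.eval₂ (succVars k : Laurent k →+* Laurent (k + 1)) (xpow 0 (-1)))) *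
        succVars k Z) =
      ∑ j ∈ Finset.range M, if 0 ≤ -a - b + j then
        constTerm k (Q.coeff j * G.coeff (-a - b + j).toNat * Z) else 0 := by
  rw [Polynomial.eval₂_eq_sum_range, Polynomial.eval₂_eq_sum_range' _ hM]
  set D := G.natDegree + 1 with hD
  have h1 : (∑ i ∈ Finset.range D, (succVars k : Laurent k →+* Laurent (k + 1)) (G.coeff i) *
        xpow 0 1 ^ i) * (xpow 0 a * (xpow 0 b * ∑ j ∈ Finset.range M,
          (succVars k : Laurent k →+* Laurent (k + 1)) (Q.coeff j) * xpow 0 (-1) ^ j)) *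
        succVars k Z =
      ∑ j ∈ Finset.range M, ∑ i ∈ Finset.range D,
        succVars k (Q.coeff j * G.coeff i * Z) * xpow 0 (i - (-a - b + j)) := by
    rw [Finset.mul_sum, Finset.mul_sum, Finset.sum_mul_sum, Finset.sum_mul]
    simp only [Finset.sum_mul]
    rw [Finset.sum_comm]
    refine Finset.sum_congr rfl fun j _ => Finset.sum_congr rfl fun i _ => ?_
    rw [xpow_pow, xpow_pow, map_mul (succVars k), map_mul (succVars k),
      show (i : ℤ) - (-a - b + j) = (i * 1 + a) + (b + j * (-1)) by ring, ← xpow_mul, ← xpow_mul,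
      ← xpow_mul]
    simp only [AlgHom.coe_toRingHom]
    ring
  rw [h1, map_sum]
  refine Finset.sum_congr rfl fun j _ => ?_
  rw [map_sum]
  simp only [constTerm_succVars_mul, sub_eq_zero]
  refine sum_ite_toNat _ (fun i => constTerm k (Q.coeff j * G.coeff i * Z)) fun i hi => ?_
  rw [Polynomial.coeff_eq_zero_of_natDegree_lt (p := G) (by omega)]
  simp

/-- Taking the adjoint of the leftmost mode adds the variable x_0 and multiplies by ∏ (1 - x_i /
x_0) ^ (2m). The power z ^ (√(2m) h₀) supplies x_0 ^ (2mk - p), where 2mk completes the product to ∏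
(x_0 - x_i) ^ (2m), the missing part of the Vandermonde power. -/
theorem form_wordFock (hm : 0 < m) (p : ℤ) (k : ℕ) (n : Fin k → ℤ) (g : SymFun) :
    form (fun s => (m : ℂ)⁻¹ * ((s : ℕ) : ℂ)) (toSymFun m (wordFock m p k n)) g =
      constTerm k (restrict k g * AddMonoidAlgebra.single (fun i => n i + 1 - p) 1 *
        vand k ^ (2 * m)) := by
  induction k generalizing g with
  | zero =>
    have h1 : vand 0 = 1 := by
      rw [vand]
      exact Finset.prod_eq_one fun x => x.1.elim0
    have h2 : (AddMonoidAlgebra.single (fun i : Fin 0 => n i + 1 - p) 1 : Laurent 0) = 1 := by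
      rw [AddMonoidAlgebra.one_def]
      exact congrArg (AddMonoidAlgebra.single · 1) (Subsingleton.elim _ _)
    rw [wordFock, map_one, form_one, h1, h2, one_pow, mul_one, mul_one]
    induction g using MvPolynomial.induction_on with
    | C a =>
      rw [MvPolynomial.coeff_C, if_pos rfl, MvPolynomial.algHom_C, constTerm_apply]
      simp
    | add f g hf hg => rw [MvPolynomial.coeff_add, hf, hg, map_add, map_add]
    | mul_X f i _ =>
      rw [map_mul, restrict_X, MvPolynomial.coeff_mul_X']
      simp
  | succ k ih =>
    obtain ⟨M₀, hM₀⟩ := form_modeFock hm (-(n 0) - 1 - (-p + 2 * m * k))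
      (wordFock m p k (Fin.tail n)) g
    rw [wordFock, hM₀ (max M₀ (2 * m * k + 1)) (le_max_left _ _), restrict_succ, single_cons_eq,
      vand_succ, mul_pow, prod_sub_pow_eq]
    have h := constTerm_succ ((shift (fun _ => 1) g).map (restrict k : SymFun →+* Laurent k))
      (linProd k (2 * m)) (AddMonoidAlgebra.single (Fin.tail fun i => n i + 1 - p) 1 *
        vand k ^ (2 * m)) (n 0 + 1 - p) ((2 * m : ℕ) * k) (M := max M₀ (2 * m * k + 1))
      (lt_of_le_of_lt (natDegree_linProd _) (lt_of_lt_of_le (Nat.lt_succ_self _) (le_max_right _ _)))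
    rw [map_mul (succVars k), map_pow (succVars k)] at h
    have h' : ∀ A B C D E : Laurent (k + 1), A * (B * C) * (D * E) = A * (B * D) * (C * E) := by
      intros; ring
    rw [h', h]
    refine Finset.sum_congr rfl fun j _ => ?_
    rw [show -(n 0) - 1 - (-p + 2 * m * k) + (j : ℤ) =
      -(n 0 + 1 - p) - ((2 * m : ℕ) * k : ℤ) + j by push_cast; ring]
    refine if_congr Iff.rfl ?_ rfl
    rw [ih, map_mul (restrict k), coeff_linProd, Polynomial.coeff_map, ← mul_assoc]
    push_cast
    rfl

/-- The span of the vectors `a_{n 0} ⋯ a_{n (k - 1)} v_p` with `0 ≤ n i < p`. -/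
theorem finitization_eq_span (m : ℕ) (p : ℤ) : finitization m p =
    Submodule.span ℂ {x | ∃ (k : ℕ) (n : Fin k → ℤ), (∀ i, 0 ≤ n i ∧ n i < p) ∧
      x = Finsupp.single (-p + 2 * m * k) (wordFock m p k n)} := by
  have ha : ∀ (k : ℕ) (n : Fin (k + 1) → ℤ), a m (n 0)
      (Finsupp.single (-p + 2 * m * k) (wordFock m p k (Fin.tail n))) =
      Finsupp.single (-p + 2 * m * ((k + 1 : ℕ) : ℤ)) (wordFock m p (k + 1) n) := by
    intro k n
    rw [a, Finsupp.lsum_single, LinearMap.comp_apply, Finsupp.lsingle_apply, wordFock]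
    congr 1
    push_cast
    ring
  set W : Set FockSum := {x | ∃ (k : ℕ) (n : Fin k → ℤ), (∀ i, 0 ≤ n i ∧ n i < p) ∧
      x = Finsupp.single (-p + 2 * m * k) (wordFock m p k n)}
  apply le_antisymm
  · rintro _ ⟨T, hT, rfl⟩
    have hext : extremal p ∈ Submodule.span ℂ W :=
      Submodule.subset_span ⟨0, Fin.elim0, fun i => i.elim0, by simp [extremal, wordFock]⟩
    change T (extremal p) ∈ _
    generalize extremal p = v at hext
    induction hT using Algebra.adjoin_induction generalizing v with
    | mem T hT =>
      obtain ⟨j, hj, rfl⟩ := hT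
      refine (Submodule.span_le (p := Submodule.comap (a m j) (Submodule.span ℂ W))).mpr ?_ hext
      rintro _ ⟨k, n, hn, rfl⟩
      refine Submodule.subset_span ⟨k + 1, Fin.cons j n, fun i => ?_, ?_⟩
      · refine Fin.cases ?_ (fun i => ?_) i
        · exact hj
        · simpa using hn i
      · have := ha k (Fin.cons j n)
        rwa [Fin.cons_zero, Fin.tail_cons] at this
    | algebraMap c => exact Submodule.smul_mem _ _ hext
    | add S T _ _ hS hT => exact Submodule.add_mem _ (hS v hext) (hT v hext)
    | mul S T _ _ hS hT => exact hS _ (hT v hext)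
  · refine Submodule.span_le.mpr ?_
    rintro _ ⟨k, n, hn, rfl⟩
    induction k with
    | zero =>
      exact ⟨1, Subalgebra.one_mem _, by simp [extremal, wordFock]⟩
    | succ k ih =>
      obtain ⟨T, hT, h⟩ := ih (Fin.tail n) fun i => hn i.succ
      refine ⟨a m (n 0) * T, Subalgebra.mul_mem _ (Algebra.subset_adjoin ⟨n 0, hn 0, rfl⟩) hT, ?_⟩
      rw [← ha, ← h]
      rfl

/-- For m > 0 the values -p + 2mk are distinct for distinct k, so the eigenspace of h₀ selects the
words of length k. -/
theorem component_eq_map (hm : 0 < m) (p : ℤ) (k : ℕ) :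
    component m p (-(p : ℝ) / √(2 * (m : ℝ)) + (k : ℝ) * √(2 * (m : ℝ))) =
      (Submodule.span ℂ {u | ∃ n : Fin k → ℤ, (∀ i, 0 ≤ n i ∧ n i < p) ∧
        u = wordFock m p k n}).map (Finsupp.lsingle (-p + 2 * m * k) : Fock →ₗ[ℂ] FockSum) := by
  have hs : (0 : ℝ) < √(2 * (m : ℝ)) := Real.sqrt_pos.mpr (by positivity)
  have hs2 : √(2 * (m : ℝ)) * √(2 * (m : ℝ)) = 2 * m := Real.mul_self_sqrt (by positivity)
  have hval : -(p : ℝ) / √(2 * (m : ℝ)) + (k : ℝ) * √(2 * (m : ℝ)) =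
      ((-p + 2 * m * k : ℤ) : ℝ) / √(2 * (m : ℝ)) := by
    rw [eq_div_iff hs.ne', add_mul, div_mul_cancel₀ _ hs.ne', mul_assoc, hs2]
    push_cast
    ring
  have hh0 : ∀ (x : FockSum) (c : ℤ), h0 m x c = (((c : ℝ) / √(2 * (m : ℝ)) : ℝ) : ℂ) • x c := by
    intro x c
    induction x using Finsupp.induction_linear with
    | zero => simp
    | add x y hx hy => rw [map_add, Finsupp.add_apply, hx, hy, Finsupp.add_apply, smul_add]
    | single d u =>
      rw [h0, Finsupp.lsum_single, LinearMap.smul_apply, Finsupp.smul_apply, Finsupp.lsingle_apply]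
      by_cases h : d = c
      · rw [h]
      · rw [Finsupp.single_eq_of_ne (Ne.symm h), smul_zero, smul_zero]
  rw [hval, component]
  set c₀ : ℤ := -p + 2 * m * k with hc₀
  apply le_antisymm
  · rintro x ⟨hx, hx'⟩
    rw [SetLike.mem_coe, Module.End.mem_eigenspace_iff] at hx'
    rw [SetLike.mem_coe, finitization_eq_span] at hx
    have h1 : x = Finsupp.single c₀ (x c₀) := by
      ext1 c
      by_cases h : c = c₀
      · rw [h, Finsupp.single_eq_same]
      · rw [Finsupp.single_eq_of_ne h]
        have h2 := DFunLike.congr_fun hx' c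
        rw [hh0, Finsupp.smul_apply, ← sub_eq_zero, ← sub_smul] at h2
        refine (smul_eq_zero.mp h2).resolve_left fun h3 => h ?_
        rw [sub_eq_zero, Complex.ofReal_inj, div_left_inj' hs.ne', Int.cast_inj] at h3
        exact h3
    rw [h1]
    refine Submodule.mem_map_of_mem (f := (Finsupp.lsingle c₀ : Fock →ₗ[ℂ] FockSum)) ?_
    refine (Submodule.span_le (p := Submodule.comap (Finsupp.lapply c₀ : FockSum →ₗ[ℂ] Fock)
      (Submodule.span ℂ {u | ∃ n : Fin k → ℤ, (∀ i, 0 ≤ n i ∧ n i < p) ∧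
        u = wordFock m p k n}))).mpr ?_ hx
    rintro _ ⟨k', n, hn, rfl⟩
    rw [SetLike.mem_coe, Submodule.mem_comap, Finsupp.lapply_apply]
    by_cases h : k' = k
    · subst h
      rw [Finsupp.single_eq_same]
      exact Submodule.subset_span ⟨n, hn, rfl⟩
    · rw [Finsupp.single_eq_of_ne]
      · exact Submodule.zero_mem _
      · intro h'
        rw [hc₀, add_right_inj, mul_right_inj' (by positivity)] at h'
        exact h (by exact_mod_cast h'.symm)
  · rw [Submodule.map_span, Submodule.span_le]
    rintro _ ⟨_, ⟨n, hn, rfl⟩, rfl⟩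
    refine ⟨?_, ?_⟩
    · rw [SetLike.mem_coe, finitization_eq_span]
      exact Submodule.subset_span ⟨k, n, hn, rfl⟩
    · rw [SetLike.mem_coe, Module.End.mem_eigenspace_iff]
      rw [Finsupp.lsingle_apply, h0, Finsupp.lsum_single]
      rfl

end Words

/-! ### Symmetry in the variables, and the comparison of the Vandermonde power with the torus
weight. -/

section Permutations

variable {k : ℕ}

theorem exists_perm_of_map_eq {ι α : Type*} [Fintype ι] {f g : ι → α}
    (h : (Finset.univ : Finset ι).val.map f = (Finset.univ : Finset ι).val.map g) :
    ∃ σ : Equiv.Perm ι, f = g ∘ σ := by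
  classical
  have hc : ∀ y, Fintype.card {x // f x = y} = Fintype.card {x // g x = y} := by
    intro y
    have h1 := congrArg (Multiset.count y) h
    rw [Multiset.count_map, Multiset.count_map] at h1
    rw [Fintype.card_subtype, Fintype.card_subtype, Finset.card_def, Finset.card_def,
      Finset.filter_val, Finset.filter_val]
    simpa [eq_comm] using h1
  refine ⟨(Equiv.sigmaFiberEquiv f).symm.trans ((Equiv.sigmaCongrRight fun y =>
    Fintype.equivOfCardEq (hc y)).trans (Equiv.sigmaFiberEquiv g)), ?_⟩
  funext i
  exact (Fintype.equivOfCardEq (hc (f i)) ⟨i, rfl⟩).2.symm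

theorem exists_perm_of_shapeZ_eq {e e' : Fin k → ℤ} (he : ∀ i, 0 ≤ e i) (he' : ∀ i, 0 ≤ e' i)
    (h : shapeZ e = shapeZ e') : ∃ σ : Equiv.Perm (Fin k), e = e' ∘ σ := by
  -- The shape forgets zeros, but their number is recovered from k.
  have key : ∀ e : Fin k → ℤ, (Finset.univ : Finset (Fin k)).val.map (fun i => (e i).toNat) =
      shapeZ e + Multiset.replicate (k - (shapeZ e).card) 0 := by
    intro e
    set A := (Finset.univ : Finset (Fin k)).val.map (fun i => (e i).toNat) with hA
    have hcard : A.card = k := by simp [hA]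
    have h1 : shapeZ e + A.filter (fun a => ¬ 0 < a) = A := Multiset.filter_add_not _ _
    have h2 : A.filter (fun a => ¬ 0 < a) = Multiset.replicate (k - (shapeZ e).card) 0 := by
      rw [Multiset.eq_replicate]
      refine ⟨?_, fun b hb => ?_⟩
      · have h3 := congrArg Multiset.card h1
        rw [Multiset.card_add, hcard] at h3
        omega
      · have := (Multiset.mem_filter.mp hb).2
        omega
    rw [← h2, h1]
  obtain ⟨σ, hσ⟩ := exists_perm_of_map_eq (f := fun i => (e i).toNat) (g := fun i => (e' i).toNat)
    (by rw [key, key, h])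
  refine ⟨σ, funext fun i => ?_⟩
  have := congrFun hσ i
  simp only [Function.comp_apply] at this ⊢
  have := he i
  have := he' (σ i)
  omega

/-- The permutation of the variables. -/
def permVars (σ : Equiv.Perm (Fin k)) : Laurent k →ₐ[ℂ] Laurent k :=
  AddMonoidAlgebra.lift ℂ (Laurent k) (Fin k → ℤ)
    { toFun := fun e => AddMonoidAlgebra.single (e.toAdd ∘ σ) 1
      map_one' := rfl
      map_mul' := fun e f => by rw [AddMonoidAlgebra.single_mul_single, mul_one]; rfl }

theorem permVars_single (σ : Equiv.Perm (Fin k)) (e : Fin k → ℤ) (c : ℂ) :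
    permVars σ (AddMonoidAlgebra.single e c) = AddMonoidAlgebra.single (e ∘ σ) c := by
  rw [permVars, AddMonoidAlgebra.lift_single]
  simp

theorem coeff_permVars (σ : Equiv.Perm (Fin k)) (f : Laurent k) (e : Fin k → ℤ) :
    (permVars σ f).coeff (e ∘ σ) = f.coeff e := by
  classical
  induction f using laurent_induction with
  | hs d c =>
    rw [permVars_single, AddMonoidAlgebra.coeff_single, AddMonoidAlgebra.coeff_single,
      Finsupp.single_apply, Finsupp.single_apply]
    exact if_congr σ.surjective.injective_comp_right.eq_iff rfl rfl
  | ha f g hf hg => simp [hf, hg]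

theorem permVars_xpow (σ : Equiv.Perm (Fin k)) (i : Fin k) (n : ℤ) :
    permVars σ (xpow i n) = xpow (σ.symm i) n := by
  rw [xpow, permVars_single, xpow]
  congr 1
  funext j
  simp only [Function.comp_apply, Pi.single_apply]
  exact if_congr (by rw [Equiv.eq_symm_apply]) rfl rfl

theorem permVars_restrict (σ : Equiv.Perm (Fin k)) (f : SymFun) :
    permVars σ (restrict k f) = restrict k f := by
  have h : (permVars σ).comp (restrict k) = restrict k := by
    apply MvPolynomial.algHom_ext
    intro n
    rw [AlgHom.comp_apply, restrict_X, map_sum]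
    simp only [permVars_xpow]
    exact Equiv.sum_comp σ.symm fun i => (xpow i (n : ℕ) : Laurent k)
  exact DFunLike.congr_fun h f

theorem permVars_fullPow (σ : Equiv.Perm (Fin k)) (c : ℤ) :
    permVars σ (fullPow k c) = fullPow k c := by
  rw [fullPow, permVars_single]
  rfl

theorem prod_pairs_mul_swap {R : Type*} [CommMonoid R] (F : Fin k → Fin k → R) :
    ∏ p ∈ pairs k, F p.1 p.2 * F p.2 p.1 = ∏ i, ∏ j, if i = j then 1 else F i j := by
  have h1 : ∏ p ∈ pairs k, F p.1 p.2 * F p.2 p.1 =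
      ∏ i, ∏ j, if i < j then F i j * F j i else 1 := by
    rw [pairs, Finset.prod_filter, Finset.univ_product_univ.symm, Finset.prod_product]
  have h2 : ∀ i j : Fin k, (if i < j then F i j * F j i else 1) =
      (if i < j then F i j else 1) * if i < j then F j i else 1 := by
    intro i j; split_ifs <;> simp
  have h3 : ∏ i : Fin k, ∏ j : Fin k, (if i < j then F j i else 1) =
      ∏ i : Fin k, ∏ j : Fin k, if j < i then F i j else 1 := Finset.prod_comm
  rw [h1]
  simp only [h2, Finset.prod_mul_distrib]
  rw [h3]
  simp only [← Finset.prod_mul_distrib]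
  refine Finset.prod_congr rfl fun i _ => Finset.prod_congr rfl fun j _ => ?_
  rcases lt_trichotomy i j with h | h | h
  · rw [if_pos h, if_neg h.not_gt, if_neg h.ne, mul_one]
  · subst h; simp
  · rw [if_pos h, if_neg h.not_gt, if_neg h.ne', one_mul]

theorem permVars_torusWeight (σ : Equiv.Perm (Fin k)) (m : ℕ) (q : ℂ) :
    permVars σ (torusWeight k m q) = torusWeight k m q := by
  have hq : ∀ a b, permVars σ (qFactor m q 0 a b) = qFactor m q 0 (σ.symm a) (σ.symm b) := by
    intro a b
    simp only [qFactor, map_prod, map_sub, map_one, map_smul, ratio, map_mul, permVars_xpow]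
  rw [torusWeight, prod_pairs_mul_swap (qFactor m q 0)]
  simp only [map_prod, apply_ite (permVars σ), map_one, hq]
  refine Eq.trans (Finset.prod_congr rfl fun i _ => ?_) (Equiv.prod_comp σ.symm fun i =>
    ∏ j, if i = j then (1 : Laurent k) else qFactor m q 0 i j)
  refine Eq.trans ?_ (Equiv.prod_comp σ.symm _)
  simp only [σ.symm.injective.eq_iff]

theorem constTerm_mul_inversion (f g : Laurent k) :
    constTerm k (f * inversion k g) = g.coeff.sum fun e c => f.coeff e * c := by
  classical
  induction g using laurent_induction with
  | hs d c =>
    rw [inversion_single, constTerm_apply, AddMonoidAlgebra.coeff_mul_single_apply,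
      AddMonoidAlgebra.coeff_single, Finsupp.sum_single_index (mul_zero _)]
    simp
  | ha g h hg hh =>
    rw [map_add, mul_add, map_add, hg, hh, AddMonoidAlgebra.coeff_add,
      Finsupp.sum_add_index' (by simp) (by intros; ring)]

/-- The torus scalar product with a monomial symmetric function determines the corresponding
coefficients. -/
theorem coeff_eq_zero_of_torusForm_mono {m : ℕ} {q : ℂ} {c : ℤ} {f : SymFun} {ν : Fin k → ℤ}
    (hν : ∀ i, 0 ≤ ν i) {κ : YoungDiagram} (hκ : shapeZ ν = (κ.rowLens : Multiset ℕ))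
    (h : torusForm k m q (fullPow k c * restrict k f) (restrict k (mono κ)) = 0) :
    (fullPow k c * restrict k f * torusWeight k m q).coeff ν = 0 := by
  classical
  rw [torusForm_eq, constTerm_mul_inversion] at h
  set H := fullPow k c * restrict k f * torusWeight k m q with hH
  -- The support is one orbit of permutations of ν and H is symmetric, so the pairing is the
  -- coefficient at ν times the size of the orbit.
  have h1 : ∀ e ∈ (restrict k (mono κ)).coeff.support,
      H.coeff e * (restrict k (mono κ)).coeff e = H.coeff ν := by
    intro e he
    rw [Finsupp.mem_support_iff] at he
    have he0 : ∀ i, 0 ≤ e i := by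
      by_contra hneg
      exact he (coeff_restrict_of_neg hneg)
    obtain ⟨μ, hμ⟩ := exists_shapeZ_eq e
    rw [coeff_restrict he0 hμ, symCoeff_mono] at he ⊢
    have hμκ : μ = κ := by
      by_contra hne
      exact he (if_neg hne)
    rw [if_pos hμκ, mul_one]
    obtain ⟨σ, hσ⟩ := exists_perm_of_shapeZ_eq he0 hν (by rw [hμ, hκ, hμκ])
    have h2 : permVars σ H = H := by
      rw [hH, map_mul, map_mul, permVars_fullPow, permVars_restrict, permVars_torusWeight]
    rw [hσ, ← h2, coeff_permVars, h2]
  rw [Finsupp.sum, Finset.sum_congr rfl h1, Finset.sum_const, nsmul_eq_mul, mul_eq_zero] at h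
  refine h.resolve_left ?_
  rw [Nat.cast_eq_zero, ← ne_eq, Finset.card_ne_zero]
  refine ⟨ν, ?_⟩
  rw [Finsupp.mem_support_iff, coeff_restrict hν hκ, symCoeff_mono, if_pos rfl]
  exact one_ne_zero

theorem fullPow_eq_prod (c : ℤ) : fullPow k c = ∏ i, xpow i c := by
  have h : ∀ s : Finset (Fin k), ∏ i ∈ s, (xpow i c : Laurent k) =
      AddMonoidAlgebra.single (∑ i ∈ s, Pi.single i c) 1 := by
    classical
    intro s
    induction s using Finset.induction_on with
    | empty => simp [AddMonoidAlgebra.one_def]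
    | insert i s hi ih =>
      rw [Finset.prod_insert hi, Finset.sum_insert hi, ih, xpow,
        AddMonoidAlgebra.single_mul_single, mul_one]
  rw [h, fullPow]
  congr 1
  exact (Finset.univ_sum_single fun _ : Fin k => c).symm

theorem qFactor_one (m : ℕ) (a b : Fin k) : qFactor m 1 0 a b = (1 - ratio a b) ^ m := by
  simp [qFactor]

theorem sub_sq_eq {a b : Fin k} : (xpow a 1 - xpow b 1 : Laurent k) ^ 2 =
    -((xpow a 1 * xpow b 1) * ((1 - ratio a b) * (1 - ratio b a))) := by
  have h1 := ratio_mul a b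
  have h2 := ratio_mul b a
  have h3 : (xpow a 1 * xpow b 1 : Laurent k) * ((1 - ratio a b) * (1 - ratio b a)) =
      (xpow b 1 - ratio a b * xpow b 1) * (xpow a 1 - ratio b a * xpow a 1) := by ring
  rw [h3, h1, h2]
  ring

/-- For each pair (x_a - x_b) ^ 2 = -x_a x_b (1 - x_a/x_b)(1 - x_b/x_a), and each variable occurs in
k - 1 pairs. -/
theorem vand_pow_eq (k m : ℕ) : ∃ ε : ℂ, ε ≠ 0 ∧
    vand k ^ (2 * m) = ε • (fullPow k (((k : ℤ) - 1) * m) * torusWeight k m 1) := by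
  refine ⟨(-1) ^ (m * (pairs k).card), pow_ne_zero _ (by norm_num), ?_⟩
  have h1 : ∏ p ∈ pairs k, (xpow p.1 m * xpow p.2 m : Laurent k) =
      fullPow k (((k : ℤ) - 1) * m) := by
    rw [prod_pairs_mul_swap (fun i _ => (xpow i m : Laurent k)), fullPow_eq_prod]
    refine Finset.prod_congr rfl fun i _ => ?_
    have h2 : ∀ j, (if i = j then (1 : Laurent k) else xpow i m) =
        if j ∈ Finset.univ.erase i then xpow i m else 1 := by
      intro j
      by_cases h : i = j
      · simp [h]
      · rw [if_neg h, if_pos (by simpa using Ne.symm h)]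
    simp only [h2]
    rw [Finset.prod_ite_mem, Finset.univ_inter, Finset.prod_const,
      Finset.card_erase_of_mem (Finset.mem_univ i), Finset.card_univ, Fintype.card_fin, xpow_pow]
    congr 1
    have := i.isLt
    push_cast [Nat.cast_sub (show 1 ≤ k by omega)]
    ring
  rw [vand, pow_mul, ← Finset.prod_pow, ← Finset.prod_pow, ← h1, torusWeight,
    ← Finset.prod_mul_distrib, Algebra.smul_def, pow_mul, map_pow, ← Finset.prod_const,
    ← Finset.prod_mul_distrib]
  refine Finset.prod_congr rfl fun p _ => ?_
  have h3 : ∀ i : Fin k, (xpow i m : Laurent k) = xpow i 1 ^ m := by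
    intro i; rw [xpow_pow, mul_one]
  rw [sub_sq_eq, qFactor_one, qFactor_one, h3, h3, map_pow, map_neg, map_one, neg_pow, mul_pow, mul_pow,
    mul_pow]

end Permutations

/-! ### Positivity of the torus scalar product at q = 1. -/

section Positivity

variable {k : ℕ}

/-- Complex conjugation of the coefficients of a Laurent polynomial. -/
def conjLaurent (k : ℕ) : Laurent k →+* Laurent k :=
  AddMonoidAlgebra.mapRingHom (Fin k → ℤ) (starRingEnd ℂ)

theorem coeff_conjLaurent (f : Laurent k) (e : Fin k → ℤ) :
    (conjLaurent k f).coeff e = starRingEnd ℂ (f.coeff e) :=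
  AddMonoidAlgebra.coeff_mapRingHom _ _ _

theorem conjLaurent_xpow (i : Fin k) (n : ℤ) : conjLaurent k (xpow i n) = xpow i n := by
  rw [conjLaurent, xpow, AddMonoidAlgebra.mapRingHom_single, map_one]

theorem eq_zero_of_constTerm_conj {f : Laurent k}
    (h : constTerm k (f * inversion k (conjLaurent k f)) = 0) : f = 0 := by
  rw [← constTerm_inversion, map_mul (inversion k), inversion_inversion, mul_comm,
    constTerm_mul_inversion, Finsupp.sum] at h
  simp only [coeff_conjLaurent, mul_comm (starRingEnd ℂ _), Complex.mul_conj] at h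
  rw [← Complex.ofReal_sum, Complex.ofReal_eq_zero,
    Finset.sum_eq_zero_iff_of_nonneg fun e _ => Complex.normSq_nonneg _] at h
  ext e
  by_contra he
  exact he (Complex.normSq_eq_zero.mp (h e (Finsupp.mem_support_iff.mpr he)))

/-- The torus scalar product with coupling `m` is nondegenerate. -/
theorem eq_zero_of_coeff_mul_torusWeight {m : ℕ} {f : Laurent k}
    (h : ∀ e, f.coeff e ≠ 0 → (f * torusWeight k m 1).coeff e = 0) : f = 0 := by
  set A : Laurent k := ∏ p ∈ pairs k, (1 - ratio p.1 p.2) ^ m with hA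
  have hinv : inversion k A = ∏ p ∈ pairs k, (1 - ratio p.2 p.1) ^ m := by
    simp only [hA, map_prod, map_pow, map_sub, map_one, inversion_ratio]
  have hconj : conjLaurent k A = A := by
    simp only [hA, map_prod, map_pow, map_sub, map_one, ratio, map_mul, conjLaurent_xpow]
  have hw : torusWeight k m 1 = A * inversion k A := by
    rw [hinv, torusWeight, hA, ← Finset.prod_mul_distrib]
    simp only [qFactor_one]
  have hA0 : A ≠ 0 := by
    intro h0
    obtain ⟨ε, -, h1⟩ := vand_pow_eq k m
    rw [hw, h0, zero_mul, mul_zero, smul_zero] at h1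
    exact pow_ne_zero _ vand_ne_zero h1
  -- The weight is A times its inversion, with A real. So the pairing of f with its conjugate is the
  -- sum of the squared absolute values of the coefficients of f A, and the hypothesis makes it
  -- vanish.
  have h2 : f * A = 0 := by
    apply eq_zero_of_constTerm_conj
    rw [map_mul (conjLaurent k), hconj, map_mul (inversion k),
      show f * A * (inversion k (conjLaurent k f) * inversion k A) =
        f * (A * inversion k A) * inversion k (conjLaurent k f) by ring, ← hw,
      constTerm_mul_inversion]
    refine Finset.sum_eq_zero fun e he => ?_
    dsimp only
    rw [Finsupp.mem_support_iff, coeff_conjLaurent] at he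
    rw [h e fun h0 => he (by rw [h0, map_zero]), zero_mul]
  exact (mul_eq_zero.mp h2).resolve_right hA0

end Positivity

/-! ### Jack polynomials as an orthogonal basis of Λ. -/

section JackBasis

variable {m : ℕ}

theorem form_jack_of_ne (hm : 0 < m) {lam μ : YoungDiagram} (h : lam ≠ μ) :
    form (fun s => (m : ℂ)⁻¹ * ((s : ℕ) : ℂ)) (jack hm lam) (jack hm μ) = 0 := by
  rw [← jackForm_eq_form]
  exact (isJackFamily_jack hm).orthogonal lam μ h

theorem symCoeff_jack_self (hm : 0 < m) (lam : YoungDiagram) : symCoeff lam (jack hm lam) = 1 := by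
  classical
  have h := symCoeff_eq_zero_of_mem_span (mono_sub_jack_mem hm lam)
    (μ := lam) fun h => (mem_below.mp h).2 rfl
  rw [map_sub, symCoeff_mono, if_pos rfl, sub_eq_zero] at h
  exact h.symm

theorem dominatedBy_of_symCoeff_jack (hm : 0 < m) {lam μ : YoungDiagram}
    (h : symCoeff μ (jack hm lam) ≠ 0) : DominatedBy μ lam := by
  classical
  by_contra hμ
  have h1 := symCoeff_eq_zero_of_mem_span (mono_sub_jack_mem hm lam)
    (μ := μ) fun h => hμ (mem_below.mp h).1
  rw [map_sub, symCoeff_mono, if_neg (by rintro rfl; exact hμ (DominatedBy.refl _)), zero_sub,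
    neg_eq_zero] at h1
  exact h h1

/-- The form is bilinear rather than hermitian, so positivity does not apply directly. If the value
were zero, J_lam would be orthogonal to every m_μ with μ ≤ lam, whose span contains it, and
`eq_zero_of_form_mono` would make it vanish. -/
theorem form_jack_self_ne_zero (hm : 0 < m) (lam : YoungDiagram) :
    form (fun s => (m : ℂ)⁻¹ * ((s : ℕ) : ℂ)) (jack hm lam) (jack hm lam) ≠ 0 := by
  classical
  intro h0
  have h1 : ∀ μ ∈ below lam,
      form (fun s => (m : ℂ)⁻¹ * ((s : ℕ) : ℂ)) (jack hm lam) (mono μ) = 0 := fun μ hμ =>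
    form_jack_mono hm fun h => (mem_below.mp hμ).2 ((mem_below.mp hμ).1.antisymm h)
  have h2 : form (fun s => (m : ℂ)⁻¹ * ((s : ℕ) : ℂ)) (jack hm lam) (mono lam) = 0 := by
    rw [← sub_add_cancel (mono lam) (jack hm lam), map_add, h0, add_zero,
      eq_sum_of_mem_span (mono_sub_jack_mem hm lam), map_sum]
    refine Finset.sum_eq_zero fun μ hμ => ?_
    rw [map_smul, h1 μ hμ, smul_zero]
  have h3 : jack hm lam = 0 := by
    refine eq_zero_of_form_mono hm (S := insert lam (below lam)) (mem_span_mono fun μ hμ => ?_)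
      fun μ hμ => ?_
    · rw [Finset.mem_coe, Finset.mem_insert, mem_below]
      have := dominatedBy_of_symCoeff_jack hm hμ
      tauto
    · rcases Finset.mem_insert.mp hμ with rfl | hμ
      · exact h2
      · exact h1 μ hμ
  have h4 := symCoeff_jack_self hm lam
  rw [h3, map_zero] at h4
  exact zero_ne_one h4

theorem form_sum_jack (hm : 0 < m) (S : Finset YoungDiagram) (c : YoungDiagram → ℂ)
    (μ : YoungDiagram) [Decidable (μ ∈ S)] :
    form (fun s => (m : ℂ)⁻¹ * ((s : ℕ) : ℂ)) (∑ lam ∈ S, c lam • jack hm lam) (jack hm μ) =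
      if μ ∈ S then
        c μ * form (fun s => (m : ℂ)⁻¹ * ((s : ℕ) : ℂ)) (jack hm μ) (jack hm μ) else 0 := by
  rw [map_sum, LinearMap.sum_apply]
  simp only [map_smul, LinearMap.smul_apply, smul_eq_mul]
  split_ifs with h
  · exact Finset.sum_eq_single_of_mem μ h fun lam _ hne => by
      rw [form_jack_of_ne hm hne, mul_zero]
  · exact Finset.sum_eq_zero fun lam hlam => by
      rw [form_jack_of_ne hm fun hne : lam = μ => h (hne ▸ hlam), mul_zero]

theorem linearIndependent_jack (hm : 0 < m) : LinearIndependent ℂ (jack hm) := by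
  classical
  rw [linearIndependent_iff']
  intro S c h μ hμ
  have h1 := form_sum_jack hm S c μ
  rw [h, map_zero, LinearMap.zero_apply, if_pos hμ] at h1
  exact (mul_eq_zero.mp h1.symm).resolve_right (form_jack_self_ne_zero hm μ)

theorem mem_span_range_jack (hm : 0 < m) (f : SymFun) :
    f ∈ Submodule.span ℂ (Set.range (jack hm)) := by
  rw [eq_sum_mono f]
  exact Submodule.sum_mem _ fun μ _ => Submodule.smul_mem _ _
    (Submodule.span_mono (Set.image_subset_range _ _)
      (mono_mem_span_of_triangular (mono_sub_jack_mem hm) μ))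

/-- The coefficient of J_μ in f is the pairing with J_μ divided by a nonzero norm. -/
theorem mem_span_jack_of_form (hm : 0 < m) {S : Set YoungDiagram} {f : SymFun}
    (h : ∀ μ ∉ S, form (fun s => (m : ℂ)⁻¹ * ((s : ℕ) : ℂ)) f (jack hm μ) = 0) :
    f ∈ Submodule.span ℂ (jack hm '' S) := by
  classical
  obtain ⟨c, rfl⟩ := Finsupp.mem_span_range_iff_exists_finsupp.mp (mem_span_range_jack hm f)
  refine Submodule.sum_mem _ fun μ hμ => Submodule.smul_mem _ _ (Submodule.subset_span ⟨μ, ?_, rfl⟩)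
  by_contra hS
  have h1 := h μ hS
  rw [Finsupp.sum, form_sum_jack hm c.support c μ, if_pos hμ] at h1
  exact Finsupp.mem_support_iff.mp hμ
    ((mul_eq_zero.mp h1).resolve_right (form_jack_self_ne_zero hm μ))

end JackBasis

/-! ### Words span exactly the Jack polynomials of the rectangle. -/

section Rectangle

theorem InRectangle.colLen_le {s : ℤ} {k : ℕ} {μ : YoungDiagram} (h : InRectangle s k μ) :
    μ.colLen 0 ≤ k := by
  by_contra! hlt
  have h1 := h k
  rw [if_neg (lt_irrefl k)] at h1
  have := (rowLen_pos_iff μ k).mpr hlt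
  omega

theorem InRectangle.rowLen_zero_le {s : ℤ} {k : ℕ} {μ : YoungDiagram} (h : InRectangle s k μ)
    (hk : 0 < k) : (μ.rowLen 0 : ℤ) ≤ s := by
  have h1 := h 0
  rwa [if_pos hk] at h1

theorem finite_inRectangle (s : ℤ) (k : ℕ) : {μ | InRectangle s k μ}.Finite := by
  refine (finite_card_le (k * s.toNat)).subset fun μ hμ => ?_
  change μ.card ≤ _
  rw [card_eq_sum_rowLen μ hμ.colLen_le]
  refine (Finset.sum_le_card_nsmul _ _ s.toNat fun i hi => ?_).trans (by simp)
  have h1 := hμ i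
  rw [if_pos (Finset.mem_range.mp hi)] at h1
  omega

theorem apply_le_rowLen_zero {k : ℕ} {e : Fin k → ℤ} {μ : YoungDiagram}
    (h : shapeZ e = (μ.rowLens : Multiset ℕ)) (i : Fin k) : e i ≤ μ.rowLen 0 := by
  rcases le_or_gt (e i) 0 with h0 | h0
  · exact h0.trans (by positivity)
  · have h1 : (e i).toNat ∈ (μ.rowLens : Multiset ℕ) := by
      rw [← h]
      exact mem_shapeOn.mpr ⟨by omega, i, Finset.mem_univ i, rfl⟩
    rw [Multiset.mem_coe, YoungDiagram.rowLens, List.mem_map] at h1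
    obtain ⟨j, -, hj⟩ := h1
    have h2 := μ.rowLen_anti 0 j (Nat.zero_le j)
    omega

theorem rowLen_zero_le {k : ℕ} {e : Fin k → ℤ} {μ : YoungDiagram} {N : ℤ}
    (h : shapeZ e = (μ.rowLens : Multiset ℕ)) (hN : 0 ≤ N) (he : ∀ i, e i ≤ N) :
    (μ.rowLen 0 : ℤ) ≤ N := by
  rcases Nat.eq_zero_or_pos (μ.rowLen 0) with h0 | h0
  · rw [h0]; exact hN
  · have h1 : μ.rowLen 0 ∈ (μ.rowLens : Multiset ℕ) := by
      rw [Multiset.mem_coe, YoungDiagram.rowLens, List.mem_map]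
      exact ⟨0, List.mem_range.mpr ((rowLen_pos_iff μ 0).mp h0), rfl⟩
    rw [← h] at h1
    obtain ⟨-, i, -, hi⟩ := mem_shapeOn.mp h1
    have := he i
    omega

theorem DominatedBy.rowLen_zero_le {μ lam : YoungDiagram} (h : DominatedBy μ lam) :
    μ.rowLen 0 ≤ lam.rowLen 0 := by
  simpa using h.2 1

variable {m : ℕ}

theorem form_wordFock_eq_coeff (hm : 0 < m) (p : ℤ) (k : ℕ) : ∃ ε : ℂ, ε ≠ 0 ∧
    ∀ (n : Fin k → ℤ) (g : SymFun),
      form (fun s => (m : ℂ)⁻¹ * ((s : ℕ) : ℂ)) (toSymFun m (wordFock m p k n)) g =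
        ε * (fullPow k (((k : ℤ) - 1) * m) * restrict k g * torusWeight k m 1).coeff
          fun i => p - 1 - n i := by
  obtain ⟨ε, hε, h⟩ := vand_pow_eq k m
  refine ⟨ε, hε, fun n g => ?_⟩
  rw [form_wordFock hm, h, mul_smul_comm, map_smul, smul_eq_mul]
  congr 1
  rw [show restrict k g * AddMonoidAlgebra.single (fun i => n i + 1 - p) 1 *
      (fullPow k (((k : ℤ) - 1) * m) * torusWeight k m 1) =
    (fullPow k (((k : ℤ) - 1) * m) * restrict k g * torusWeight k m 1) *
      AddMonoidAlgebra.single (fun i => n i + 1 - p) 1 by ring, constTerm_apply,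
    AddMonoidAlgebra.coeff_mul_single_apply, mul_one]
  congr 1
  funext i
  change (0 : ℤ) + -(n i + 1 - p) = p - 1 - n i
  ring

/-- The exponents p - 1 - n_i are at most p - 1, hence so is the first row of every ν dominated by
their shape. Failing to fit in the rectangle means lam_0 + (k-1)m > p - 1, so lam + ((k-1)m) ^ k is
none of these ν and torus orthogonality applies. -/
theorem form_wordFock_jack (hm : 0 < m) {p : ℤ} (hp : 0 < p) {k : ℕ} {n : Fin k → ℤ}
    (hn : ∀ i, 0 ≤ n i ∧ n i < p) {lam : YoungDiagram}
    (hlam : ¬ InRectangle (p - ((k : ℤ) - 1) * m - 1) k lam) :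
    form (fun s => (m : ℂ)⁻¹ * ((s : ℕ) : ℂ)) (toSymFun m (wordFock m p k n)) (jack hm lam) = 0 := by
  obtain ⟨ε, -, h⟩ := form_wordFock_eq_coeff hm p k
  rw [h]
  rcases lt_or_ge k (lam.colLen 0) with hk | hk
  · rw [restrict_jack_eq_zero hm hk]
    simp
  · obtain ⟨i, hi⟩ := not_forall.mp hlam
    rw [not_le] at hi
    have hik : i < k := by
      by_contra hik
      rw [if_neg hik, rowLen_eq_zero (hk.trans (not_lt.mp hik))] at hi
      simp at hi
    rw [if_pos hik] at hi
    have h0 := lam.rowLen_anti 0 i (Nat.zero_le i)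
    have hc : (((k - 1) * m : ℕ) : ℤ) = ((k : ℤ) - 1) * m := by
      push_cast [Nat.cast_sub (show 1 ≤ k by omega)]
      rfl
    have hν : ∀ i, 0 ≤ p - 1 - n i := fun i => by have := hn i; omega
    obtain ⟨κ, hκ⟩ := exists_shapeZ_eq fun i => p - 1 - n i
    have hκ0 : (κ.rowLen 0 : ℤ) ≤ p - 1 :=
      rowLen_zero_le hκ (by omega) fun i => by have := hn i; omega
    have h1 := torusForm_jack_mono hm (c := (k - 1) * m) (κ := κ) hk fun ν hν _ => by
      refine ⟨0, by omega, fun h2 => ?_⟩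
      have h3 := hν.rowLen_zero_le
      have h4 : ((lam.rowLen 0 : ℤ)) + ((k : ℤ) - 1) * m = ν.rowLen 0 := by
        rw [← hc]; exact_mod_cast h2
      linarith [(Nat.cast_le (α := ℤ)).mpr h0, (Nat.cast_le (α := ℤ)).mpr h3]
    rw [hc] at h1
    rw [coeff_eq_zero_of_torusForm_mono hν hκ h1, mul_zero]

theorem bounds_of_coeff_restrict_jack (hm : 0 < m) {s : ℤ} {k : ℕ} {lam : YoungDiagram}
    (hlam : InRectangle s k lam) {e : Fin k → ℤ} (he : (restrict k (jack hm lam)).coeff e ≠ 0)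
    (i : Fin k) : 0 ≤ e i ∧ e i ≤ s := by
  have he0 : ∀ i, 0 ≤ e i := by
    by_contra hneg
    exact he (coeff_restrict_of_neg hneg)
  obtain ⟨μ, hμ⟩ := exists_shapeZ_eq e
  rw [coeff_restrict he0 hμ] at he
  have h1 := (dominatedBy_of_symCoeff_jack hm he).rowLen_zero_le
  have h2 := hlam.rowLen_zero_le (lt_of_le_of_lt (Nat.zero_le i) i.isLt)
  have h3 := apply_le_rowLen_zero hμ i
  exact ⟨he0 i, by linarith [(Nat.cast_le (α := ℤ)).mpr h1]⟩

/-- The span of the vectors `a_{n 0} ⋯ a_{n (k - 1)} v_p`, as a space of symmetric functions. -/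
theorem map_span_wordFock (hm : 0 < m) {p : ℤ} (hp : 0 < p) (k : ℕ) :
    (Submodule.span ℂ {u | ∃ n : Fin k → ℤ, (∀ i, 0 ≤ n i ∧ n i < p) ∧
      u = wordFock m p k n}).map (toSymFun m).toLinearMap =
      Submodule.span ℂ (jack hm '' {μ | InRectangle (p - ((k : ℤ) - 1) * m - 1) k μ}) := by
  classical
  set R := {μ | InRectangle (p - ((k : ℤ) - 1) * m - 1) k μ} with hR
  set W := (Submodule.span ℂ {u | ∃ n : Fin k → ℤ, (∀ i, 0 ≤ n i ∧ n i < p) ∧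
      u = wordFock m p k n}).map (toSymFun m).toLinearMap with hW
  have hle : W ≤ Submodule.span ℂ (jack hm '' R) := by
    rw [hW, Submodule.map_span, Submodule.span_le]
    rintro _ ⟨_, ⟨n, hn, rfl⟩, rfl⟩
    exact mem_span_jack_of_form hm fun μ hμ => form_wordFock_jack hm hp hn hμ
  refine le_antisymm hle (Submodule.span_le.mpr ?_)
  rintro _ ⟨μ, hμ, rfl⟩
  by_contra hmem
  -- A functional vanishing on all words but not on J_μ will be represented by an element y of the
  -- span of the rectangle.
  obtain ⟨φ', hφ, hφ'⟩ := Submodule.exists_dual_map_eq_bot_of_notMem hmem inferInstance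
  set S := (finite_inRectangle (p - ((k : ℤ) - 1) * m - 1) k).toFinset with hS
  have hS' : ∀ lam, lam ∈ S ↔ InRectangle (p - ((k : ℤ) - 1) * m - 1) k lam := by simp [hS]
  -- These are the coordinates, in the orthogonal Jack basis, of the element representing the
  -- functional.
  set c : YoungDiagram → ℂ := fun lam => φ' (jack hm lam) /
    form (fun s => (m : ℂ)⁻¹ * ((s : ℕ) : ℂ)) (jack hm lam) (jack hm lam) with hc
  set y := ∑ lam ∈ S, c lam • jack hm lam with hy
  have h1 : ∀ w ∈ Submodule.span ℂ (jack hm '' R),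
      form (fun s => (m : ℂ)⁻¹ * ((s : ℕ) : ℂ)) y w = φ' w := by
    intro w hw
    induction hw using Submodule.span_induction with
    | mem x hx =>
      obtain ⟨lam, hlam, rfl⟩ := hx
      rw [hy, form_sum_jack, if_pos ((hS' lam).mpr hlam), hc,
        div_mul_cancel₀ _ (form_jack_self_ne_zero hm lam)]
    | zero => rw [map_zero, map_zero]
    | add x y _ _ hx hy => rw [map_add, map_add, hx, hy]
    | smul a x _ hx => rw [map_smul, map_smul, hx]
  obtain ⟨ε, hε, h2⟩ := form_wordFock_eq_coeff hm p k
  have h3 : ∀ n : Fin k → ℤ, (∀ i, 0 ≤ n i ∧ n i < p) →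
      (fullPow k (((k : ℤ) - 1) * m) * restrict k y * torusWeight k m 1).coeff
        (fun i => p - 1 - n i) = 0 := by
    intro n hn
    have hw : toSymFun m (wordFock m p k n) ∈ W :=
      Submodule.mem_map_of_mem (Submodule.subset_span ⟨n, hn, rfl⟩)
    have h4 := h1 _ (hle hw)
    have h5 : φ' (toSymFun m (wordFock m p k n)) ∈ W.map φ' := Submodule.mem_map_of_mem hw
    rw [hφ', Submodule.mem_bot] at h5
    rw [h5, form_symm, h2] at h4
    exact (mul_eq_zero.mp h4).resolve_left hε
  -- The exponents of y lie in [0, p - (k-1)m - 1]. Shifted by (k-1)m they stay within [0, p - 1],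
  -- where words give vanishing coefficients. So y · weight vanishes on the support of y.
  have h4 : restrict k y = 0 := by
    refine eq_zero_of_coeff_mul_torusWeight (m := m) fun e he => ?_
    rw [hy, map_sum, AddMonoidAlgebra.coeff_sum, Finsupp.finsetSum_apply] at he
    obtain ⟨lam, hlam, hne⟩ := Finset.exists_ne_zero_of_sum_ne_zero he
    have hb := bounds_of_coeff_restrict_jack hm ((hS' lam).mp hlam) (e := e) (fun h0 => hne (by
      rw [map_smul, AddMonoidAlgebra.coeff_smul, Finsupp.smul_apply, h0, smul_zero]))
    have h5 := h3 (fun i => p - 1 - (e i + ((k : ℤ) - 1) * m)) fun i => by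
      have hk : (0 : ℤ) ≤ ((k : ℤ) - 1) * m :=
        mul_nonneg (by have := i.isLt; omega) (by positivity)
      have := hb i
      constructor <;> linarith
    rw [mul_assoc, fullPow, AddMonoidAlgebra.coeff_single_mul_apply, one_mul] at h5
    rw [← h5]
    congr 1
    funext i
    simp only [Pi.add_apply, Pi.neg_apply]
    ring
  have h5 := sum_jack_eq_zero hm (fun lam hlam => ((hS' lam).mp hlam).colLen_le) h4 μ
    ((hS' μ).mpr hμ)
  rw [hc, div_eq_zero_iff] at h5
  exact h5.elim hφ (form_jack_self_ne_zero hm μ)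

end Rectangle

end BosonicVertex

end

/-! ### The theorem, transported back from Λ to the Fock space. -/

open BosonicVertex in
theorem mainTheorem1 (m : ℕ) (hm : 0 < m) :
    (∃! J : YoungDiagram → BosonicVertex.SymFun, BosonicVertex.IsJackFamily (m : ℂ) J) ∧
    ∀ J : YoungDiagram → BosonicVertex.SymFun, BosonicVertex.IsJackFamily (m : ℂ) J →
      ∀ (p : ℤ), 0 < p → ∀ k : ℕ,
        ∃ b : Module.Basis
            {μ : YoungDiagram // BosonicVertex.InRectangle (p - ((k : ℤ) - 1) * m - 1) k μ} ℂ
            (BosonicVertex.component m p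
              (-(p : ℝ) / √(2 * (m : ℝ)) + (k : ℝ) * √(2 * (m : ℝ)))),
          ∀ μ, (b μ : BosonicVertex.FockSum) =
            Finsupp.single (-p + 2 * m * k) (BosonicVertex.ofSymFun m (J μ.1)) := by
  refine ⟨existsUnique_isJackFamily hm, fun J hJ p hp k => ?_⟩
  rw [hJ.eq_jack hm]
  set F : SymFun →ₗ[ℂ] FockSum :=
    Finsupp.lsingle (-p + 2 * m * k) ∘ₗ (ofSymFun m).toLinearMap with hF
  have hker : LinearMap.ker F = ⊥ := by
    rw [LinearMap.ker_eq_bot]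
    exact (Finsupp.single_injective _).comp
      (Function.LeftInverse.injective (toSymFun_ofSymFun m hm))
  have hli : LinearIndependent ℂ fun μ : {μ : YoungDiagram //
      InRectangle (p - ((k : ℤ) - 1) * m - 1) k μ} => F (jack hm μ.1) :=
    ((linearIndependent_jack hm).comp _ Subtype.val_injective).map' F hker
  have hspan : Submodule.span ℂ (Set.range fun μ : {μ : YoungDiagram //
      InRectangle (p - ((k : ℤ) - 1) * m - 1) k μ} => F (jack hm μ.1)) =
      component m p (-(p : ℝ) / √(2 * (m : ℝ)) + (k : ℝ) * √(2 * (m : ℝ))) := by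
    have h1 : (Set.range fun μ : {μ : YoungDiagram //
        InRectangle (p - ((k : ℤ) - 1) * m - 1) k μ} => F (jack hm μ.1)) =
        F '' (jack hm '' {μ | InRectangle (p - ((k : ℤ) - 1) * m - 1) k μ}) := by
      rw [Set.image_image, Set.image_eq_range]
      rfl
    rw [h1, ← Submodule.map_span, ← map_span_wordFock hm hp, component_eq_map hm,
      ← Submodule.map_comp]
    exact congrArg (fun G => Submodule.map G _) (LinearMap.ext fun f : Fock =>
      congrArg (Finsupp.single (-p + 2 * m * k)) (ofSymFun_toSymFun m hm f))
  refine ⟨(Module.Basis.span hli).map (LinearEquiv.ofEq _ _ hspan), fun μ => ?_⟩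
  rw [Module.Basis.map_apply, LinearEquiv.coe_ofEq_apply, Module.Basis.span_apply]
  rfl
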